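/- **Setting.** Let $M$ be a connected $C^\infty$-manifold without boundary of dimension $n\ge2$, and let $L\colon TM\to\mathbb R$ be a Lorentz–Finsler structure: $L$ is $C^\infty$ on $TM\setminus\{0\}$, $L(cv)=c^2L(v)$ for $c>0$, and for every $v\neq0$ the matrix $g_{ij}(v)=\partial^2L/\partial v^i\partial v^j(v)$, which defines the inner product $g_v$, has signature $(-,+,\dots,+)$. Put $\Omega'_x=\{v\in T_xM: L(v)<0\}$ (timelike vectors) and $F(v)=\sqrt{-2L(v)}$ for $v$ with $L(v)\le0$. Let $M$ be time oriented by a smooth timelike vector field $X$, and let $\Omega_x$ be the set of those $v\in\Omega'_x$ that lie in the same connected component of $\overline{\Omega'_x}\setminus\{0\}$ as $X(x)$; $\Omega=\bigcup_x\Omega_x$. Let $\mathfrak m$ be a positive $C^\infty$-measure on $M$, $\mathfrak m=e^{\Phi}dx^1\cdots dx^n$ in coordinates. In local coordinates let $$\gamma^i_{jk}=\tfrac12\sum_l g^{il}\Big(\frac{\partial g_{lk}}{\partial x^j}+\frac{\partial g_{jl}}{\partial x^k}-\frac{\partial g_{jk}}{\partial x^l}\Big),\quad G^i(v)=\sum_{j,k}\gamma^i_{jk}(v)v^jv^k,\quad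 N^i_j=\tfrac12\frac{\partial G^i}{\partial v^j},$$ $$\Gamma^i_{jk}=\gamma^i_{jk}-\tfrac12\sum_{l,m}g^{il}\Big(\frac{\partial g_{lk}}{\partial v^m}N^m_j+\frac{\partial g_{jl}}{\partial v^m}N^m_k-\frac{\partial g_{jk}}{\partial v^m}N^m_l\Big),$$ $$D^w_vX=\sum_{i,j}\Big(v^j\frac{\partial X^i}{\partial x^j}+\sum_k\Gamma^i_{jk}(w)v^jX^k\Big)\frac{\partial}{\partial x^i},$$ $$R^i_j(v)=\frac{\partial G^i}{\partial x^j}-\sum_k\Big(\frac{\partial N^i_j}{\partial x^k}v^k-\frac{\partial N^i_j}{\partial v^k}G^k+N^i_kN^k_j\Big),\qquad \mathrm{Ric}(v)=\sum_iR^i_i(v).$$ Geodesics are the solutions of $D^{\dot\eta}_{\dot\eta}\dot\eta=0$, and $\exp$ is the exponential map. Define $\psi_{\mathfrak m}(v)$ for $v\in\Omega$ by $e^{\Phi}=e^{-\psi_{\mathfrak m}(v)}\sqrt{-\det(g_{ij}(v))}$ and, with $\eta$ the geodesic with $\dot\eta(0)=v$, $$\mathrm{Ric}_0(v)=\mathrm{Ric}(v)+(\psi_{\mathfrak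 m}\circ\dot\eta)''(0)+\frac{(\psi_{\mathfrak m}\circ\dot\eta)'(0)^2}{n}.$$ Let $\Omega^*_x=\{\omega\in T^*_xM:\omega(v)<0\ \text{for all }v\in\overline{\Omega}_x\setminus\{0\}\}$ and, for $\omega\in\Omega_x^*$, $L^*(\omega)=-\frac12\big(\sup\{\omega(v):v\in\Omega_x,\ F(v)=1\}\big)^2$; the Legendre transform of $\omega$ is the unique $v\in\Omega_x$ with $L(v)=L^*(\omega)=\omega(v)/2$. Let $U\subset M$ be open and let $h\in C^3(U)$ be such that $-h$ is temporal, that is, $dh(x)\in\Omega^*_x$ for all $x\in U$. Then $\nabla h(x)\in\Omega_x$ denotes the Legendre transform of $dh(x)$, and $\nabla^2_vh=\nabla^2h(v)=D^{\nabla h}_v[\nabla h]$, $\square h=\mathrm{trace}\,\nabla^2h$, $\square_{\mathfrak m}h=\square h-(\psi_{\mathfrak m}\circ\dot\eta)'(0)$ with $\eta$ the geodesic with initial velocity $\nabla h$; also $\mathrm{div}_{\mathfrak m}V=\sum_i\big(\partial V^i/\partial x^i+V^i\,\partial\Phi/\partial x^i\big)$ and $\nabla^{\nabla h}u=\sum_{i,j}g^{ij}(\nabla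 h)\frac{\partial u}{\partial x^j}\frac{\partial}{\partial x^i}$. **Lemma 4.5.** Suppose $\mathrm{Ric}_0(v)\ge0$ for all $v\in\Omega$. Let $x\in U$, let $\zeta(t)=\exp_x(t\nabla h(x))$ and $w(\zeta(t))=e^{2\psi_{\mathfrak m}(\dot\zeta(t))/n}$ for $t$ near $0$, and let $(e_i)_{i=1}^n$ be an orthonormal basis of $(T_xM,g_{\nabla h})$ (that is, $g_{\nabla h}(e_1,e_1)=-1$, $g_{\nabla h}(e_i,e_i)=1$ for $i\ge2$ and $g_{\nabla h}(e_i,e_j)=0$ for $i\ne j$) with $e_1=\nabla h(x)/F(\nabla h(x))$. Then, at $x$, $$w\,\mathrm{div}_{\mathfrak m}\Big(\nabla^{\nabla h}\Big[\frac{F(\nabla h)^2}{2}\Big]\Big)+d(w\square_{\mathfrak m}h)(\nabla h)+w\frac{(\square_{\mathfrak m}h)^2}{n}\le\frac{w}{2F(\nabla h)^2}\sum_{\alpha=2}^n\Big(d\big[F(\nabla h)^2\big](e_\alpha)\Big)^2,$$ where $d(w\square_{\mathfrak m}h)(\nabla h)=\frac{d}{dt}\big|_{t=0}\big[w(\zeta(t))\,\square_{\mathfrak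 m}h(\zeta(t))\big]$. Moreover, if $F(\nabla h)$ is constant on $U$, then equality holds at $x$ if and only if $\mathrm{Ric}_0(\nabla h(x))=0$ and there is $c\in\mathbb R$ with $\nabla^2_vh=cv$ for all $v\in T_xM$. -/

import Mathlib

open scoped Manifold ContDiff Topology

noncomputable section

namespace FinslerST

/-- The coordinate space `ℝⁿ`. -/
abbrev Vec (n : ℕ) := EuclideanSpace ℝ (Fin n)

/-! ## Coordinate calculus

Throughout this part `Λ : Vec n → Vec n → ℝ` is the expression `(x, v) ↦ L(x, v)` of a
Lorentz--Finsler structure in fibrewise linear coordinates, and `Φ : Vec n → ℝ` is the logarithm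
of the density of the measure, `𝔪 = exp(Φ) dx¹ ⋯ dxⁿ`. -/

section Coordinates

variable {n : ℕ}

/-- The partial derivative `∂f/∂xⁱ` at `q`. -/
def pd (i : Fin n) (f : Vec n → ℝ) (q : Vec n) : ℝ :=
  fderiv ℝ f q (EuclideanSpace.single i 1)

/-- The matrix `g_{ij}(v) = ∂²L/∂vⁱ∂vʲ`. -/
def gMat (Λ : Vec n → Vec n → ℝ) (q v : Vec n) : Matrix (Fin n) (Fin n) ℝ :=
  Matrix.of fun i j => pd i (fun v' => pd j (Λ q) v') v

/-- The inverse matrix `g^{ij}(v)`. -/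
def gInv (Λ : Vec n → Vec n → ℝ) (q v : Vec n) : Matrix (Fin n) (Fin n) ℝ :=
  (gMat Λ q v)⁻¹

/-- The formal Christoffel symbols `γ^i_{jk}(v)`. -/
def formalChristoffel (Λ : Vec n → Vec n → ℝ) (q v : Vec n) (i j k : Fin n) : ℝ :=
  (1 / 2) * ∑ l, gInv Λ q v i l *
    (pd j (fun q' => gMat Λ q' v l k) q + pd k (fun q' => gMat Λ q' v j l) q
      - pd l (fun q' => gMat Λ q' v j k) q)

/-- The spray coefficients `G^i(v) = ∑ γ^i_{jk}(v) vʲ vᵏ`. -/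
def spray (Λ : Vec n → Vec n → ℝ) (q v : Vec n) (i : Fin n) : ℝ :=
  ∑ j, ∑ k, formalChristoffel Λ q v i j k * v j * v k

/-- The nonlinear connection `N^i_j(v) = (1/2) ∂G^i/∂vʲ`. -/
def nonlinConn (Λ : Vec n → Vec n → ℝ) (q v : Vec n) (i j : Fin n) : ℝ :=
  (1 / 2) * pd j (fun v' => spray Λ q v' i) v

/-- The coefficients `Γ^i_{jk}(v)` of the Chern connection. -/
def chern (Λ : Vec n → Vec n → ℝ) (q v : Vec n) (i j k : Fin n) : ℝ :=
  formalChristoffel Λ q v i j k - (1 / 2) * ∑ l, ∑ m, gInv Λ q v i l *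
    (pd m (fun v' => gMat Λ q v' l k) v * nonlinConn Λ q v m j
      + pd m (fun v' => gMat Λ q v' j l) v * nonlinConn Λ q v m k
      - pd m (fun v' => gMat Λ q v' j k) v * nonlinConn Λ q v m l)

/-- The covariant derivative `D_v^w X` at `q`, with reference vector `w`. -/
def covDeriv (Λ : Vec n → Vec n → ℝ) (q w v : Vec n) (X : Vec n → Vec n) : Vec n :=
  WithLp.toLp 2 fun i => ∑ j, (v j * pd j (fun q' => X q' i) q
    + ∑ k, chern Λ q w i j k * v j * X q k)

/-- The curvature tensor `R^i_j(v)`. -/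
def curvature (Λ : Vec n → Vec n → ℝ) (q v : Vec n) (i j : Fin n) : ℝ :=
  pd j (fun q' => spray Λ q' v i) q
    - ∑ k, (pd k (fun q' => nonlinConn Λ q' v i j) q * v k
      - pd k (fun v' => nonlinConn Λ q v' i j) v * spray Λ q v k
      + nonlinConn Λ q v i k * nonlinConn Λ q v k j)

/-- The Ricci curvature `Ric(v) = trace R_v`. -/
def ricci (Λ : Vec n → Vec n → ℝ) (q v : Vec n) : ℝ :=
  ∑ i, curvature Λ q v i i

/-- `η` solves the geodesic equation `D_{η'}^{η'} η' = 0` near `t = 0`, with `η(0) = q` and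
`η'(0) = v`. -/
def IsGeodesicFrom (Λ : Vec n → Vec n → ℝ) (q v : Vec n) (η : ℝ → Vec n) : Prop :=
  η 0 = q ∧ deriv η 0 = v ∧ ∀ᶠ t in 𝓝 (0 : ℝ),
    DifferentiableAt ℝ η t ∧
    HasDerivAt (deriv η) (WithLp.toLp 2 fun i => - ∑ j, ∑ k,
      chern Λ (η t) (deriv η t) i j k * deriv η t j * deriv η t k) t

/-- The geodesic `t ↦ exp_q(t v)`, for `t` near `0`. -/
def geodesic (Λ : Vec n → Vec n → ℝ) (q v : Vec n) : ℝ → Vec n :=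
  Classical.epsilon (IsGeodesicFrom Λ q v)

/-- The weight function `ψ_𝔪`, determined by `exp(Φ) = exp(-ψ_𝔪(v)) √(-det g_{ij}(v))`. -/
def psi (Λ : Vec n → Vec n → ℝ) (Φ : Vec n → ℝ) (q v : Vec n) : ℝ :=
  Real.log (Real.sqrt (-(gMat Λ q v).det)) - Φ q

/-- The function `t ↦ ψ_𝔪(η'(t))`, where `η` is the geodesic with `η'(0) = v`. -/
def psiAlong (Λ : Vec n → Vec n → ℝ) (Φ : Vec n → ℝ) (q v : Vec n) (t : ℝ) : ℝ :=
  psi Λ Φ (geodesic Λ q v t) (deriv (geodesic Λ q v) t)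

/-- The weighted Ricci curvature `Ric_N(v)` for a real number `N ≠ n`. -/
def weightedRicciCoord (Λ : Vec n → Vec n → ℝ) (Φ : Vec n → ℝ) (N : ℝ) (q v : Vec n) : ℝ :=
  ricci Λ q v + iteratedDeriv 2 (psiAlong Λ Φ q v) 0
    - (deriv (psiAlong Λ Φ q v) 0) ^ 2 / (N - n)

/-- The Hessian `∇²h(v) = D_v^{∇h} (∇h)`, where `V = ∇h`. -/
def hessCoord (Λ : Vec n → Vec n → ℝ) (V : Vec n → Vec n) (q v : Vec n) : Vec n :=
  covDeriv Λ q (V q) v V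

/-- The d'Alembertian `□h = trace ∇²h`, where `V = ∇h`. -/
def boxCoord (Λ : Vec n → Vec n → ℝ) (V : Vec n → Vec n) (q : Vec n) : ℝ :=
  ∑ i, hessCoord Λ V q (EuclideanSpace.single i 1) i

/-- The weighted d'Alembertian `□_𝔪 h = □h - (ψ_𝔪 ∘ η')'(0)`, where `V = ∇h` and `η` is the
geodesic with initial velocity `∇h`. -/
def boxMCoord (Λ : Vec n → Vec n → ℝ) (Φ : Vec n → ℝ) (V : Vec n → Vec n) (q : Vec n) : ℝ :=
  boxCoord Λ V q - deriv (psiAlong Λ Φ q (V q)) 0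

/-- The divergence `div_𝔪 W = ∑ (∂Wⁱ/∂xⁱ + Wⁱ ∂Φ/∂xⁱ)`. -/
def divCoord (Φ : Vec n → ℝ) (W : Vec n → Vec n) (q : Vec n) : ℝ :=
  ∑ i, (pd i (fun q' => W q' i) q + W q i * pd i Φ q)

/-- The vector field `∇^V u = ∑ g^{ij}(V) ∂u/∂xʲ ∂/∂xⁱ`. -/
def relGradCoord (Λ : Vec n → Vec n → ℝ) (V : Vec n → Vec n) (u : Vec n → ℝ) (q : Vec n) :
    Vec n :=
  WithLp.toLp 2 fun i => ∑ j, gInv Λ q (V q) i j * pd j u q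

end Coordinates

/-! ## Weighted Finsler spacetimes -/

/-- The fundamental tensor `g_v(a, b)`: the second derivative at `v` of the restriction of `L` to
the tangent space at `x`. -/
def fundTensor {n : ℕ} {M : Type*} [TopologicalSpace M] [ChartedSpace (Vec n) M]
    (L : TangentBundle (𝓡 n) M → ℝ) (x : M) (v a b : TangentSpace (𝓡 n) x) : ℝ :=
  fderiv ℝ (fun v' : Vec n => fderiv ℝ (fun v'' : Vec n => L ⟨x, v''⟩) v' b) v a

/-- `e` is an orthonormal frame of signature `(-, +, …, +)` for `g`, with its first vector
timelike. -/
def IsLorentzOrthonormal {n : ℕ} {T : Type*} (g : T → T → ℝ) (e : Fin n → T) : Prop :=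
  ∀ i j, g (e i) (e j) = if i = j then (if i.val = 0 then -1 else 1) else 0

/-- `Φ` is a smooth logarithmic density of `m` in the chart `c`. -/
def IsLogDensity {n : ℕ} {M : Type*} [TopologicalSpace M] [ChartedSpace (Vec n) M]
    [MeasurableSpace M] (m : MeasureTheory.Measure M) (c : OpenPartialHomeomorph M (Vec n))
    (Φ : Vec n → ℝ) : Prop :=
  ContDiffOn ℝ ∞ Φ c.target ∧ ∀ A : Set (Vec n), MeasurableSet A → A ⊆ c.target →
    m (c.symm '' A) = ∫⁻ q in A, ENNReal.ofReal (Real.exp (Φ q))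

/-- A Lorentz--Finsler structure `L : TM → ℝ`. -/
structure LorentzFinsler (n : ℕ) (M : Type*) [TopologicalSpace M] [ChartedSpace (Vec n) M]
    [IsManifold (𝓡 n) ∞ M] where
  /-- the Lagrangian -/
  L : TangentBundle (𝓡 n) M → ℝ
  smooth : ContMDiffOn (𝓡 n).tangent 𝓘(ℝ, ℝ) ∞ L {v | v.2 ≠ 0}
  homogeneous : ∀ (x : M) (v : TangentSpace (𝓡 n) x) (c : ℝ), 0 < c →
    L ⟨x, c • v⟩ = c ^ 2 * L ⟨x, v⟩
  /-- a frame as below exists exactly if `g_v` is non-degenerate with signature `(-,+,…,+)` -/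
  lorentzian : ∀ (x : M) (v : TangentSpace (𝓡 n) x), v ≠ 0 →
    ∃ e : Fin n → TangentSpace (𝓡 n) x, IsLorentzOrthonormal (fundTensor L x v) e

/-- A Finsler spacetime: a Lorentz--Finsler manifold time oriented by a smooth timelike vector
field `X`. -/
structure FinslerSpacetime (n : ℕ) (M : Type*) [TopologicalSpace M] [ChartedSpace (Vec n) M]
    [IsManifold (𝓡 n) ∞ M] extends LorentzFinsler n M where
  /-- the time orientation -/
  X : (x : M) → TangentSpace (𝓡 n) x
  X_smooth : ContMDiff (𝓡 n) (𝓡 n).tangent ∞ (fun x => (⟨x, X x⟩ : TangentBundle (𝓡 n) M))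
  X_timelike : ∀ x, L ⟨x, X x⟩ < 0

/-- A weighted Finsler spacetime: a Finsler spacetime with a positive smooth measure. -/
structure WeightedFinslerSpacetime (n : ℕ) (M : Type*) [TopologicalSpace M]
    [ChartedSpace (Vec n) M] [IsManifold (𝓡 n) ∞ M] [MeasurableSpace M]
    extends FinslerSpacetime n M where
  /-- the measure -/
  m : MeasureTheory.Measure M
  m_smooth : ∀ c ∈ IsManifold.maximalAtlas (𝓡 n) ∞ M, ∃ Φ : Vec n → ℝ, IsLogDensity m c Φ

namespace FinslerSpacetime

variable {n : ℕ} {M : Type*} [TopologicalSpace M] [ChartedSpace (Vec n) M]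
  [IsManifold (𝓡 n) ∞ M] (S : FinslerSpacetime n M)

/-- `F(v) = √(-2 L(v))`. -/
def F (x : M) (v : TangentSpace (𝓡 n) x) : ℝ := Real.sqrt (-2 * S.L ⟨x, v⟩)

/-- The set `Ω'_x` of timelike vectors. -/
def timelike (x : M) : Set (TangentSpace (𝓡 n) x) := {v | S.L ⟨x, v⟩ < 0}

/-- The set `Ω_x` of future-directed timelike vectors: those in the same connected component of
`closure Ω'_x ∖ {0}` as `X(x)`. -/
def future (x : M) : Set (TangentSpace (𝓡 n) x) :=
  S.timelike x ∩ connectedComponentIn (closure (S.timelike x) \ {0}) (S.X x)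

/-- The polar cone `Ω*_x`. -/
def polar (x : M) : Set (TangentSpace (𝓡 n) x →L[ℝ] ℝ) :=
  {ξ | ∀ v ∈ closure (S.future x) \ {0}, ξ v < 0}

/-- The dual structure `L*(ξ) = -(1/2) (sup {ξ(v) | v ∈ Ω_x, F(v) = 1})²` for `ξ ∈ Ω*_x`. -/
def dualL (x : M) (ξ : TangentSpace (𝓡 n) x →L[ℝ] ℝ) : ℝ :=
  -(1 / 2) * (sSup (ξ '' {v | v ∈ S.future x ∧ S.F x v = 1})) ^ 2

/-- The Legendre transform: the element `v ∈ Ω_x` with `L(v) = L*(ξ) = ξ(v)/2`. -/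
def legendre (x : M) (ξ : TangentSpace (𝓡 n) x →L[ℝ] ℝ) : TangentSpace (𝓡 n) x :=
  Classical.epsilon fun v => v ∈ S.future x ∧ S.L ⟨x, v⟩ = S.dualL x ξ ∧ S.dualL x ξ = ξ v / 2

/-- The differential `dh(x)` as a covector. -/
def diff (h : M → ℝ) (x : M) : TangentSpace (𝓡 n) x →L[ℝ] ℝ :=
  mfderiv (𝓡 n) 𝓘(ℝ, ℝ) h x

/-- `f` is temporal on the open set `U`: it is `C¹` there and `-df(x) ∈ Ω*_x`. -/
def IsTemporalOn (f : M → ℝ) (U : Set M) : Prop :=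
  ContMDiffOn (𝓡 n) 𝓘(ℝ, ℝ) 1 f U ∧ ∀ x ∈ U, -(diff f x) ∈ S.polar x

/-- The gradient vector `∇h(x)`, the Legendre transform of `dh(x)` (for `-h` temporal). -/
def gradient (h : M → ℝ) (x : M) : TangentSpace (𝓡 n) x := S.legendre x (diff h x)

/-- The expression of `L` in the fibrewise linear coordinates induced by the chart `c`. -/
def coordL (c : OpenPartialHomeomorph M (Vec n)) (q v : Vec n) : ℝ :=
  S.L ⟨c.symm q, mfderiv (𝓡 n) (𝓡 n) c.symm q v⟩

end FinslerSpacetime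

section Charts

variable {n : ℕ} {M : Type*} [TopologicalSpace M] [ChartedSpace (Vec n) M]

/-- The coordinates of the tangent vector `v ∈ T_xM` in the chart `c`. -/
def coordVec (c : OpenPartialHomeomorph M (Vec n)) (x : M) (v : TangentSpace (𝓡 n) x) : Vec n :=
  mfderiv (𝓡 n) (𝓡 n) c x v

/-- The coordinate expression of the vector field `V` in the chart `c`. -/
def coordField (c : OpenPartialHomeomorph M (Vec n)) (V : (x : M) → TangentSpace (𝓡 n) x)
    (q : Vec n) : Vec n :=
  coordVec c (c.symm q) (V (c.symm q))

end Charts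

namespace WeightedFinslerSpacetime

variable {n : ℕ} {M : Type*} [TopologicalSpace M] [ChartedSpace (Vec n) M]
  [IsManifold (𝓡 n) ∞ M] [MeasurableSpace M] (S : WeightedFinslerSpacetime n M)

/-- The function `Φ` with `𝔪 = exp(Φ) dx¹ ⋯ dxⁿ` in the chart `c`
(it is unique on the target of `c`). -/
def logDensity (c : OpenPartialHomeomorph M (Vec n)) : Vec n → ℝ :=
  Classical.epsilon (IsLogDensity S.m c)

/-- The weighted Ricci curvature `Ric_N(v)` of `v ∈ T_xM ∖ {0}`, for real `N ≠ n`. -/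
def weightedRicci (N : ℝ) (x : M) (v : TangentSpace (𝓡 n) x) : ℝ :=
  weightedRicciCoord (S.coordL (chartAt (Vec n) x)) (S.logDensity (chartAt (Vec n) x)) N
    (chartAt (Vec n) x x) (coordVec (chartAt (Vec n) x) x v)

/-- `Ric_N ≥ K` in timelike directions: `Ric_N(v) ≥ K F(v)²` for all `v ∈ Ω`. -/
def RicciBoundedBelow (N K : ℝ) : Prop :=
  ∀ (x : M), ∀ v ∈ S.future x, K * S.F x v ^ 2 ≤ S.weightedRicci N x v

/-- The function `F(∇h)²`. -/
def speedSq (h : M → ℝ) (x : M) : ℝ := S.F x (S.gradient h x) ^ 2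

/-- The Hessian `∇²h : T_xM → T_xM`, in the coordinates of the chart at `x` (which identify
`T_xM` with `ℝⁿ`). -/
def hessian (h : M → ℝ) (x : M) (v : TangentSpace (𝓡 n) x) : TangentSpace (𝓡 n) x :=
  hessCoord (S.coordL (chartAt (Vec n) x)) (coordField (chartAt (Vec n) x) (S.gradient h))
    (chartAt (Vec n) x x) (coordVec (chartAt (Vec n) x) x v)

/-- The weighted d'Alembertian `□_𝔪 h`, as a function of the coordinates of the chart `c`. -/
def boxM (c : OpenPartialHomeomorph M (Vec n)) (h : M → ℝ) : Vec n → ℝ :=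
  boxMCoord (S.coordL c) (S.logDensity c) (coordField c (S.gradient h))

/-- The function `div_𝔪(∇^{∇h} u)`, as a function of the coordinates of the chart `c`. -/
def divRelGrad (c : OpenPartialHomeomorph M (Vec n)) (h u : M → ℝ) : Vec n → ℝ :=
  divCoord (S.logDensity c)
    (relGradCoord (S.coordL c) (coordField c (S.gradient h)) (u ∘ c.symm))

/-- The geodesic `ζ(t) = exp_x(t ∇h(x))`, in the coordinates of the chart `c`. -/
def zeta (c : OpenPartialHomeomorph M (Vec n)) (h : M → ℝ) (x : M) : ℝ → Vec n :=
  geodesic (S.coordL c) (c x) (coordVec c x (S.gradient h x))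

/-- The weight `w(ζ(t)) = exp(2 ψ_𝔪(ζ'(t)) / n)`. -/
def weight (c : OpenPartialHomeomorph M (Vec n)) (h : M → ℝ) (x : M) (t : ℝ) : ℝ :=
  Real.exp (2 * psi (S.coordL c) (S.logDensity c) (S.zeta c h x t) (deriv (S.zeta c h x) t) / n)

/-- The left-hand side
`w div_𝔪(∇^{∇h}[F(∇h)²/2]) + d(w □_𝔪 h)(∇h) + w (□_𝔪 h)²/n` at `x`. As `w` is given along `ζ` and
`ζ'(0) = ∇h(x)`, the middle term is the derivative of `w □_𝔪 h` along `ζ` at `t = 0`. -/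
def wylieLHS (h : M → ℝ) (x : M) : ℝ :=
  S.weight (chartAt (Vec n) x) h x 0 *
      S.divRelGrad (chartAt (Vec n) x) h (fun y => S.speedSq h y / 2) (chartAt (Vec n) x x)
    + deriv (fun t => S.weight (chartAt (Vec n) x) h x t *
        S.boxM (chartAt (Vec n) x) h (S.zeta (chartAt (Vec n) x) h x t)) 0
    + S.weight (chartAt (Vec n) x) h x 0 *
        (S.boxM (chartAt (Vec n) x) h (chartAt (Vec n) x x)) ^ 2 / n

/-- The right-hand side `w / (2 F(∇h)²) ∑_{α=2}^n (d[F(∇h)²](e_α))²` at `x`. -/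
def wylieRHS (h : M → ℝ) (x : M) (e : Fin n → TangentSpace (𝓡 n) x) : ℝ :=
  S.weight (chartAt (Vec n) x) h x 0 / (2 * S.speedSq h x) *
    ∑ α ∈ Finset.univ.filter (fun α : Fin n => α.val ≠ 0),
      (FinslerSpacetime.diff (S.speedSq h) x (e α)) ^ 2

end WeightedFinslerSpacetime

end FinslerST

end

open scoped Manifold ContDiff Topology
open FinslerST

/-!
# A Bochner--Wylie inequality on weighted Finsler spacetimes

Let `V = ∇h` and `A = ∇²h`. The assertion rests on a pointwise identity. Differentiating the
acceleration `D_V^V V = A V` and commuting derivatives gives, for every vector field,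
`div (A V) = d(tr A)(V) + tr (A²) + Ric(V)` in an appropriate sense
(`IsCoordField.sum_pd_accel`; in coordinates `A` is the matrix `∂Vⁱ/∂xʲ + Nⁱ_j(V)`). For the
gradient of a function, `A V` is the negative of the `g_V`-gradient of `F(V)²/2`, because `A` is
self-adjoint and `L` is constant along horizontal curves. The trace of the nonlinear connection is
the derivative of `log √(-det g)` along the spray (`IsCoordLagrangian.trace_nonlinConn`), which
turns unweighted into weighted divergences, and the choice of the weight `w = exp(2ψ/n)` completes
a square. The result (`IsCoordField.weighted_bochner`) is that the left-hand side of the inequality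
equals
`w ((tr A)²/n - tr (A²) - Ric_0(V))`.

What remains is linear algebra (`lorentz_trace_inequality`). With `h_ij = g_V(A e_i, e_j)`, the
quantity `tr (A²) - (tr A)²/n` is `-2 ∑ h_{1α}²` plus a sum of squares, which vanishes only if, apart
from the mixed entries `h_{1α}`, `A` is diagonal in the frame `e` with equal eigenvalues. Moreover
`d[F(V)²](e_α) = -2 F(V) h_{1α}`, so the right-hand side of the inequality is `2 w ∑ h_{1α}²`. If
`F(V)` is constant, the mixed entries vanish, and equality means that both `Ric_0(V)` and the sum of
squares are zero.

The Bochner identity needs `∇h` to be of class `C²`, whereas `∇h` is defined through a supremum over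
unit timelike vectors. The concavity of `F` on timelike segments shows that the future cone of a
tangent space is convex (`IsLorentzMinkowski.segment_timelike`) and that the differential of `L` is
injective on it. Legendre transforms exist by compactness, and the differential of `L` at a Legendre
transform of `ξ` is `ξ` (`IsLorentzMinkowski.fderiv_eq_of_legendre`). Regularity then follows from
the implicit function theorem (`FinslerST.FinslerSpacetime.exists_isCoordField`).
-/

open scoped Manifold ContDiff Topology
open FinslerST

/-! ### Lorentzian bilinear forms -/

/-- The sign `-1` of the time direction, `+1` of the space directions. -/
def lorentzSign {n : ℕ} (i : Fin n) : ℝ := if i.val = 0 then -1 else 1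

theorem lorentzSign_mul_self {n : ℕ} (i : Fin n) : lorentzSign i * lorentzSign i = 1 := by
  unfold lorentzSign; split_ifs <;> norm_num

section Bilinear

variable {n : ℕ} {B : Vec n →L[ℝ] Vec n →L[ℝ] ℝ} {e : Fin n → Vec n}

theorem lorentz_apply_frame (he : IsLorentzOrthonormal (fun a b => B a b) e) (i j : Fin n) :
    B (e i) (e j) = if i = j then lorentzSign i else 0 := he i j

/-- An orthonormal frame of a Lorentzian form gives linear coordinates in which the form is
diagonal. -/
theorem exists_lorentz_coordinates (he : IsLorentzOrthonormal (fun a b => B a b) e) :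
    ∃ b : Module.Basis (Fin n) ℝ (Vec n), (∀ i, b i = e i) ∧
      ∀ u w, B u w = ∑ i, lorentzSign i * b.repr u i * b.repr w i := by
  have hli : LinearIndependent ℝ e := by
    rw [Fintype.linearIndependent_iff]
    intro c hc j
    have h := congrArg (fun z => B z (e j)) hc
    simp only [map_sum, map_smul, sum_apply, smul_apply,
      lorentz_apply_frame he, smul_eq_mul, mul_ite, mul_zero, Finset.sum_ite_eq',
      Finset.mem_univ, if_true, map_zero, zero_apply] at h
    have := lorentzSign_mul_self j
    rcases mul_eq_zero.1 h with h | h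
    · exact h
    · rw [h] at this; norm_num at this
  rcases Nat.eq_zero_or_pos n with h0 | h0
  · subst h0
    refine ⟨Module.Basis.empty _, fun i => i.elim0, fun u w => ?_⟩
    rw [Subsingleton.elim u 0]; simp
  have : Nonempty (Fin n) := ⟨⟨0, h0⟩⟩
  let b := basisOfLinearIndependentOfCardEqFinrank hli (by simp)
  have hb : ∀ i, b i = e i := fun i => by simp [b]
  refine ⟨b, hb, fun u w => ?_⟩
  conv_lhs => rw [← b.sum_repr u, ← b.sum_repr w]
  simp only [map_sum, map_smul, sum_apply, smul_apply, hb,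
      lorentz_apply_frame he, smul_eq_mul, mul_ite, mul_zero, Finset.sum_ite_eq',
      Finset.mem_univ, if_true]
  exact Finset.sum_congr rfl fun i _ => by ring

/-- A vector orthogonal to a causal vector, and not a multiple of it, is spacelike. -/
theorem lorentz_pos_of_orthogonal (hsymm : ∀ a b, B a b = B b a)
    (he : IsLorentzOrthonormal (fun a b => B a b) e) {v u : Vec n} (hv : v ≠ 0)
    (hvv : B v v ≤ 0) (hvu : B v u = 0) (hu : ∀ t : ℝ, u ≠ t • v) : 0 < B u u := by
  obtain ⟨b, -, hb⟩ := exists_lorentz_coordinates he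
  rcases n with _ | m
  · exact absurd (Subsingleton.elim v 0) hv
  have key : ∀ z, B z z = -(b.repr z 0) ^ 2 + ∑ i : Fin m, (b.repr z i.succ) ^ 2 := by
    intro z
    rw [hb, Fin.sum_univ_succ]
    simp [lorentzSign, sq]
  have hzero : ∀ z, b.repr z 0 = 0 → B z z ≤ 0 → z = 0 := by
    intro z h0 hz
    rw [key, h0] at hz
    have h1 : ∑ i : Fin m, (b.repr z i.succ) ^ 2 = 0 :=
      le_antisymm (by simpa using hz) (Finset.sum_nonneg fun i _ => sq_nonneg _)
    rw [Finset.sum_eq_zero_iff_of_nonneg fun i _ => sq_nonneg _] at h1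
    apply b.repr.injective
    ext i
    refine Fin.cases ?_ (fun i => ?_) i
    · simpa using h0
    · simpa using h1 i (Finset.mem_univ _)
  have ha : b.repr v 0 ≠ 0 := fun h => hv (hzero v h hvv)
  set t := b.repr u 0 / b.repr v 0 with ht
  have hw : B (u - t • v) (u - t • v) = B u u + t ^ 2 * B v v := by
    simp only [map_sub, map_smul, sub_apply, smul_apply,
      smul_eq_mul, hsymm u v, hvu]
    ring
  by_contra hcon
  refine hu t (sub_eq_zero.1 (hzero (u - t • v) ?_ ?_))
  · simp [ht, ha]
  · rw [hw]; nlinarith [sq_nonneg t]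

theorem lorentz_pos_of_orthogonal_timelike (hsymm : ∀ a b, B a b = B b a)
    (he : IsLorentzOrthonormal (fun a b => B a b) e) {v u : Vec n}
    (hvv : B v v < 0) (hvu : B v u = 0) (hu : u ≠ 0) : 0 < B u u := by
  have hv : v ≠ 0 := by rintro rfl; simp at hvv
  refine lorentz_pos_of_orthogonal hsymm he hv hvv.le hvu fun t ht => ?_
  rw [ht, map_smul, smul_eq_mul] at hvu
  rcases mul_eq_zero.1 hvu with h | h
  · exact hu (by rw [ht, h, zero_smul])
  · exact hvv.ne h

/-- Reverse Cauchy--Schwarz inequality, in the form `B(u,u) B(v,v) < B(v,u)²`. -/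
theorem lorentz_reverse_cauchy_schwarz (hsymm : ∀ a b, B a b = B b a)
    (he : IsLorentzOrthonormal (fun a b => B a b) e) {v u : Vec n}
    (hvv : B v v < 0) (hu : ∀ t : ℝ, u ≠ t • v) : B u u * B v v < (B v u) ^ 2 := by
  set t := B v u / B v v with ht
  have h1 : B v (u - t • v) = 0 := by
    simp only [map_sub, map_smul, smul_eq_mul, ht]
    field_simp [hvv.ne]; ring
  have h2 := lorentz_pos_of_orthogonal_timelike hsymm he hvv h1 (sub_ne_zero.2 (hu t))
  have h3 : B (u - t • v) (u - t • v) = B u u - (B v u) ^ 2 / B v v := by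
    simp only [map_sub, map_smul, sub_apply, smul_apply,
      smul_eq_mul, hsymm u v, ht]
    field_simp [hvv.ne]; ring
  rw [h3, sub_pos, div_lt_iff_of_neg hvv] at h2
  exact h2

end Bilinear

/-! ### Lorentz--Minkowski functions on a vector space -/

/-- A Lorentz--Minkowski function: the restriction of a Lorentz--Finsler structure to one tangent
space. It is smooth away from the origin, positively homogeneous of degree two, and its second
derivatives away from the origin have signature `(-, +, …, +)`. -/
structure IsLorentzMinkowski {n : ℕ} (l : Vec n → ℝ) : Prop where
  smooth : ContDiffOn ℝ ∞ l {0}ᶜ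
  homogeneous : ∀ (v : Vec n) (c : ℝ), 0 < c → l (c • v) = c ^ 2 * l v
  lorentzian : ∀ v : Vec n, v ≠ 0 → ∃ e : Fin n → Vec n,
    IsLorentzOrthonormal (fun a b => fderiv ℝ (fderiv ℝ l) v a b) e

namespace IsLorentzMinkowski

variable {n : ℕ} {l : Vec n → ℝ} (hl : IsLorentzMinkowski l)
include hl

theorem contDiffAt {v : Vec n} (hv : v ≠ 0) : ContDiffAt ℝ ∞ l v :=
  hl.smooth.contDiffAt (isOpen_compl_singleton.mem_nhds hv)

theorem differentiableAt {v : Vec n} (hv : v ≠ 0) : DifferentiableAt ℝ l v :=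
  (hl.contDiffAt hv).differentiableAt (by simp)

theorem contDiffAt_fderiv {v : Vec n} (hv : v ≠ 0) : ContDiffAt ℝ ∞ (fderiv ℝ l) v :=
  (hl.contDiffAt hv).fderiv_right (by simp)

theorem differentiableAt_fderiv {v : Vec n} (hv : v ≠ 0) : DifferentiableAt ℝ (fderiv ℝ l) v :=
  (hl.contDiffAt_fderiv hv).differentiableAt (by simp)

theorem symm {v : Vec n} (hv : v ≠ 0) (a b : Vec n) :
    fderiv ℝ (fderiv ℝ l) v a b = fderiv ℝ (fderiv ℝ l) v b a :=
  ((hl.contDiffAt hv).isSymmSndFDerivAt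
    (by rw [minSmoothness_of_isRCLikeNormedField]; norm_cast)).eq a b

theorem map_zero : l 0 = 0 := by
  have h := hl.homogeneous 0 2 (by norm_num)
  rw [smul_zero] at h; linarith

theorem ne_zero {v : Vec n} (hv : l v < 0) : v ≠ 0 := by
  rintro rfl; rw [hl.map_zero] at hv; exact lt_irrefl _ hv

theorem continuous : Continuous l := by
  rw [continuous_iff_continuousAt]
  intro v
  by_cases hv : v = 0
  · subst hv
    -- `l` is bounded on the unit sphere, hence `O(|v|²)`
    obtain ⟨C, hC⟩ := (isCompact_sphere (0 : Vec n) 1).exists_bound_of_continuousOn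
      (f := l) (hl.smooth.continuousOn.mono fun v hv h => by
        rw [Set.mem_singleton_iff] at h; subst h; simp at hv)
    have hb : ∀ w : Vec n, |l w| ≤ C * ‖w‖ ^ 2 := by
      intro w
      by_cases hw : w = 0
      · subst hw; simp [hl.map_zero]
      have hn : 0 < ‖w‖ := norm_pos_iff.2 hw
      have h1 := hC (‖w‖⁻¹ • w) (by simp [norm_smul, hn.ne'])
      rw [hl.homogeneous _ _ (inv_pos.2 hn), Real.norm_eq_abs, abs_mul, abs_of_pos (by positivity),
        inv_pow, inv_mul_le_iff₀ (by positivity)] at h1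
      linarith
    rw [ContinuousAt, hl.map_zero]
    refine squeeze_zero_norm (a := fun w => C * ‖w‖ ^ 2) hb ?_
    have : Continuous fun w : Vec n => C * ‖w‖ ^ 2 := by fun_prop
    simpa using this.tendsto 0
  · exact (hl.differentiableAt hv).continuousAt

/-- Euler's identity for `l`. -/
theorem fderiv_self {v : Vec n} (hv : v ≠ 0) : fderiv ℝ l v v = 2 * l v := by
  have h1 : HasDerivAt (fun c : ℝ => l (c • v)) (fderiv ℝ l v v) 1 := by
    have h := (hl.differentiableAt hv).hasFDerivAt
    have h2 : HasDerivAt (fun c : ℝ => c • v) v 1 := by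
      simpa using (hasDerivAt_id (1 : ℝ)).smul_const v
    have h3 : HasFDerivAt l (fderiv ℝ l v) ((1 : ℝ) • v) := by rwa [one_smul]
    exact h3.comp_hasDerivAt 1 h2
  have h2 : HasDerivAt (fun c : ℝ => l (c • v)) (2 * l v) 1 := by
    have h : HasDerivAt (fun c : ℝ => c ^ 2 * l v) (2 * l v) 1 := by
      simpa using (hasDerivAt_pow 2 (1 : ℝ)).mul_const (l v)
    refine h.congr_of_eventuallyEq ?_
    filter_upwards [lt_mem_nhds (zero_lt_one (α := ℝ))] with c hc using hl.homogeneous v c hc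
  exact h1.unique h2

/-- The first derivatives of `l` are homogeneous of degree one. -/
theorem fderiv_smul (v : Vec n) {c : ℝ} (hc : 0 < c) : fderiv ℝ l (c • v) = c • fderiv ℝ l v := by
  have h1 : (fun w => l (c • w)) = c ^ 2 • l := by
    funext w; exact hl.homogeneous w c hc
  have h2 := congrArg (fun f => fderiv ℝ f v) h1
  simp only [fderiv_comp_smul, fderiv_const_smul_field] at h2
  have h3 : c • fderiv ℝ l (c • v) = c • (c • fderiv ℝ l v) := by
    rw [h2, smul_smul, sq]; rfl
  exact smul_right_injective _ hc.ne' h3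

/-- Euler's identity for the first derivatives of `l`. -/
theorem snd_fderiv_self {v : Vec n} (hv : v ≠ 0) (u : Vec n) :
    fderiv ℝ (fderiv ℝ l) v v u = fderiv ℝ l v u := by
  have h1 : HasDerivAt (fun c : ℝ => fderiv ℝ l (c • v)) (fderiv ℝ (fderiv ℝ l) v v) 1 := by
    have h2 : HasDerivAt (fun c : ℝ => c • v) v 1 := by
      simpa using (hasDerivAt_id (1 : ℝ)).smul_const v
    have h3 : HasFDerivAt (fderiv ℝ l) (fderiv ℝ (fderiv ℝ l) v) ((1 : ℝ) • v) := by
      rw [one_smul]; exact (hl.differentiableAt_fderiv hv).hasFDerivAt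
    exact h3.comp_hasDerivAt 1 h2
  have h2 : HasDerivAt (fun c : ℝ => fderiv ℝ l (c • v)) (fderiv ℝ l v) 1 := by
    have h : HasDerivAt (fun c : ℝ => c • fderiv ℝ l v) (fderiv ℝ l v) 1 := by
      simpa using (hasDerivAt_id (1 : ℝ)).smul_const (fderiv ℝ l v)
    refine h.congr_of_eventuallyEq ?_
    filter_upwards [lt_mem_nhds (zero_lt_one (α := ℝ))] with c hc using hl.fderiv_smul v hc
  rw [h1.unique h2]

theorem snd_fderiv_self_self {v : Vec n} (hv : v ≠ 0) :
    fderiv ℝ (fderiv ℝ l) v v v = 2 * l v := by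
  rw [hl.snd_fderiv_self hv, hl.fderiv_self hv]

end IsLorentzMinkowski

/-! ### Concavity of `F` on timelike segments -/

/-- The function `F = √(-2l)` of a Lorentz--Minkowski function `l`. The square root makes it zero
where `l` is positive. -/
noncomputable def lorentzNorm {n : ℕ} (l : Vec n → ℝ) (v : Vec n) : ℝ := Real.sqrt (-2 * l v)

theorem lorentzNorm_sq {n : ℕ} {l : Vec n → ℝ} {v : Vec n} (hv : l v ≤ 0) :
    lorentzNorm l v ^ 2 = -2 * l v :=
  Real.sq_sqrt (by linarith)

theorem lorentzNorm_pos {n : ℕ} {l : Vec n → ℝ} {v : Vec n} (hv : l v < 0) :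
    0 < lorentzNorm l v :=
  Real.sqrt_pos.2 (by linarith)

namespace IsLorentzMinkowski

variable {n : ℕ} {l : Vec n → ℝ} (hl : IsLorentzMinkowski l)
include hl

theorem lorentzNorm_smul (v : Vec n) {c : ℝ} (hc : 0 < c) :
    lorentzNorm l (c • v) = c * lorentzNorm l v := by
  rw [lorentzNorm, hl.homogeneous v c hc, show -2 * (c ^ 2 * l v) = c ^ 2 * (-2 * l v) by ring,
    Real.sqrt_mul (sq_nonneg c), Real.sqrt_sq hc.le, lorentzNorm]

theorem continuous_lorentzNorm : Continuous (lorentzNorm l) :=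
  (continuous_const.mul hl.continuous).sqrt

theorem hasDerivAt_line {p u : Vec n} {s : ℝ} (hs : p + s • u ≠ 0) :
    HasDerivAt (fun r : ℝ => l (p + r • u)) (fderiv ℝ l (p + s • u) u) s := by
  have h2 : HasDerivAt (fun r : ℝ => p + r • u) u s := by
    simpa using ((hasDerivAt_id s).smul_const u).const_add p
  exact (hl.differentiableAt hs).hasFDerivAt.comp_hasDerivAt s h2

theorem hasDerivAt_fderiv_line {p u : Vec n} {s : ℝ} (hs : p + s • u ≠ 0) :
    HasDerivAt (fun r : ℝ => fderiv ℝ l (p + r • u) u)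
      (fderiv ℝ (fderiv ℝ l) (p + s • u) u u) s := by
  have h2 : HasDerivAt (fun r : ℝ => p + r • u) u s := by
    simpa using ((hasDerivAt_id s).smul_const u).const_add p
  have h3 := (hl.differentiableAt_fderiv hs).hasFDerivAt.comp_hasDerivAt s h2
  exact h3.clm_apply (hasDerivAt_const s u) |>.congr_deriv (by simp)

theorem hasDerivAt_lorentzNorm_line {p u : Vec n} {s : ℝ} (hs : l (p + s • u) < 0) :
    HasDerivAt (fun r : ℝ => lorentzNorm l (p + r • u))
      (-(fderiv ℝ l (p + s • u) u) / lorentzNorm l (p + s • u)) s := by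
  have h := ((hl.hasDerivAt_line (hl.ne_zero hs)).const_mul (-2)).sqrt (by nlinarith)
  refine h.congr_deriv ?_
  have := lorentzNorm_pos hs
  rw [lorentzNorm] at this ⊢
  field_simp

/-- The second derivative of `F` along a line; by the reverse Cauchy--Schwarz inequality the
numerator is not positive. -/
theorem deriv2_lorentzNorm_line {p u : Vec n} {s : ℝ} (hs : l (p + s • u) < 0) :
    deriv^[2] (fun r : ℝ => lorentzNorm l (p + r • u)) s =
      (fderiv ℝ (fderiv ℝ l) (p + s • u) u u * fderiv ℝ (fderiv ℝ l) (p + s • u) (p + s • u)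
        (p + s • u) - fderiv ℝ (fderiv ℝ l) (p + s • u) (p + s • u) u ^ 2) /
        lorentzNorm l (p + s • u) ^ 3 := by
  have hev : ∀ᶠ r in 𝓝 s, l (p + r • u) < 0 := by
    have : Continuous fun r : ℝ => l (p + r • u) := hl.continuous.comp (by fun_prop)
    exact this.continuousAt.eventually_lt continuousAt_const hs
  have h1 : deriv (fun r : ℝ => lorentzNorm l (p + r • u)) =ᶠ[𝓝 s]
      fun r => -(fderiv ℝ l (p + r • u) u) / lorentzNorm l (p + r • u) := by
    filter_upwards [hev] with r hr using (hl.hasDerivAt_lorentzNorm_line hr).deriv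
  have hpos := lorentzNorm_pos hs
  have h2 := ((hl.hasDerivAt_fderiv_line (hl.ne_zero hs)).neg).div
    (hl.hasDerivAt_lorentzNorm_line hs) hpos.ne'
  rw [Function.iterate_succ, Function.iterate_one, Function.comp_apply, h1.deriv_eq]
  refine h2.deriv.trans ?_
  rw [hl.snd_fderiv_self_self (hl.ne_zero hs), hl.snd_fderiv_self (hl.ne_zero hs)]
  have h3 : 2 * l (p + s • u) = - lorentzNorm l (p + s • u) ^ 2 := by
    rw [lorentzNorm_sq hs.le]; ring
  rw [h3]
  simp only [Pi.neg_apply]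
  field_simp

theorem deriv2_lorentzNorm_line_neg {p u : Vec n} {s : ℝ} (hs : l (p + s • u) < 0)
    (hu : ∀ t : ℝ, u ≠ t • (p + s • u)) :
    deriv^[2] (fun r : ℝ => lorentzNorm l (p + r • u)) s < 0 := by
  rw [hl.deriv2_lorentzNorm_line hs]
  have h0 := hl.ne_zero hs
  obtain ⟨e, he⟩ := hl.lorentzian _ h0
  have hvv : fderiv ℝ (fderiv ℝ l) (p + s • u) (p + s • u) (p + s • u) < 0 := by
    rw [hl.snd_fderiv_self_self h0]; linarith
  refine div_neg_of_neg_of_pos ?_ (pow_pos (lorentzNorm_pos hs) 3)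
  linarith [lorentz_reverse_cauchy_schwarz (hl.symm h0) he hvv hu]

/-- On radial segments, which `deriv2_lorentzNorm_line_neg` leaves out, `F` is affine. -/
theorem deriv2_lorentzNorm_line_nonpos {p u : Vec n} {s : ℝ} (hs : l (p + s • u) < 0) :
    deriv^[2] (fun r : ℝ => lorentzNorm l (p + r • u)) s ≤ 0 := by
  by_cases hu : ∀ t : ℝ, u ≠ t • (p + s • u)
  · exact (hl.deriv2_lorentzNorm_line_neg hs hu).le
  · push Not at hu
    obtain ⟨t, ht⟩ := hu
    rw [hl.deriv2_lorentzNorm_line hs]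
    generalize hv : p + s • u = v at ht
    rw [ht]
    refine le_of_eq (div_eq_zero_iff.2 (Or.inl ?_))
    simp only [map_smul, smul_apply, smul_eq_mul]
    ring

/-- `F` is concave along timelike segments. -/
theorem concaveOn_lorentzNorm_line {p u : Vec n} (h : ∀ s ∈ Set.Ioo (0 : ℝ) 1, l (p + s • u) < 0) :
    ConcaveOn ℝ (Set.Icc 0 1) fun s : ℝ => lorentzNorm l (p + s • u) := by
  have hc : Continuous fun s : ℝ => lorentzNorm l (p + s • u) :=
    hl.continuous_lorentzNorm.comp (by fun_prop)
  refine concaveOn_of_deriv2_nonpos (convex_Icc 0 1) hc.continuousOn ?_ ?_ ?_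
  · rw [interior_Icc]
    exact fun s hs =>
      (hl.hasDerivAt_lorentzNorm_line (h s hs)).differentiableAt.differentiableWithinAt
  · rw [interior_Icc]
    intro s hs
    refine DifferentiableAt.differentiableWithinAt ?_
    have h1 : deriv (fun r : ℝ => lorentzNorm l (p + r • u)) =ᶠ[𝓝 s]
        fun r => -(fderiv ℝ l (p + r • u) u) / lorentzNorm l (p + r • u) := by
      filter_upwards [isOpen_Ioo.mem_nhds hs] with r hr using
        (hl.hasDerivAt_lorentzNorm_line (h r hr)).deriv
    refine (DifferentiableAt.congr_of_eventuallyEq ?_ h1)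
    exact ((hl.hasDerivAt_fderiv_line (hl.ne_zero (h s hs))).neg.div
      (hl.hasDerivAt_lorentzNorm_line (h s hs)) (lorentzNorm_pos (h s hs)).ne').differentiableAt
  · rw [interior_Icc]
    exact fun s hs => hl.deriv2_lorentzNorm_line_nonpos (h s hs)

theorem strictConcaveOn_lorentzNorm_line {p u : Vec n}
    (h : ∀ s ∈ Set.Ioo (0 : ℝ) 1, l (p + s • u) < 0)
    (hu : ∀ s ∈ Set.Ioo (0 : ℝ) 1, ∀ t : ℝ, u ≠ t • (p + s • u)) :
    StrictConcaveOn ℝ (Set.Icc 0 1) fun s : ℝ => lorentzNorm l (p + s • u) := by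
  have hc : Continuous fun s : ℝ => lorentzNorm l (p + s • u) :=
    hl.continuous_lorentzNorm.comp (by fun_prop)
  refine strictConcaveOn_of_deriv2_neg (convex_Icc 0 1) hc.continuousOn ?_
  rw [interior_Icc]
  exact fun s hs => hl.deriv2_lorentzNorm_line_neg (h s hs) (hu s hs)

theorem lorentzNorm_line_ge {p u : Vec n} (h : ∀ s ∈ Set.Ioo (0 : ℝ) 1, l (p + s • u) < 0)
    {s : ℝ} (hs : s ∈ Set.Icc (0 : ℝ) 1) :
    (1 - s) * lorentzNorm l p + s * lorentzNorm l (p + u) ≤ lorentzNorm l (p + s • u) := by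
  have h1 := (hl.concaveOn_lorentzNorm_line h).2 (Set.left_mem_Icc.2 zero_le_one)
    (Set.right_mem_Icc.2 zero_le_one) (sub_nonneg.2 hs.2) hs.1 (by ring)
  simpa using h1

/-- The differential of `l` is injective on timelike vectors joined by a timelike segment: were
the differentials equal, the end slopes of the strictly concave function `F` on the segment would
force both `F(p) < F(q)` and `F(q) < F(p)`. -/
theorem eq_of_fderiv_eq {p q : Vec n} (h : ∀ s ∈ Set.Icc (0 : ℝ) 1, l (p + s • (q - p)) < 0)
    (hpq : fderiv ℝ l p = fderiv ℝ l q) : p = q := by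
  have hp : l p < 0 := by simpa using h 0 (by simp)
  have hq : l q < 0 := by simpa using h 1 (by simp)
  by_contra hne
  have hu : ∀ s ∈ Set.Ioo (0 : ℝ) 1, ∀ t : ℝ, q - p ≠ t • (p + s • (q - p)) := by
    intro s hs t ht
    -- a radial segment: `p` and `q` are multiples of one vector `w`, hence of each other
    have hw := hl.ne_zero (h s ⟨hs.1.le, hs.2.le⟩)
    set w := p + s • (q - p) with hwdef
    have hpw : p = (1 - s * t) • w := by
      rw [ht] at hwdef
      rw [sub_smul, one_smul, mul_smul, eq_sub_iff_add_eq]; exact hwdef.symm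
    have hqw : q = (1 + (1 - s) * t) • w := by
      rw [← sub_add_cancel q p, ht]
      nth_rewrite 1 [hpw]
      rw [← add_smul]; congr 1; ring
    have hpos : ∀ r ∈ Set.Icc (0 : ℝ) 1, 1 + (r - s) * t ≠ 0 := by
      intro r hr h0
      have h1 : p + r • (q - p) = (1 + (r - s) * t) • w := by
        rw [ht]; nth_rewrite 1 [hpw]; rw [smul_smul, ← add_smul]; congr 1; ring
      have h2 := h r hr
      rw [h1, h0, zero_smul, hl.map_zero] at h2
      exact lt_irrefl _ h2
    have h1 : 0 < 1 - s * t := by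
      by_contra hc
      have hst : 1 ≤ s * t := by linarith
      have ht0 : 0 < t := by
        by_contra h'; nlinarith [hs.1]
      refine hpos (s - 1 / t) ⟨?_, ?_⟩ (by field_simp; ring)
      · rw [sub_nonneg, div_le_iff₀ ht0]; exact hst
      · have : 0 < 1 / t := by positivity
        linarith [hs.2]
    have h2 : 0 < 1 + (1 - s) * t := by
      by_contra hc
      have ht0 : t < 0 := by
        by_contra h'; nlinarith [hs.2]
      refine hpos (s - 1 / t) ⟨?_, ?_⟩ (by field_simp [ht0.ne]; ring)
      · have : 1 / t < 0 := one_div_neg.2 ht0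
        linarith [hs.1]
      · have : s - 1 / t = (s * t - 1) / t := by field_simp [ht0.ne]
        rw [this, div_le_iff_of_neg ht0]; linarith
    have h3 := hl.fderiv_smul w h1
    have h4 := hl.fderiv_smul w h2
    rw [← hpw] at h3
    rw [← hqw] at h4
    rw [h3, h4] at hpq
    have h5 := congrArg (fun ξ => ξ w) hpq
    simp only [smul_apply, smul_eq_mul, hl.fderiv_self hw] at h5
    have h6 : l w < 0 := h s ⟨hs.1.le, hs.2.le⟩
    have h7 : t = 0 := by
      have := mul_right_cancel₀ (by linarith : 2 * l w ≠ 0) h5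
      linarith
    rw [h7, zero_smul, sub_eq_zero] at ht
    exact hne ht.symm
  have hc := hl.strictConcaveOn_lorentzNorm_line (fun s hs => h s ⟨hs.1.le, hs.2.le⟩) hu
  have h0 := hl.hasDerivAt_lorentzNorm_line (p := p) (u := q - p) (s := 0) (by simpa using hp)
  have h1 := hl.hasDerivAt_lorentzNorm_line (p := p) (u := q - p) (s := 1) (by simpa using hq)
  have i0 := hc.slope_lt_of_hasDerivAt (Set.left_mem_Icc.2 zero_le_one)
    (Set.right_mem_Icc.2 zero_le_one) zero_lt_one h0
  have i1 := hc.lt_slope_of_hasDerivAt (Set.left_mem_Icc.2 zero_le_one)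
    (Set.right_mem_Icc.2 zero_le_one) zero_lt_one h1
  have hup : fderiv ℝ l p (q - p) = 2 * l q - 2 * l p := by
    rw [map_sub, hl.fderiv_self (hl.ne_zero hp), hpq, hl.fderiv_self (hl.ne_zero hq)]
  simp only [slope_def_field, zero_smul, add_zero, one_smul, add_sub_cancel, sub_zero, div_one,
    ← hpq, hup] at i0 i1
  have a := lorentzNorm_pos hp
  have b := lorentzNorm_pos hq
  have a2 := lorentzNorm_sq hp.le
  have b2 := lorentzNorm_sq hq.le
  rw [show -(2 * l q - 2 * l p) = (-2 * l q) - (-2 * l p) by ring, ← a2, ← b2] at i0 i1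
  rw [lt_div_iff₀ a] at i0
  rw [div_lt_iff₀ b] at i1
  nlinarith

end IsLorentzMinkowski

/-! ### The future cone and the Legendre transform -/

/-- The timelike vectors in the connected component of `X` among the nonzero vectors of the
closed cone of causal vectors. -/
def futureCone {n : ℕ} (l : Vec n → ℝ) (X : Vec n) : Set (Vec n) :=
  {v | l v < 0} ∩ connectedComponentIn (closure {v | l v < 0} \ {0}) X

namespace IsLorentzMinkowski

variable {n : ℕ} {l : Vec n → ℝ} (hl : IsLorentzMinkowski l)
include hl

/-- If the open segment from the null vector `q` to the timelike vector `p` is timelike, then `l`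
decreases at first order from `q` towards `p`: otherwise the second derivative, positive on the
orthogonal complement of `q`, would make `l` positive near `q`. -/
theorem fderiv_neg_of_null {p q : Vec n} (hq : q ≠ 0) (hq0 : l q = 0)
    (h : ∀ s ∈ Set.Ioc (0 : ℝ) 1, l (q + s • (p - q)) < 0) : fderiv ℝ l q (p - q) < 0 := by
  have hp : l p < 0 := by simpa using h 1 (by simp)
  have hd : HasDerivAt (fun r : ℝ => l (q + r • (p - q))) (fderiv ℝ l q (p - q)) 0 := by
    simpa using hl.hasDerivAt_line (p := q) (u := p - q) (s := 0) (by simpa using hq)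
  have hle : fderiv ℝ l q (p - q) ≤ 0 := by
    refine le_of_tendsto hd.tendsto_slope_zero_right ?_
    filter_upwards [Ioc_mem_nhdsGT (zero_lt_one (α := ℝ))] with s hs
    simp only [zero_add, zero_smul, add_zero, hq0, sub_zero, smul_eq_mul]
    exact (mul_neg_of_pos_of_neg (inv_pos.2 hs.1) (h s hs)).le
  refine lt_of_le_of_ne hle fun h0 => ?_
  obtain ⟨e, he⟩ := hl.lorentzian q hq
  have hqq : fderiv ℝ (fderiv ℝ l) q q q = 0 := by
    rw [hl.snd_fderiv_self_self hq, hq0, mul_zero]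
  have hqp : fderiv ℝ (fderiv ℝ l) q q p = 0 := by
    have := h0
    rw [map_sub, hl.fderiv_self hq, hq0, mul_zero, sub_zero] at this
    rw [hl.snd_fderiv_self hq, this]
  have hpp : 0 < fderiv ℝ (fderiv ℝ l) q p p := by
    refine lorentz_pos_of_orthogonal (hl.symm hq) he hq hqq.le hqp fun t ht => ?_
    rcases lt_trichotomy t 0 with h1 | h1 | h1
    · have h2 := h (1 / (1 - t)) ⟨by apply one_div_pos.2; linarith,
        by rw [div_le_one (by linarith)]; linarith⟩
      rw [show q + (1 / (1 - t)) • (p - q) = 0 by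
        rw [ht]
        nth_rewrite 1 [← one_smul ℝ q]
        nth_rewrite 3 [← one_smul ℝ q]
        rw [← sub_smul, smul_smul, ← add_smul,
          show 1 + 1 / (1 - t) * (t - 1) = 0 by
            have : 1 - t ≠ 0 := by linarith
            field_simp; ring, zero_smul], hl.map_zero] at h2
      exact lt_irrefl _ h2
    · rw [ht, h1, zero_smul, hl.map_zero] at hp; exact lt_irrefl _ hp
    · rw [ht, hl.homogeneous q t h1, hq0, mul_zero] at hp; exact lt_irrefl _ hp
  have hdd : deriv (deriv fun r : ℝ => l (q + r • (p - q))) 0 =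
      fderiv ℝ (fderiv ℝ l) q (p - q) (p - q) := by
    have hev : ∀ᶠ r : ℝ in 𝓝 0, q + r • (p - q) ≠ 0 := by
      have : Continuous fun r : ℝ => q + r • (p - q) := by fun_prop
      exact this.continuousAt.eventually_ne (by simpa using hq)
    have h1 : deriv (fun r : ℝ => l (q + r • (p - q))) =ᶠ[𝓝 0]
        fun r => fderiv ℝ l (q + r • (p - q)) (p - q) := by
      filter_upwards [hev] with r hr using (hl.hasDerivAt_line hr).deriv
    rw [h1.deriv_eq]
    simpa using (hl.hasDerivAt_fderiv_line (p := q) (u := p - q) (s := 0)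
      (by simpa using hq)).deriv
  have hmin : IsLocalMin (fun r : ℝ => l (q + r • (p - q))) 0 := by
    refine isLocalMin_of_deriv_deriv_pos ?_ (hd.deriv.trans h0) hd.continuousAt
    rw [hdd]
    simp only [map_sub, sub_apply, hl.symm hq p q, hqp, hqq]
    linarith
  have h3 : ∀ᶠ s in 𝓝[>] (0 : ℝ), l (q + (0 : ℝ) • (p - q)) ≤ l (q + s • (p - q)) :=
    hmin.filter_mono nhdsWithin_le_nhds
  obtain ⟨s, hs1, hs2⟩ := (h3.and (Ioc_mem_nhdsGT (zero_lt_one (α := ℝ)))).exists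
  have := h s hs2
  rw [zero_smul, add_zero, hq0] at hs1
  linarith

/-- The causal vectors near `q` are joined to `p` by a timelike segment as soon as `q` is. Only the
parameter `s = 0` needs care, and only when `q` is null. -/
theorem eventually_segment {p q : Vec n} (hq : q ≠ 0) (hq0 : l q ≤ 0)
    (h : ∀ s ∈ Set.Ioc (0 : ℝ) 1, l (q + s • (p - q)) < 0) :
    ∀ᶠ q' in 𝓝 q, l q' ≤ 0 → ∀ s ∈ Set.Ioc (0 : ℝ) 1, l (q' + s • (p - q')) < 0 := by
  have key : ∀ᶠ q' in 𝓝 q, ∀ s ∈ Set.Icc (0 : ℝ) 1, l q' ≤ 0 → 0 < s →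
      l (q' + s • (p - q')) < 0 := by
    refine isCompact_Icc.eventually_forall_of_forall_eventually fun s hs => ?_
    have hc : Continuous fun z : Vec n × ℝ => z.1 + z.2 • (p - z.1) := by fun_prop
    by_cases hlt : l (q + s • (p - q)) < 0
    · have := (hl.continuous.comp hc).continuousAt.eventually_lt
        (x₀ := (q, s)) (continuousAt_const (y := (0 : ℝ))) hlt
      filter_upwards [this] with z hz _ _ using hz
    · have hs0 : s = 0 := by
        by_contra h'
        exact hlt (h s ⟨lt_of_le_of_ne hs.1 (Ne.symm h'), hs.2⟩)
      subst hs0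
      rw [zero_smul, add_zero] at hlt
      have hd := hl.fderiv_neg_of_null hq (le_antisymm hq0 (not_lt.1 hlt)) h
      -- near `(q, 0)` the derivative of `l` along the segment stays negative
      have h1 : ∀ᶠ z in 𝓝 (q, (0 : ℝ)), fderiv ℝ l (z.1 + z.2 • (p - z.1)) (p - z.1) < 0 ∧
          z.1 + z.2 • (p - z.1) ≠ 0 := by
        refine Filter.Eventually.and ?_ (hc.continuousAt.eventually_ne (by simpa using hq))
        have hcd : ContinuousAt (fun z : Vec n × ℝ => fderiv ℝ l (z.1 + z.2 • (p - z.1)))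
            (q, 0) := by
          refine ContinuousAt.comp (g := fderiv ℝ l) ?_ hc.continuousAt
          simpa using (hl.contDiffAt_fderiv hq).continuousAt
        refine ContinuousAt.eventually_lt (hcd.clm_apply (by fun_prop))
          (continuousAt_const (y := (0 : ℝ))) ?_
        simpa using hd
      obtain ⟨ε, hε, hball⟩ := Metric.eventually_nhds_iff_ball.1 h1
      filter_upwards [Metric.ball_mem_nhds _ hε] with z hz hz0 hzs
      rw [← ball_prod_same, Set.mem_prod, Metric.mem_ball, Metric.mem_ball, Real.dist_eq,
        sub_zero] at hz
      have hin : ∀ r ∈ Set.Icc 0 z.2, fderiv ℝ l (z.1 + r • (p - z.1)) (p - z.1) < 0 ∧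
          z.1 + r • (p - z.1) ≠ 0 := by
        intro r hr
        refine hball (z.1, r) ?_
        rw [← ball_prod_same, Set.mem_prod, Metric.mem_ball, Metric.mem_ball, Real.dist_eq,
          sub_zero]
        refine ⟨hz.1, lt_of_le_of_lt ?_ hz.2⟩
        rw [abs_of_nonneg hr.1, abs_of_pos hzs]; exact hr.2
      have hanti : StrictAntiOn (fun r : ℝ => l (z.1 + r • (p - z.1))) (Set.Icc 0 z.2) := by
        refine strictAntiOn_of_deriv_neg (convex_Icc _ _)
          (hl.continuous.comp (by fun_prop)).continuousOn fun r hr => ?_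
        rw [interior_Icc] at hr
        have := hin r ⟨hr.1.le, hr.2.le⟩
        rw [(hl.hasDerivAt_line this.2).deriv]
        exact this.1
      have h2 := hanti (Set.left_mem_Icc.2 hzs.le) (Set.right_mem_Icc.2 hzs.le) hzs
      simp only [zero_smul, add_zero] at h2
      linarith
  filter_upwards [key] with q' hq' h0 s hs using hq' s ⟨hs.1.le, hs.2⟩ h0 hs.1

theorem isOpen_timelike : IsOpen {v | l v < 0} := isOpen_lt hl.continuous continuous_const

theorem closure_timelike_subset : closure {v | l v < 0} ⊆ {v | l v ≤ 0} :=
  closure_minimal (fun v (h : l v < 0) => show l v ≤ 0 from h.le)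
    (isClosed_le hl.continuous continuous_const)

/-- The component of `p` in the causal cone is star-shaped about `p`. The vectors which are
joined to `p` by a timelike segment form a closed subset, because `F` is concave on timelike
segments, and an open subset of the component. -/
theorem segment_timelike {p : Vec n} (hp : l p < 0) {q : Vec n}
    (hq : q ∈ connectedComponentIn (closure {v | l v < 0} \ {0}) p) {s : ℝ}
    (hs : s ∈ Set.Ioc (0 : ℝ) 1) : l (q + s • (p - q)) < 0 := by
  set K := connectedComponentIn (closure {v | l v < 0} \ {0}) p with hK
  have hKsub : K ⊆ closure {v | l v < 0} \ {0} := connectedComponentIn_subset _ _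
  have hKle : ∀ z ∈ K, l z ≤ 0 := fun z hz => hl.closure_timelike_subset (hKsub hz).1
  have hpK : p ∈ K := mem_connectedComponentIn ⟨subset_closure hp, hl.ne_zero hp⟩
  have : PreconnectedSpace K := Subtype.preconnectedSpace isPreconnected_connectedComponentIn
  let A : Set K := {z | ∀ s ∈ Set.Ioc (0 : ℝ) 1, l (z + s • (p - z)) < 0}
  have hA : IsClopen A := by
    constructor
    · have : A = ⋂ s ∈ Set.Ioc (0 : ℝ) 1,
          {z : K | s * lorentzNorm l p ≤ lorentzNorm l (z + s • (p - z))} := by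
        ext z
        simp only [A, Set.mem_ofPred_eq, Set.mem_iInter]
        constructor
        · intro hz s hs
          have h1 := hl.lorentzNorm_line_ge (fun s hs => hz s ⟨hs.1, hs.2.le⟩) ⟨hs.1.le, hs.2⟩
          rw [add_sub_cancel] at h1
          have : 0 ≤ (1 - s) * lorentzNorm l (z : Vec n) :=
            mul_nonneg (sub_nonneg.2 hs.2) (Real.sqrt_nonneg _)
          linarith
        · intro hz s hs
          have h1 := lt_of_lt_of_le (mul_pos hs.1 (lorentzNorm_pos hp)) (hz s hs)
          have := Real.sqrt_pos.1 h1
          linarith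
      rw [this]
      refine isClosed_biInter fun s _ => isClosed_le continuous_const ?_
      exact hl.continuous_lorentzNorm.comp (by fun_prop)
    · rw [isOpen_iff_mem_nhds]
      intro z hz
      have h1 := hl.eventually_segment (hKsub z.2).2 (hKle z z.2) hz
      have h2 : ∀ᶠ z' : K in 𝓝 z, l z' ≤ 0 → ∀ s ∈ Set.Ioc (0 : ℝ) 1,
          l (z' + s • (p - z')) < 0 := continuousAt_subtype_val.eventually h1
      filter_upwards [h2] with z' hz' using hz' (hKle z' z'.2)
  have huniv := hA.eq_univ ⟨⟨p, hpK⟩, fun s _ => by simpa using hp⟩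
  have : (⟨q, hq⟩ : K) ∈ A := by rw [huniv]; exact Set.mem_univ _
  exact this s hs

variable {X : Vec n}

theorem mem_futureCone_self (hX : l X < 0) : X ∈ futureCone l X :=
  ⟨hX, mem_connectedComponentIn ⟨subset_closure hX, hl.ne_zero hX⟩⟩

theorem mem_futureCone_of_isPreconnected {p : Vec n} (hp : p ∈ futureCone l X) {s : Set (Vec n)}
    (hs : IsPreconnected s) (hps : p ∈ s) (hsub : s ⊆ {v | l v < 0}) : s ⊆ futureCone l X := by
  have h1 := hs.subset_connectedComponentIn hps
    (F := closure {v | l v < 0} \ {0}) fun v hv =>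
      ⟨subset_closure (hsub hv), hl.ne_zero (hsub hv)⟩
  rw [← connectedComponentIn_eq hp.2] at h1
  exact fun v hv => ⟨hsub hv, h1 hv⟩

theorem mem_futureCone_of_segment {p q : Vec n} (hp : p ∈ futureCone l X)
    (h : ∀ s ∈ Set.Icc (0 : ℝ) 1, l (p + s • (q - p)) < 0) : q ∈ futureCone l X := by
  refine hl.mem_futureCone_of_isPreconnected (s := (fun s : ℝ => p + s • (q - p)) '' Set.Icc 0 1) hp
    (isPreconnected_Icc.image _ (by fun_prop)) ⟨0, by simp, by simp⟩ ?_ ⟨1, by simp, by simp⟩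
  rintro _ ⟨s, hs, rfl⟩
  exact h s hs

/-- The future cone is convex. -/
theorem futureCone_segment {p q : Vec n} (hp : p ∈ futureCone l X) (hq : q ∈ futureCone l X)
    {s : ℝ} (hs : s ∈ Set.Icc (0 : ℝ) 1) : l (p + s • (q - p)) < 0 := by
  rcases hs.1.eq_or_lt with h0 | h0
  · rw [← h0, zero_smul, add_zero]; exact hp.1
  · refine hl.segment_timelike hq.1 ?_ ⟨h0, hs.2⟩
    rw [← connectedComponentIn_eq hq.2]; exact hp.2

theorem smul_mem_futureCone {p : Vec n} (hp : p ∈ futureCone l X) {c : ℝ} (hc : 0 < c) :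
    c • p ∈ futureCone l X := by
  refine hl.mem_futureCone_of_segment hp fun s hs => ?_
  have hpos : 0 < 1 + s * (c - 1) := by
    rcases hs.1.eq_or_lt with h | h
    · rw [← h]; norm_num
    · nlinarith [mul_pos h hc, hs.2]
  rw [show p + s • (c • p - p) = (1 + s * (c - 1)) • p by
    rw [add_smul, mul_smul, sub_smul, one_smul], hl.homogeneous _ _ hpos]
  exact mul_neg_of_pos_of_neg (by positivity) hp.1

/-- The future cone is open, and closed in the set of timelike vectors. -/
theorem futureCone_mem_nhds {v : Vec n} (hv : v ∈ closure (futureCone l X)) (hlv : l v < 0) :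
    futureCone l X ∈ 𝓝 v := by
  obtain ⟨ε, hε, hball⟩ := Metric.isOpen_iff.1 hl.isOpen_timelike v hlv
  obtain ⟨p, hp, hpd⟩ := Metric.mem_closure_iff.1 hv ε hε
  refine Filter.mem_of_superset (Metric.ball_mem_nhds v hε) ?_
  exact hl.mem_futureCone_of_isPreconnected hp (convex_ball v ε).isPreconnected
    (by rwa [Metric.mem_ball, dist_comm]) hball

/-- The differential of `l` is injective on the future cone. -/
theorem fderiv_injOn_futureCone : Set.InjOn (fderiv ℝ l) (futureCone l X) :=
  fun _ hp _ hq h => hl.eq_of_fderiv_eq (fun _ hs => hl.futureCone_segment hp hq hs) h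

/-- The differential of `l` at a Legendre transform of `ξ` is `ξ`: by homogeneity the function
`ξ + F(v) F` attains its maximum over the open future cone at `v`. -/
theorem fderiv_eq_of_legendre {ξ : Vec n →L[ℝ] ℝ}
    (hξ : ∀ v ∈ closure (futureCone l X) \ {0}, ξ v < 0) {v : Vec n} (hv : v ∈ futureCone l X)
    (h1 : l v = -(1 / 2) * (sSup (ξ '' {w | w ∈ futureCone l X ∧ lorentzNorm l w = 1})) ^ 2)
    (h2 : l v = ξ v / 2) : fderiv ℝ l v = ξ := by
  have hneg : ∀ w ∈ futureCone l X, ξ w < 0 := fun w hw =>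
    hξ w ⟨subset_closure hw, hl.ne_zero hw.1⟩
  set D := ξ '' {w | w ∈ futureCone l X ∧ lorentzNorm l w = 1} with hD
  have hDneg : ∀ r ∈ D, r ≤ 0 := by rintro _ ⟨w, hw, rfl⟩; exact (hneg w hw.1).le
  have hsup0 : sSup D ≤ 0 := Real.sSup_nonpos hDneg
  have hFv := lorentzNorm_pos hv.1
  have hsup : sSup D = - lorentzNorm l v := by
    have h3 := lorentzNorm_sq hv.1.le
    have h4 : (sSup D) ^ 2 = lorentzNorm l v ^ 2 := by rw [h3]; linarith
    rcases sq_eq_sq_iff_eq_or_eq_neg.1 h4 with h | h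
    · linarith
    · exact h
  have hle : ∀ w ∈ futureCone l X, ξ w + lorentzNorm l v * lorentzNorm l w ≤ 0 := by
    intro w hw
    have hFw := lorentzNorm_pos hw.1
    have h3 : ξ ((lorentzNorm l w)⁻¹ • w) ≤ sSup D := by
      refine le_csSup ⟨0, hDneg⟩ ⟨_, ⟨hl.smul_mem_futureCone hw (inv_pos.2 hFw), ?_⟩, rfl⟩
      rw [hl.lorentzNorm_smul w (inv_pos.2 hFw), inv_mul_cancel₀ hFw.ne']
    rw [map_smul, smul_eq_mul, hsup, inv_mul_le_iff₀ hFw] at h3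
    linarith
  have hnhds : futureCone l X ∈ 𝓝 v := hl.futureCone_mem_nhds (subset_closure hv) hv.1
  have hF : HasFDerivAt (lorentzNorm l) (-((lorentzNorm l v)⁻¹ • fderiv ℝ l v)) v := by
    have h3 := ((hl.differentiableAt (hl.ne_zero hv.1)).hasFDerivAt.const_mul (-2)).sqrt
      (by have := hv.1; simp only [Set.mem_ofPred_eq] at this; linarith)
    refine h3.congr_fderiv ?_
    ext u
    simp only [smul_apply, neg_apply, smul_eq_mul]
    change 1 / (2 * lorentzNorm l v) * _ = _
    field_simp
  have hmax : IsLocalMax (fun w => ξ w + lorentzNorm l v * lorentzNorm l w) v := by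
    filter_upwards [hnhds] with w hw
    refine (hle w hw).trans (le_of_eq ?_)
    have h3 := lorentzNorm_sq hv.1.le
    rw [sq] at h3
    rw [h3]; linarith
  have h0 := hmax.hasFDerivAt_eq_zero (ξ.hasFDerivAt.add (hF.const_mul _))
  ext u
  have := congrArg (fun η => η u) h0
  simp only [add_apply, smul_apply, neg_apply, smul_eq_mul, zero_apply] at this
  field_simp at this
  linarith

/-- Existence of the Legendre transform: on the hypersurface `F = 1` of the future cone, a covector
which is negative on the closed cone attains its supremum. -/
theorem exists_legendre (hX : l X < 0) {ξ : Vec n →L[ℝ] ℝ}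
    (hξ : ∀ v ∈ closure (futureCone l X) \ {0}, ξ v < 0) :
    ∃ v ∈ futureCone l X,
      l v = -(1 / 2) * (sSup (ξ '' {w | w ∈ futureCone l X ∧ lorentzNorm l w = 1})) ^ 2 ∧
      -(1 / 2) * (sSup (ξ '' {w | w ∈ futureCone l X ∧ lorentzNorm l w = 1})) ^ 2 = ξ v / 2 := by
  have hXc := hl.mem_futureCone_self hX
  have hFX := lorentzNorm_pos hX
  obtain ⟨w0, hw0, hw1⟩ : ∃ w ∈ futureCone l X, lorentzNorm l w = 1 :=
    ⟨(lorentzNorm l X)⁻¹ • X, hl.smul_mem_futureCone hXc (inv_pos.2 hFX), by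
      rw [hl.lorentzNorm_smul X (inv_pos.2 hFX), inv_mul_cancel₀ hFX.ne']⟩
  -- homogeneity and compactness of the sphere: `ξ w ≤ -a |w|` on the closed cone
  obtain ⟨a, ha, hbound⟩ : ∃ a > 0, ∀ w ∈ futureCone l X, ξ w ≤ -a * ‖w‖ := by
    have hcomp : IsCompact (closure (futureCone l X) ∩ Metric.sphere 0 1) :=
      (isCompact_sphere _ _).inter_left isClosed_closure
    have hunit : ∀ w ∈ futureCone l X,
        ‖w‖⁻¹ • w ∈ closure (futureCone l X) ∩ Metric.sphere 0 1 := by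
      intro w hw
      have hn : 0 < ‖w‖ := norm_pos_iff.2 (hl.ne_zero hw.1)
      exact ⟨subset_closure (hl.smul_mem_futureCone hw (inv_pos.2 hn)), by
        simp [norm_smul, hn.ne']⟩
    obtain ⟨z, hz, hzmax⟩ := hcomp.exists_isMaxOn ⟨_, hunit _ hXc⟩ ξ.continuous.continuousOn
    have hz0 : z ≠ 0 := by
      rintro rfl; simpa using hz.2
    refine ⟨-ξ z, by linarith [hξ z ⟨hz.1, hz0⟩], fun w hw => ?_⟩
    have hn : 0 < ‖w‖ := norm_pos_iff.2 (hl.ne_zero hw.1)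
    have h1 : ξ (‖w‖⁻¹ • w) ≤ ξ z := hzmax (hunit w hw)
    rw [map_smul, smul_eq_mul, inv_mul_le_iff₀ hn] at h1
    linarith
  let Q : Set (Vec n) := {w | w ∈ closure (futureCone l X) ∧ l w = -(1 / 2) ∧ ξ w0 ≤ ξ w}
  have hF1 : ∀ w, l w < 0 → (lorentzNorm l w = 1 ↔ l w = -(1 / 2)) := by
    intro w hw
    have h1 := lorentzNorm_sq hw.le
    have h2 := lorentzNorm_pos hw
    constructor
    · intro h; rw [h] at h1; linarith
    · intro h; rw [h] at h1; nlinarith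
  have hQmem : ∀ w ∈ Q, w ∈ futureCone l X := fun w hw =>
    mem_of_mem_nhds (hl.futureCone_mem_nhds hw.1 (by rw [hw.2.1]; norm_num))
  have hQ : IsCompact Q := by
    refine Metric.isCompact_of_isClosed_isBounded ?_ ?_
    · exact isClosed_closure.inter ((isClosed_eq hl.continuous continuous_const).inter
        (isClosed_le continuous_const ξ.continuous))
    · refine isBounded_iff_forall_norm_le.2 ⟨-ξ w0 / a, fun w hw => ?_⟩
      rw [le_div_iff₀ ha]
      linarith [hbound w (hQmem w hw), hw.2.2]
  have hw0Q : w0 ∈ Q := ⟨subset_closure hw0, (hF1 _ hw0.1).1 hw1, le_rfl⟩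
  obtain ⟨v, hvQ, hvmax⟩ := hQ.exists_isMaxOn ⟨w0, hw0Q⟩ ξ.continuous.continuousOn
  have hv := hQmem v hvQ
  have hsup : sSup (ξ '' {w | w ∈ futureCone l X ∧ lorentzNorm l w = 1}) = ξ v := by
    refine IsGreatest.csSup_eq ⟨⟨v, ⟨hv, (hF1 v hv.1).2 hvQ.2.1⟩, rfl⟩, ?_⟩
    rintro _ ⟨w, ⟨hw, hw1⟩, rfl⟩
    by_cases hww : ξ w0 ≤ ξ w
    · exact hvmax ⟨subset_closure hw, (hF1 w hw.1).1 hw1, hww⟩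
    · exact (not_le.1 hww).le.trans (hvmax hw0Q)
  have hneg : ξ v < 0 := hξ v ⟨subset_closure hv, hl.ne_zero hv.1⟩
  refine ⟨(-ξ v) • v, hl.smul_mem_futureCone hv (neg_pos.2 hneg), ?_, ?_⟩
  · rw [hsup, hl.homogeneous v _ (neg_pos.2 hneg), hvQ.2.1]; ring
  · rw [hsup, map_smul, smul_eq_mul]; ring

end IsLorentzMinkowski

/-! ### Directional derivatives on the coordinate tangent bundle -/

section Derivation

variable {E : Type*} [NormedAddCommGroup E] [NormedSpace ℝ E]

/-- The derivative of `f` in the direction `a`, as a function of the base point. -/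
noncomputable def dirD (a : E) (f : E → ℝ) (p : E) : ℝ := fderiv ℝ f p a

variable {O : Set E} {f g : E → ℝ} {p : E}

theorem ContDiffOn.dirD (hf : ContDiffOn ℝ ∞ f O) (hO : IsOpen O) (a : E) :
    ContDiffOn ℝ ∞ (dirD a f) O :=
  (hf.fderiv_of_isOpen hO (by simp)).clm_apply contDiffOn_const

theorem ContDiffOn.differentiableAt_of_isOpen (hf : ContDiffOn ℝ ∞ f O) (hO : IsOpen O)
    (hp : p ∈ O) : DifferentiableAt ℝ f p :=
  (hf.contDiffAt (hO.mem_nhds hp)).differentiableAt (by simp)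

theorem dirD_congr (hO : IsOpen O) (h : ∀ p ∈ O, f p = g p) (a : E) (hp : p ∈ O) :
    dirD a f p = dirD a g p := by
  have : f =ᶠ[𝓝 p] g := by
    filter_upwards [hO.mem_nhds hp] with p hp using h p hp
  rw [dirD, dirD, this.fderiv_eq]

theorem dirD_comm_of_contDiffAt (hc : ContDiffAt ℝ 2 f p) (a b : E) :
    dirD a (dirD b f) p = dirD b (dirD a f) p := by
  have hd : DifferentiableAt ℝ (fderiv ℝ f) p :=
    (hc.fderiv_right (m := 1) (by norm_num)).differentiableAt (by simp)
  have h1 : ∀ a b : E, dirD a (dirD b f) p = fderiv ℝ (fderiv ℝ f) p a b := by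
    intro a b
    have := (hd.hasFDerivAt.clm_apply (hasFDerivAt_const b p)).fderiv
    rw [show dirD a (dirD b f) p = fderiv ℝ (fun y => fderiv ℝ f y b) p a from rfl, this]
    simp
  rw [h1, h1]
  exact (hc.isSymmSndFDerivAt (by rw [minSmoothness_of_isRCLikeNormedField])).eq a b

theorem dirD_comm (hf : ContDiffOn ℝ ∞ f O) (hO : IsOpen O) (hp : p ∈ O) (a b : E) :
    dirD a (dirD b f) p = dirD b (dirD a f) p :=
  dirD_comm_of_contDiffAt ((hf.contDiffAt (hO.mem_nhds hp)).of_le (by norm_cast)) a b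

theorem dirD_add (hf : DifferentiableAt ℝ f p) (hg : DifferentiableAt ℝ g p) (a : E) :
    dirD a (fun p => f p + g p) p = dirD a f p + dirD a g p := by
  simp only [dirD]
  rw [fderiv_fun_add hf hg]; rfl

theorem dirD_sub (hf : DifferentiableAt ℝ f p) (hg : DifferentiableAt ℝ g p) (a : E) :
    dirD a (fun p => f p - g p) p = dirD a f p - dirD a g p := by
  simp only [dirD]
  rw [fderiv_fun_sub hf hg]; rfl

theorem dirD_mul (hf : DifferentiableAt ℝ f p) (hg : DifferentiableAt ℝ g p) (a : E) :
    dirD a (fun p => f p * g p) p = dirD a f p * g p + f p * dirD a g p := by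
  simp only [dirD]
  rw [fderiv_fun_mul hf hg]
  simp only [add_apply, smul_apply, smul_eq_mul]
  ring

theorem dirD_const_mul (hf : DifferentiableAt ℝ f p) (c : ℝ) (a : E) :
    dirD a (fun p => c * f p) p = c * dirD a f p := by
  simp only [dirD]
  rw [fderiv_const_mul hf]; rfl

theorem dirD_sum {ι : Type*} {s : Finset ι} {f : ι → E → ℝ}
    (hf : ∀ i ∈ s, DifferentiableAt ℝ (f i) p) (a : E) :
    dirD a (fun p => ∑ i ∈ s, f i p) p = ∑ i ∈ s, dirD a (f i) p := by
  simp only [dirD]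
  rw [fderiv_fun_sum hf]; simp

end Derivation

section Det

variable {E : Type*} [NormedAddCommGroup E] [NormedSpace ℝ E] {n : ℕ}

theorem contDiffOn_det {O : Set E} {A : E → Matrix (Fin n) (Fin n) ℝ}
    (hA : ∀ i j, ContDiffOn ℝ ∞ (fun p => A p i j) O) : ContDiffOn ℝ ∞ (fun p => (A p).det) O := by
  simp only [Matrix.det_apply']
  exact ContDiffOn.sum fun σ _ => contDiffOn_const.mul (contDiffOn_prod fun i _ => hA _ _)

theorem contDiffOn_inv_entry {O : Set E} {A : E → Matrix (Fin n) (Fin n) ℝ}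
    (hA : ∀ i j, ContDiffOn ℝ ∞ (fun p => A p i j) O) (hdet : ∀ p ∈ O, (A p).det ≠ 0)
    (i j : Fin n) : ContDiffOn ℝ ∞ (fun p => (A p)⁻¹ i j) O := by
  simp only [Matrix.inv_def, Ring.inverse_eq_inv', Matrix.smul_apply, smul_eq_mul,
    Matrix.adjugate_apply]
  refine ((contDiffOn_det hA).inv hdet).mul (contDiffOn_det fun k l => ?_)
  simp only [Matrix.updateRow_apply]
  by_cases hk : k = j
  · simp only [hk, if_true]; exact contDiffOn_const
  · simp only [hk, if_false]; exact hA k l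

theorem det_updateRow_eq_sum_adjugate (A : Matrix (Fin n) (Fin n) ℝ) (i : Fin n) (b : Fin n → ℝ) :
    (A.updateRow i b).det = ∑ j, A.adjugate j i * b j := by
  rw [← Matrix.det_transpose, ← Matrix.updateCol_transpose, ← Matrix.cramer_apply,
    Matrix.cramer_eq_adjugate_mulVec, ← Matrix.adjugate_transpose]
  rfl

/-- Jacobi's formula for the derivative of a determinant. -/
theorem dirD_det {A : E → Matrix (Fin n) (Fin n) ℝ} {p : E}
    (hA : ∀ i j, DifferentiableAt ℝ (fun p => A p i j) p) (a : E) :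
    dirD a (fun p => (A p).det) p =
      ∑ i, ∑ j, (A p).adjugate j i * dirD a (fun p => A p i j) p := by
  let D : ContinuousMultilinearMap ℝ (fun _ : Fin n => Fin n → ℝ) ℝ :=
    ⟨(Matrix.detRowAlternating (n := Fin n) (R := ℝ)).toMultilinearMap,
      Continuous.matrix_det (A := fun M : Fin n → Fin n → ℝ => Matrix.of M) continuous_id⟩
  have h1 : HasFDerivAt (fun p i j => A p i j) (ContinuousLinearMap.pi fun i =>
      ContinuousLinearMap.pi fun j => fderiv ℝ (fun p => A p i j) p) p :=
    hasFDerivAt_pi.2 fun i => hasFDerivAt_pi.2 fun j => (hA i j).hasFDerivAt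
  have h2 := (D.hasFDerivAt fun i j => A p i j).comp p h1
  have h3 := congrArg (fun L => L a) h2.fderiv
  refine h3.trans ?_
  rw [ContinuousLinearMap.comp_apply, ContinuousMultilinearMap.linearDeriv_apply]
  exact Finset.sum_congr rfl fun i _ => det_updateRow_eq_sum_adjugate (A p) i _

end Det

/-! ### Local expressions of a Lorentz--Finsler structure -/

/-- The coordinate direction `∂/∂xⁱ` on the coordinate tangent bundle. -/
noncomputable def baseDir {n : ℕ} (i : Fin n) : Vec n × Vec n := (EuclideanSpace.single i 1, 0)

/-- The coordinate direction `∂/∂vⁱ` on the coordinate tangent bundle. -/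
noncomputable def fibDir {n : ℕ} (i : Fin n) : Vec n × Vec n := (0, EuclideanSpace.single i 1)

/-- The slit tangent bundle over the coordinate domain `T`. -/
def slit {n : ℕ} (T : Set (Vec n)) : Set (Vec n × Vec n) := T ×ˢ {0}ᶜ

/-- `Λ` is the local expression over `T` of a Lorentz--Finsler structure. Of the signature only
the sign of the determinant is recorded. -/
structure IsCoordLagrangian {n : ℕ} (T : Set (Vec n)) (Λ : Vec n → Vec n → ℝ) : Prop where
  isOpen : IsOpen T
  smooth : ContDiffOn ℝ ∞ (fun p : Vec n × Vec n => Λ p.1 p.2) (slit T)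
  homogeneous : ∀ q ∈ T, ∀ (v : Vec n) (c : ℝ), 0 < c → Λ q (c • v) = c ^ 2 * Λ q v
  det_neg : ∀ q ∈ T, ∀ v : Vec n, v ≠ 0 → (gMat Λ q v).det < 0

theorem vec_eq_sum_single {n : ℕ} (v : Vec n) :
    v = ∑ i, v i • (EuclideanSpace.single i (1 : ℝ) : Vec n) := by
  ext j
  simp [Finset.sum_apply, Pi.single_apply]

section Coordinates

variable {n : ℕ}

theorem pd_congr {f g : Vec n → ℝ} {q : Vec n} (h : f =ᶠ[𝓝 q] g) (i : Fin n) :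
    pd i f q = pd i g q := by
  rw [pd, pd, h.fderiv_eq]

theorem pd_base_eq {f : Vec n × Vec n → ℝ} {q v : Vec n} (hf : DifferentiableAt ℝ f (q, v))
    (i : Fin n) : pd i (fun q' => f (q', v)) q = dirD (baseDir i) f (q, v) := by
  have h := HasFDerivAt.comp (f := fun q' => (q', v)) q hf.hasFDerivAt
    ((hasFDerivAt_id q).prodMk (hasFDerivAt_const v q))
  exact congrArg (fun L => L (EuclideanSpace.single i 1)) h.fderiv

theorem pd_fib_eq {f : Vec n × Vec n → ℝ} {q v : Vec n} (hf : DifferentiableAt ℝ f (q, v))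
    (i : Fin n) : pd i (fun v' => f (q, v')) v = dirD (fibDir i) f (q, v) := by
  have h := HasFDerivAt.comp (f := fun v' => (q, v')) v hf.hasFDerivAt
    ((hasFDerivAt_const q v).prodMk (hasFDerivAt_id v))
  exact congrArg (fun L => L (EuclideanSpace.single i 1)) h.fderiv

theorem dirD_eq_sum (f : Vec n × Vec n → ℝ) (p : Vec n × Vec n) (a b : Vec n) :
    dirD (a, b) f p =
      ∑ i, a i * dirD (baseDir i) f p + ∑ i, b i * dirD (fibDir i) f p := by
  have h : (a, b) = ∑ i, a i • (baseDir i : Vec n × Vec n) + ∑ i, b i • fibDir i := by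
    refine Prod.ext ?_ ?_
    · simp only [Prod.fst_add, Prod.fst_sum, Prod.smul_fst, baseDir, fibDir, smul_zero,
        Finset.sum_const_zero, add_zero]
      exact vec_eq_sum_single a
    · simp only [Prod.snd_add, Prod.snd_sum, Prod.smul_snd, baseDir, fibDir, smul_zero,
        Finset.sum_const_zero, zero_add]
      exact vec_eq_sum_single b
  simp only [dirD]
  rw [h]
  simp only [map_add, map_sum, map_smul, smul_eq_mul]

theorem contDiff_fibCoord (k : Fin n) : ContDiff ℝ ∞ fun p : Vec n × Vec n => p.2 k :=
  (EuclideanSpace.proj (𝕜 := ℝ) k).contDiff.comp contDiff_snd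

theorem dirD_base_fibCoord (i k : Fin n) (p : Vec n × Vec n) :
    dirD (baseDir i) (fun p => p.2 k) p = 0 := by
  have h : HasFDerivAt (fun p : Vec n × Vec n => p.2 k)
      ((EuclideanSpace.proj (𝕜 := ℝ) k).comp (ContinuousLinearMap.snd ℝ (Vec n) (Vec n))) p :=
    ((EuclideanSpace.proj (𝕜 := ℝ) k : Vec n →L[ℝ] ℝ).comp
      (ContinuousLinearMap.snd ℝ (Vec n) (Vec n))).hasFDerivAt
  rw [dirD, h.fderiv]
  simp [baseDir]

theorem dirD_fib_fibCoord (i k : Fin n) (p : Vec n × Vec n) :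
    dirD (fibDir i) (fun p => p.2 k) p = if i = k then 1 else 0 := by
  have h : HasFDerivAt (fun p : Vec n × Vec n => p.2 k)
      ((EuclideanSpace.proj (𝕜 := ℝ) k).comp (ContinuousLinearMap.snd ℝ (Vec n) (Vec n))) p :=
    ((EuclideanSpace.proj (𝕜 := ℝ) k : Vec n →L[ℝ] ℝ).comp
      (ContinuousLinearMap.snd ℝ (Vec n) (Vec n))).hasFDerivAt
  rw [dirD, h.fderiv]
  simp [fibDir, eq_comm]

/-- The derivative of `∑ vᵏ fₖ` in a base direction. -/
theorem dirD_base_sum_fibCoord {f : Fin n → Vec n × Vec n → ℝ} {p : Vec n × Vec n}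
    (hf : ∀ k, DifferentiableAt ℝ (f k) p) (i : Fin n) :
    dirD (baseDir i) (fun p => ∑ k, p.2 k * f k p) p = ∑ k, p.2 k * dirD (baseDir i) (f k) p := by
  have hv : ∀ k, DifferentiableAt ℝ (fun p : Vec n × Vec n => p.2 k) p := fun k =>
    (contDiff_fibCoord k).contDiffAt.differentiableAt (by simp)
  rw [dirD_sum fun k _ => (hv k).fun_mul (hf k)]
  refine Finset.sum_congr rfl fun k _ => ?_
  rw [dirD_mul (hv k) (hf k), dirD_base_fibCoord, zero_mul, zero_add]

/-- The derivative of `∑ vᵏ fₖ` in a fibre direction. -/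
theorem dirD_fib_sum_fibCoord {f : Fin n → Vec n × Vec n → ℝ} {p : Vec n × Vec n}
    (hf : ∀ k, DifferentiableAt ℝ (f k) p) (i : Fin n) :
    dirD (fibDir i) (fun p => ∑ k, p.2 k * f k p) p =
      f i p + ∑ k, p.2 k * dirD (fibDir i) (f k) p := by
  have hv : ∀ k, DifferentiableAt ℝ (fun p : Vec n × Vec n => p.2 k) p := fun k =>
    (contDiff_fibCoord k).contDiffAt.differentiableAt (by simp)
  rw [dirD_sum fun k _ => (hv k).fun_mul (hf k)]
  have : f i p = ∑ k, (if i = k then 1 else 0) * f k p := by simp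
  rw [this, ← Finset.sum_add_distrib]
  refine Finset.sum_congr rfl fun k _ => ?_
  rw [dirD_mul (hv k) (hf k), dirD_fib_fibCoord]

/-- The derivative of `f` along the geodesic spray,
`∑ vᵏ ∂f/∂xᵏ - ∑ Gᵏ ∂f/∂vᵏ`. -/
noncomputable def sprayD (Λ : Vec n → Vec n → ℝ) (f : Vec n × Vec n → ℝ) (p : Vec n × Vec n) : ℝ :=
  ∑ k, p.2 k * dirD (baseDir k) f p - ∑ k, spray Λ p.1 p.2 k * dirD (fibDir k) f p

/-- The momentum `pᵢ = ∂L/∂vⁱ`. -/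
noncomputable def momentum (Λ : Vec n → Vec n → ℝ) (i : Fin n) : Vec n × Vec n → ℝ :=
  dirD (fibDir i) fun p => Λ p.1 p.2

end Coordinates

namespace IsCoordLagrangian

variable {n : ℕ} {T : Set (Vec n)} {Λ : Vec n → Vec n → ℝ} (hΛ : IsCoordLagrangian T Λ)
include hΛ

theorem isOpen_slit : IsOpen (slit T) := hΛ.isOpen.prod isOpen_compl_singleton

theorem slit_mem_nhds {p : Vec n × Vec n} (hp : p ∈ slit T) : slit T ∈ 𝓝 p :=
  hΛ.isOpen_slit.mem_nhds hp

theorem diffAt {f : Vec n × Vec n → ℝ} (hf : ContDiffOn ℝ ∞ f (slit T)) {p : Vec n × Vec n}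
    (hp : p ∈ slit T) : DifferentiableAt ℝ f p :=
  hf.differentiableAt_of_isOpen hΛ.isOpen_slit hp

theorem smooth_dirD {f : Vec n × Vec n → ℝ} (hf : ContDiffOn ℝ ∞ f (slit T)) (a : Vec n × Vec n) :
    ContDiffOn ℝ ∞ (dirD a f) (slit T) :=
  hf.dirD hΛ.isOpen_slit a

theorem pd_base {f : Vec n × Vec n → ℝ} (hf : ContDiffOn ℝ ∞ f (slit T)) {p : Vec n × Vec n}
    (hp : p ∈ slit T) (i : Fin n) : pd i (fun q' => f (q', p.2)) p.1 = dirD (baseDir i) f p :=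
  pd_base_eq (hΛ.diffAt hf hp) i

theorem pd_fib {f : Vec n × Vec n → ℝ} (hf : ContDiffOn ℝ ∞ f (slit T)) {p : Vec n × Vec n}
    (hp : p ∈ slit T) (i : Fin n) : pd i (fun v' => f (p.1, v')) p.2 = dirD (fibDir i) f p :=
  pd_fib_eq (hΛ.diffAt hf hp) i

theorem smooth_momentum (i : Fin n) : ContDiffOn ℝ ∞ (momentum Λ i) (slit T) :=
  hΛ.smooth_dirD hΛ.smooth _

theorem gMat_eq {p : Vec n × Vec n} (hp : p ∈ slit T) (i j : Fin n) :
    gMat Λ p.1 p.2 i j = dirD (fibDir i) (momentum Λ j) p := by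
  rw [← hΛ.pd_fib (hΛ.smooth_momentum j) hp]
  rw [gMat, Matrix.of_apply]
  refine pd_congr ?_ i
  filter_upwards [isOpen_compl_singleton.mem_nhds hp.2] with v hv
  exact hΛ.pd_fib (p := (p.1, v)) hΛ.smooth ⟨hp.1, hv⟩ j

theorem smooth_gMat (i j : Fin n) :
    ContDiffOn ℝ ∞ (fun p : Vec n × Vec n => gMat Λ p.1 p.2 i j) (slit T) :=
  (hΛ.smooth_dirD (hΛ.smooth_momentum j) (fibDir i)).congr fun _ hp => hΛ.gMat_eq hp i j

theorem gMat_symm {p : Vec n × Vec n} (hp : p ∈ slit T) (i j : Fin n) :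
    gMat Λ p.1 p.2 i j = gMat Λ p.1 p.2 j i := by
  rw [hΛ.gMat_eq hp, hΛ.gMat_eq hp]
  exact dirD_comm hΛ.smooth hΛ.isOpen_slit hp _ _

theorem smooth_gInv (i j : Fin n) :
    ContDiffOn ℝ ∞ (fun p : Vec n × Vec n => gInv Λ p.1 p.2 i j) (slit T) :=
  contDiffOn_inv_entry (fun i j => hΛ.smooth_gMat i j)
    (fun p hp => (hΛ.det_neg p.1 hp.1 p.2 hp.2).ne) i j

theorem gMat_mul_gInv {p : Vec n × Vec n} (hp : p ∈ slit T) :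
    gMat Λ p.1 p.2 * gInv Λ p.1 p.2 = 1 :=
  Matrix.mul_nonsing_inv _ (isUnit_iff_ne_zero.2 (hΛ.det_neg p.1 hp.1 p.2 hp.2).ne)

theorem gInv_mul_gMat {p : Vec n × Vec n} (hp : p ∈ slit T) :
    gInv Λ p.1 p.2 * gMat Λ p.1 p.2 = 1 :=
  Matrix.nonsing_inv_mul _ (isUnit_iff_ne_zero.2 (hΛ.det_neg p.1 hp.1 p.2 hp.2).ne)

theorem gInv_symm {p : Vec n × Vec n} (hp : p ∈ slit T) (i j : Fin n) :
    gInv Λ p.1 p.2 i j = gInv Λ p.1 p.2 j i := by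
  have h : (gMat Λ p.1 p.2).transpose = gMat Λ p.1 p.2 := by
    ext i j; exact hΛ.gMat_symm hp j i
  have h2 : (gInv Λ p.1 p.2).transpose = gInv Λ p.1 p.2 := by
    rw [gInv, Matrix.transpose_nonsing_inv, h]
  exact congrFun (congrFun h2 j) i

/-- Raising and then lowering an index. -/
theorem sum_gMat_gInv {p : Vec n × Vec n} (hp : p ∈ slit T) (a : Fin n → ℝ) (m : Fin n) :
    ∑ i, gMat Λ p.1 p.2 m i * ∑ l, gInv Λ p.1 p.2 i l * a l = a m := by
  have h : (gMat Λ p.1 p.2).mulVec ((gInv Λ p.1 p.2).mulVec a) = a := by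
    rw [Matrix.mulVec_mulVec, hΛ.gMat_mul_gInv hp, Matrix.one_mulVec]
  exact congrFun h m

/-- Lowering and then raising an index. -/
theorem sum_gInv_gMat {p : Vec n × Vec n} (hp : p ∈ slit T) (a : Fin n → ℝ) (m : Fin n) :
    ∑ i, gInv Λ p.1 p.2 m i * ∑ l, gMat Λ p.1 p.2 i l * a l = a m := by
  have h : (gInv Λ p.1 p.2).mulVec ((gMat Λ p.1 p.2).mulVec a) = a := by
    rw [Matrix.mulVec_mulVec, hΛ.gInv_mul_gMat hp, Matrix.one_mulVec]
  exact congrFun h m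

theorem eq_of_lower_eq {p : Vec n × Vec n} (hp : p ∈ slit T) {a b : Fin n → ℝ}
    (h : ∀ m, ∑ i, gMat Λ p.1 p.2 m i * a i = ∑ i, gMat Λ p.1 p.2 m i * b i) (m : Fin n) :
    a m = b m := by
  rw [← hΛ.sum_gInv_gMat hp a m, ← hΛ.sum_gInv_gMat hp b m]
  simp only [h]

/-! ### Consequences of homogeneity -/

/-- Euler's identity for `L`. -/
theorem euler {p : Vec n × Vec n} (hp : p ∈ slit T) :
    ∑ k, p.2 k * momentum Λ k p = 2 * Λ p.1 p.2 := by
  have h1 : HasDerivAt (fun c : ℝ => Λ p.1 (c • p.2))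
      (dirD (0, p.2) (fun p : Vec n × Vec n => Λ p.1 p.2) p) 1 := by
    have h2 : HasDerivAt (fun c : ℝ => (p.1, c • p.2)) ((0 : Vec n), p.2) 1 := by
      simpa using (hasDerivAt_const (1 : ℝ) p.1).prodMk ((hasDerivAt_id (1 : ℝ)).smul_const p.2)
    have h3 : HasFDerivAt (fun p : Vec n × Vec n => Λ p.1 p.2)
        (fderiv ℝ (fun p : Vec n × Vec n => Λ p.1 p.2) p) (p.1, (1 : ℝ) • p.2) := by
      rw [one_smul]; exact (hΛ.diffAt hΛ.smooth hp).hasFDerivAt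
    exact h3.comp_hasDerivAt (1 : ℝ) h2
  have h2 : HasDerivAt (fun c : ℝ => Λ p.1 (c • p.2)) (2 * Λ p.1 p.2) 1 := by
    have h : HasDerivAt (fun c : ℝ => c ^ 2 * Λ p.1 p.2) (2 * Λ p.1 p.2) 1 := by
      simpa using (hasDerivAt_pow 2 (1 : ℝ)).mul_const (Λ p.1 p.2)
    refine h.congr_of_eventuallyEq ?_
    filter_upwards [lt_mem_nhds (zero_lt_one (α := ℝ))] with c hc using
      hΛ.homogeneous p.1 hp.1 p.2 c hc
  rw [← h1.unique h2, dirD_eq_sum]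
  simp [momentum]

theorem gMat_apply_self {p : Vec n × Vec n} (hp : p ∈ slit T) (i : Fin n) :
    ∑ k, p.2 k * gMat Λ p.1 p.2 i k = momentum Λ i p := by
  have h := dirD_congr hΛ.isOpen_slit (fun p hp => hΛ.euler hp) (fibDir i) hp
  rw [dirD_fib_sum_fibCoord (fun k => hΛ.diffAt (hΛ.smooth_momentum k) hp),
    dirD_const_mul (hΛ.diffAt hΛ.smooth hp)] at h
  simp only [← hΛ.gMat_eq hp] at h
  change _ = 2 * momentum Λ i p at h
  linarith

theorem base_gMat_apply_self {p : Vec n × Vec n} (hp : p ∈ slit T) (i j : Fin n) :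
    ∑ k, p.2 k * dirD (baseDir j) (fun p => gMat Λ p.1 p.2 i k) p =
      dirD (baseDir j) (momentum Λ i) p := by
  rw [← dirD_base_sum_fibCoord (fun k => hΛ.diffAt (hΛ.smooth_gMat i k) hp)]
  exact dirD_congr hΛ.isOpen_slit (fun p hp => hΛ.gMat_apply_self hp i) _ hp

theorem fib_gMat_apply_self {p : Vec n × Vec n} (hp : p ∈ slit T) (i j : Fin n) :
    ∑ k, p.2 k * dirD (fibDir j) (fun p => gMat Λ p.1 p.2 i k) p = 0 := by
  have h := dirD_congr hΛ.isOpen_slit (fun p hp => hΛ.gMat_apply_self hp i) (fibDir j) hp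
  rw [dirD_fib_sum_fibCoord (fun k => hΛ.diffAt (hΛ.smooth_gMat i k) hp), ← hΛ.gMat_eq hp,
    hΛ.gMat_symm hp j i] at h
  linarith

theorem base_momentum_apply_self {p : Vec n × Vec n} (hp : p ∈ slit T) (j : Fin n) :
    ∑ k, p.2 k * dirD (baseDir j) (momentum Λ k) p =
      2 * dirD (baseDir j) (fun p => Λ p.1 p.2) p := by
  rw [← dirD_base_sum_fibCoord (fun k => hΛ.diffAt (hΛ.smooth_momentum k) hp),
    ← dirD_const_mul (hΛ.diffAt hΛ.smooth hp)]
  exact dirD_congr hΛ.isOpen_slit (fun p hp => hΛ.euler hp) _ hp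

/-- The derivatives `∂g_{ij}/∂vᵏ` are symmetric in all three indices. -/
theorem fib_gMat_symm {p : Vec n × Vec n} (hp : p ∈ slit T) (i j k : Fin n) :
    dirD (fibDir k) (fun p => gMat Λ p.1 p.2 i j) p =
      dirD (fibDir i) (fun p => gMat Λ p.1 p.2 k j) p := by
  rw [dirD_congr hΛ.isOpen_slit (fun p hp => hΛ.gMat_eq hp i j) _ hp,
    dirD_congr hΛ.isOpen_slit (fun p hp => hΛ.gMat_eq hp k j) _ hp]
  exact dirD_comm (hΛ.smooth_momentum j) hΛ.isOpen_slit hp _ _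

theorem base_momentum_fib {p : Vec n × Vec n} (hp : p ∈ slit T) (i j k : Fin n) :
    dirD (fibDir j) (dirD (baseDir k) (momentum Λ i)) p =
      dirD (baseDir k) (fun p => gMat Λ p.1 p.2 j i) p := by
  rw [dirD_congr hΛ.isOpen_slit (fun p hp => hΛ.gMat_eq hp j i) _ hp]
  exact dirD_comm (hΛ.smooth_momentum i) hΛ.isOpen_slit hp _ _

theorem dirD_gMat_symm {p : Vec n × Vec n} (hp : p ∈ slit T) (a : Vec n × Vec n) (i j : Fin n) :
    dirD a (fun p => gMat Λ p.1 p.2 i j) p = dirD a (fun p => gMat Λ p.1 p.2 j i) p :=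
  dirD_congr hΛ.isOpen_slit (fun _ hp => hΛ.gMat_symm hp i j) _ hp

/-! ### The spray and the nonlinear connection -/

theorem formalChristoffel_eq {p : Vec n × Vec n} (hp : p ∈ slit T) (i j k : Fin n) :
    formalChristoffel Λ p.1 p.2 i j k = ∑ l, gInv Λ p.1 p.2 i l *
      ((1 / 2) * (dirD (baseDir j) (fun p => gMat Λ p.1 p.2 l k) p
        + dirD (baseDir k) (fun p => gMat Λ p.1 p.2 j l) p
        - dirD (baseDir l) (fun p => gMat Λ p.1 p.2 j k) p)) := by
  rw [formalChristoffel, Finset.mul_sum]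
  refine Finset.sum_congr rfl fun l _ => ?_
  rw [← hΛ.pd_base (hΛ.smooth_gMat l k) hp, ← hΛ.pd_base (hΛ.smooth_gMat j l) hp,
    ← hΛ.pd_base (hΛ.smooth_gMat j k) hp]
  ring

theorem smooth_spray (i : Fin n) :
    ContDiffOn ℝ ∞ (fun p : Vec n × Vec n => spray Λ p.1 p.2 i) (slit T) := by
  have h : ContDiffOn ℝ ∞ (fun p : Vec n × Vec n => ∑ j, ∑ k, (∑ l, gInv Λ p.1 p.2 i l *
      ((1 / 2) * (dirD (baseDir j) (fun p => gMat Λ p.1 p.2 l k) p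
        + dirD (baseDir k) (fun p => gMat Λ p.1 p.2 j l) p
        - dirD (baseDir l) (fun p => gMat Λ p.1 p.2 j k) p))) * p.2 j * p.2 k) (slit T) := by
    refine ContDiffOn.sum fun j _ => ContDiffOn.sum fun k _ => ?_
    refine (ContDiffOn.mul ?_ (contDiff_fibCoord j).contDiffOn).mul
      (contDiff_fibCoord k).contDiffOn
    refine ContDiffOn.sum fun l _ => (hΛ.smooth_gInv i l).mul (contDiffOn_const.mul ?_)
    exact ((hΛ.smooth_dirD (hΛ.smooth_gMat _ _) _).add (hΛ.smooth_dirD (hΛ.smooth_gMat _ _) _)).sub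
      (hΛ.smooth_dirD (hΛ.smooth_gMat _ _) _)
  refine h.congr fun p hp => ?_
  simp only [spray, hΛ.formalChristoffel_eq hp]

theorem lower_formalChristoffel {p : Vec n × Vec n} (hp : p ∈ slit T) (m j k : Fin n) :
    ∑ i, gMat Λ p.1 p.2 m i * formalChristoffel Λ p.1 p.2 i j k =
      (1 / 2) * (dirD (baseDir j) (fun p => gMat Λ p.1 p.2 m k) p
        + dirD (baseDir k) (fun p => gMat Λ p.1 p.2 j m) p
        - dirD (baseDir m) (fun p => gMat Λ p.1 p.2 j k) p) := by
  simp only [hΛ.formalChristoffel_eq hp]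
  rw [hΛ.sum_gMat_gInv hp]

theorem lower_formalChristoffel_self {p : Vec n × Vec n} (hp : p ∈ slit T) (m j : Fin n) :
    ∑ i, gMat Λ p.1 p.2 m i * ∑ k, formalChristoffel Λ p.1 p.2 i j k * p.2 k =
      (1 / 2) * (dirD (baseDir j) (momentum Λ m) p
        + ∑ k, p.2 k * dirD (baseDir k) (fun p => gMat Λ p.1 p.2 j m) p
        - dirD (baseDir m) (momentum Λ j) p) := by
  rw [← hΛ.base_gMat_apply_self hp m j, ← hΛ.base_gMat_apply_self hp j m,
    ← Finset.sum_add_distrib, ← Finset.sum_sub_distrib, Finset.mul_sum]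
  simp only [Finset.mul_sum]
  rw [Finset.sum_comm]
  refine Finset.sum_congr rfl fun k _ => ?_
  have h := hΛ.lower_formalChristoffel hp m j k
  rw [← mul_add, ← mul_sub, mul_left_comm, ← h, Finset.mul_sum]
  exact Finset.sum_congr rfl fun i _ => by ring

/-- The Euler--Lagrange form of the spray coefficients. -/
theorem lower_spray {p : Vec n × Vec n} (hp : p ∈ slit T) (m : Fin n) :
    ∑ i, gMat Λ p.1 p.2 m i * spray Λ p.1 p.2 i =
      ∑ k, p.2 k * dirD (baseDir k) (momentum Λ m) p
        - dirD (baseDir m) (fun p => Λ p.1 p.2) p := by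
  have h1 : ∑ i, gMat Λ p.1 p.2 m i * spray Λ p.1 p.2 i =
      ∑ j, p.2 j * ∑ i, gMat Λ p.1 p.2 m i * ∑ k, formalChristoffel Λ p.1 p.2 i j k * p.2 k := by
    simp only [spray, Finset.mul_sum]
    rw [Finset.sum_comm]
    refine Finset.sum_congr rfl fun j _ => Finset.sum_congr rfl fun i _ =>
      Finset.sum_congr rfl fun k _ => by ring
  have h2 : ∑ j, p.2 j * ∑ k, p.2 k * dirD (baseDir k) (fun p => gMat Λ p.1 p.2 j m) p =
      ∑ k, p.2 k * dirD (baseDir k) (momentum Λ m) p := by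
    simp only [← hΛ.base_gMat_apply_self hp m, Finset.mul_sum]
    rw [Finset.sum_comm]
    refine Finset.sum_congr rfl fun k _ => Finset.sum_congr rfl fun j _ => ?_
    rw [hΛ.dirD_gMat_symm hp _ j m]; ring
  have h3 := hΛ.base_momentum_apply_self hp m
  rw [h1]
  simp only [hΛ.lower_formalChristoffel_self hp]
  have h4 : ∀ j, p.2 j * (1 / 2 * (dirD (baseDir j) (momentum Λ m) p
      + ∑ k, p.2 k * dirD (baseDir k) (fun p => gMat Λ p.1 p.2 j m) p
      - dirD (baseDir m) (momentum Λ j) p)) =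
      (1 / 2) * (p.2 j * dirD (baseDir j) (momentum Λ m) p)
      + (1 / 2) * (p.2 j * ∑ k, p.2 k * dirD (baseDir k) (fun p => gMat Λ p.1 p.2 j m) p)
      - (1 / 2) * (p.2 j * dirD (baseDir m) (momentum Λ j) p) := fun j => by ring
  simp only [h4, Finset.sum_add_distrib, Finset.sum_sub_distrib, ← Finset.mul_sum]
  rw [h2, h3]
  ring

theorem nonlinConn_eq {p : Vec n × Vec n} (hp : p ∈ slit T) (i j : Fin n) :
    nonlinConn Λ p.1 p.2 i j = (1 / 2) * dirD (fibDir j) (fun p => spray Λ p.1 p.2 i) p := by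
  rw [nonlinConn, ← hΛ.pd_fib (hΛ.smooth_spray i) hp]

theorem smooth_nonlinConn (i j : Fin n) :
    ContDiffOn ℝ ∞ (fun p : Vec n × Vec n => nonlinConn Λ p.1 p.2 i j) (slit T) :=
  (contDiffOn_const.mul (hΛ.smooth_dirD (hΛ.smooth_spray i) (fibDir j))).congr
    fun _ hp => hΛ.nonlinConn_eq hp i j

/-- The nonlinear connection with its index lowered: up to a skew part, it is half the derivative
of the fundamental tensor along the spray. -/
theorem lower_nonlinConn {p : Vec n × Vec n} (hp : p ∈ slit T) (m j : Fin n) :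
    2 * ∑ i, gMat Λ p.1 p.2 m i * nonlinConn Λ p.1 p.2 i j =
      sprayD Λ (fun p => gMat Λ p.1 p.2 j m) p
        + dirD (baseDir j) (momentum Λ m) p - dirD (baseDir m) (momentum Λ j) p := by
  have h := dirD_congr hΛ.isOpen_slit (fun p hp => hΛ.lower_spray hp m) (fibDir j) hp
  have hg := fun i => hΛ.diffAt (hΛ.smooth_gMat m i) hp
  have hs := fun i => hΛ.diffAt (hΛ.smooth_spray i) hp
  have hb := fun k => hΛ.smooth_dirD (hΛ.smooth_momentum m) (baseDir k)
  have hsum : DifferentiableAt ℝ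
      (fun p : Vec n × Vec n => ∑ k, p.2 k * dirD (baseDir k) (momentum Λ m) p) p :=
    hΛ.diffAt (ContDiffOn.sum fun k _ => (contDiff_fibCoord k).contDiffOn.mul (hb k)) hp
  rw [dirD_sum fun i _ => (hg i).fun_mul (hs i),
    dirD_sub hsum (hΛ.diffAt (hΛ.smooth_dirD hΛ.smooth _) hp),
    dirD_fib_sum_fibCoord fun k => hΛ.diffAt (hb k) hp] at h
  simp only [hΛ.base_momentum_fib hp] at h
  have h1 : ∀ i, dirD (fibDir j) (fun p => gMat Λ p.1 p.2 m i * spray Λ p.1 p.2 i) p =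
      spray Λ p.1 p.2 i * dirD (fibDir i) (fun p => gMat Λ p.1 p.2 j m) p
        + 2 * (gMat Λ p.1 p.2 m i * nonlinConn Λ p.1 p.2 i j) := by
    intro i
    rw [dirD_mul (hg i) (hs i), hΛ.nonlinConn_eq hp, hΛ.fib_gMat_symm hp m i j,
      hΛ.dirD_gMat_symm hp _ j i, hΛ.fib_gMat_symm hp i j m, hΛ.dirD_gMat_symm hp _ m j]
    ring
  simp only [h1, Finset.sum_add_distrib, ← Finset.mul_sum] at h
  have h2 : dirD (fibDir j) (dirD (baseDir m) fun p => Λ p.1 p.2) p =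
      dirD (baseDir m) (momentum Λ j) p := dirD_comm hΛ.smooth hΛ.isOpen_slit hp _ _
  rw [h2] at h
  rw [sprayD]
  linarith

end IsCoordLagrangian

/-- The logarithm of the Lorentzian volume density, `log √(-det g_{ij}(v))`. -/
noncomputable def logVolume {n : ℕ} (Λ : Vec n → Vec n → ℝ) (p : Vec n × Vec n) : ℝ :=
  Real.log (Real.sqrt (-(gMat Λ p.1 p.2).det))

namespace IsCoordLagrangian

variable {n : ℕ} {T : Set (Vec n)} {Λ : Vec n → Vec n → ℝ} (hΛ : IsCoordLagrangian T Λ)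
include hΛ

/-- The spray coefficients are homogeneous of degree two. -/
theorem nonlinConn_apply_self {p : Vec n × Vec n} (hp : p ∈ slit T) (i : Fin n) :
    ∑ j, nonlinConn Λ p.1 p.2 i j * p.2 j = spray Λ p.1 p.2 i := by
  refine hΛ.eq_of_lower_eq hp (a := fun i => ∑ j, nonlinConn Λ p.1 p.2 i j * p.2 j)
    (b := spray Λ p.1 p.2) (fun m => ?_) i
  beta_reduce
  have h1 : 2 * ∑ i, gMat Λ p.1 p.2 m i * ∑ j, nonlinConn Λ p.1 p.2 i j * p.2 j =
      ∑ j, p.2 j * (2 * ∑ i, gMat Λ p.1 p.2 m i * nonlinConn Λ p.1 p.2 i j) := by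
    simp only [Finset.mul_sum]
    rw [Finset.sum_comm]
    exact Finset.sum_congr rfl fun j _ => Finset.sum_congr rfl fun i _ => by ring
  have h2 : ∑ j, p.2 j * sprayD Λ (fun p => gMat Λ p.1 p.2 j m) p =
      ∑ k, p.2 k * dirD (baseDir k) (momentum Λ m) p := by
    simp only [sprayD, mul_sub, Finset.sum_sub_distrib, Finset.mul_sum]
    rw [Finset.sum_comm, Finset.sum_comm (f := fun j k => p.2 j * (spray Λ p.1 p.2 k *
      dirD (fibDir k) (fun p => gMat Λ p.1 p.2 j m) p))]
    have h3 : ∀ k, ∑ j, p.2 j * (spray Λ p.1 p.2 k *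
        dirD (fibDir k) (fun p => gMat Λ p.1 p.2 j m) p) = 0 := by
      intro k
      have := hΛ.fib_gMat_apply_self hp m k
      simp only [hΛ.dirD_gMat_symm hp _ m] at this
      calc _ = spray Λ p.1 p.2 k *
            ∑ j, p.2 j * dirD (fibDir k) (fun p => gMat Λ p.1 p.2 j m) p := by
            rw [Finset.mul_sum]; exact Finset.sum_congr rfl fun j _ => by ring
        _ = 0 := by rw [this, mul_zero]
    simp only [h3, Finset.sum_const_zero, sub_zero]
    refine Finset.sum_congr rfl fun k _ => ?_
    rw [← hΛ.base_gMat_apply_self hp m k, Finset.mul_sum]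
    refine Finset.sum_congr rfl fun j _ => ?_
    rw [hΛ.dirD_gMat_symm hp _ m j]; ring
  have h4 := hΛ.base_momentum_apply_self hp m
  simp only [hΛ.lower_nonlinConn hp, mul_sub, mul_add, Finset.sum_sub_distrib,
    Finset.sum_add_distrib, h2, h4] at h1
  rw [hΛ.lower_spray hp]
  linarith

/-- Contracted with the reference vector, the Chern connection is the nonlinear connection. -/
theorem chern_apply_self {p : Vec n × Vec n} (hp : p ∈ slit T) (i j : Fin n) :
    ∑ k, chern Λ p.1 p.2 i j k * p.2 k = nonlinConn Λ p.1 p.2 i j := by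
  refine hΛ.eq_of_lower_eq hp (a := fun i => ∑ k, chern Λ p.1 p.2 i j k * p.2 k)
    (b := fun i => nonlinConn Λ p.1 p.2 i j) (fun m => ?_) i
  beta_reduce
  let Y : Fin n → Fin n → Fin n → ℝ := fun i j k =>
    dirD (fibDir k) (fun p => gMat Λ p.1 p.2 i j) p
  have hY0 : ∀ i k, ∑ j, Y i j k * p.2 j = 0 := fun i k => by
    rw [← hΛ.fib_gMat_apply_self hp i k]
    exact Finset.sum_congr rfl fun j _ => mul_comm _ _
  have hchern : ∀ i k, chern Λ p.1 p.2 i j k = formalChristoffel Λ p.1 p.2 i j k -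
      ∑ l, gInv Λ p.1 p.2 i l * ((1 / 2) * ∑ m, (Y l k m * nonlinConn Λ p.1 p.2 m j
        + Y j l m * nonlinConn Λ p.1 p.2 m k - Y j k m * nonlinConn Λ p.1 p.2 m l)) := by
    intro i k
    rw [chern, Finset.mul_sum]
    congr 1
    refine Finset.sum_congr rfl fun l _ => ?_
    rw [← Finset.mul_sum, mul_left_comm]
    congr 2
    refine Finset.sum_congr rfl fun m _ => ?_
    simp only [Y]
    rw [← hΛ.pd_fib (hΛ.smooth_gMat l k) hp, ← hΛ.pd_fib (hΛ.smooth_gMat j l) hp,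
      ← hΛ.pd_fib (hΛ.smooth_gMat j k) hp]
  have h1 : ∑ i, gMat Λ p.1 p.2 m i * ∑ k, chern Λ p.1 p.2 i j k * p.2 k =
      ∑ i, gMat Λ p.1 p.2 m i * ∑ k, formalChristoffel Λ p.1 p.2 i j k * p.2 k
      - ∑ k, p.2 k * ∑ i, gMat Λ p.1 p.2 m i * ∑ l, gInv Λ p.1 p.2 i l *
        ((1 / 2) * ∑ m, (Y l k m * nonlinConn Λ p.1 p.2 m j
        + Y j l m * nonlinConn Λ p.1 p.2 m k - Y j k m * nonlinConn Λ p.1 p.2 m l)) := by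
    simp only [Finset.mul_sum (s := Finset.univ) (a := p.2 _)]
    rw [Finset.sum_comm, ← Finset.sum_sub_distrib]
    refine Finset.sum_congr rfl fun i _ => ?_
    rw [Finset.mul_sum, Finset.mul_sum, ← Finset.sum_sub_distrib]
    refine Finset.sum_congr rfl fun k _ => ?_
    rw [hchern]; ring
  have h2 : ∑ k, p.2 k * ((1 / 2) * ∑ r, (Y m k r * nonlinConn Λ p.1 p.2 r j
        + Y j m r * nonlinConn Λ p.1 p.2 r k - Y j k r * nonlinConn Λ p.1 p.2 r m)) =
      (1 / 2) * ∑ r, spray Λ p.1 p.2 r * Y j m r := by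
    simp only [Finset.mul_sum]
    rw [Finset.sum_comm]
    refine Finset.sum_congr rfl fun r _ => ?_
    have h3 : ∀ k, p.2 k * (1 / 2 * (Y m k r * nonlinConn Λ p.1 p.2 r j
        + Y j m r * nonlinConn Λ p.1 p.2 r k - Y j k r * nonlinConn Λ p.1 p.2 r m)) =
        (1 / 2) * nonlinConn Λ p.1 p.2 r j * (Y m k r * p.2 k)
        + (1 / 2) * Y j m r * (nonlinConn Λ p.1 p.2 r k * p.2 k)
        - (1 / 2) * nonlinConn Λ p.1 p.2 r m * (Y j k r * p.2 k) := fun k => by ring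
    simp only [h3, Finset.sum_add_distrib, Finset.sum_sub_distrib, ← Finset.mul_sum, hY0,
      hΛ.nonlinConn_apply_self hp]
    ring
  have h4 := hΛ.lower_nonlinConn hp m j
  rw [sprayD] at h4
  rw [h1, hΛ.lower_formalChristoffel_self hp]
  simp only [hΛ.sum_gMat_gInv hp]
  rw [h2]
  change _ - 1 / 2 * ∑ r, spray Λ p.1 p.2 r *
    dirD (fibDir r) (fun p => gMat Λ p.1 p.2 j m) p = _
  linarith

theorem chern_apply_self_self {p : Vec n × Vec n} (hp : p ∈ slit T) (i : Fin n) :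
    ∑ j, ∑ k, chern Λ p.1 p.2 i j k * p.2 j * p.2 k = spray Λ p.1 p.2 i := by
  rw [← hΛ.nonlinConn_apply_self hp i]
  refine Finset.sum_congr rfl fun j _ => ?_
  rw [← hΛ.chern_apply_self hp i j, Finset.sum_mul]
  exact Finset.sum_congr rfl fun k _ => by ring

/-- The horizontal derivatives of `L` vanish, so `L` is constant along horizontal curves. -/
theorem base_lagrangian {p : Vec n × Vec n} (hp : p ∈ slit T) (j : Fin n) :
    ∑ i, momentum Λ i p * nonlinConn Λ p.1 p.2 i j = dirD (baseDir j) (fun p => Λ p.1 p.2) p := by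
  have h1 : 2 * ∑ i, momentum Λ i p * nonlinConn Λ p.1 p.2 i j =
      ∑ m, p.2 m * (2 * ∑ i, gMat Λ p.1 p.2 m i * nonlinConn Λ p.1 p.2 i j) := by
    simp only [← hΛ.gMat_apply_self hp, Finset.mul_sum, Finset.sum_mul]
    rw [Finset.sum_comm]
    refine Finset.sum_congr rfl fun m _ => Finset.sum_congr rfl fun i _ => ?_
    rw [hΛ.gMat_symm hp i m]; ring
  have h2 : ∑ m, p.2 m * sprayD Λ (fun p => gMat Λ p.1 p.2 j m) p =
      ∑ k, p.2 k * dirD (baseDir k) (momentum Λ j) p := by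
    simp only [sprayD, mul_sub, Finset.sum_sub_distrib, Finset.mul_sum]
    rw [Finset.sum_comm, Finset.sum_comm (f := fun m k => p.2 m * (spray Λ p.1 p.2 k *
      dirD (fibDir k) (fun p => gMat Λ p.1 p.2 j m) p))]
    have h3 : ∀ k, ∑ m, p.2 m * (spray Λ p.1 p.2 k *
        dirD (fibDir k) (fun p => gMat Λ p.1 p.2 j m) p) = 0 := by
      intro k
      calc _ = spray Λ p.1 p.2 k *
            ∑ m, p.2 m * dirD (fibDir k) (fun p => gMat Λ p.1 p.2 j m) p := by
            rw [Finset.mul_sum]; exact Finset.sum_congr rfl fun j _ => by ring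
        _ = 0 := by rw [hΛ.fib_gMat_apply_self hp j k, mul_zero]
    simp only [h3, Finset.sum_const_zero, sub_zero]
    refine Finset.sum_congr rfl fun k _ => ?_
    rw [← hΛ.base_gMat_apply_self hp j k, Finset.mul_sum]
    exact Finset.sum_congr rfl fun m _ => by ring
  have h4 := hΛ.base_momentum_apply_self hp j
  simp only [hΛ.lower_nonlinConn hp, mul_sub, mul_add, Finset.sum_sub_distrib,
    Finset.sum_add_distrib, h2, h4] at h1
  linarith

/-- The part of the lowered nonlinear connection which is not the base derivative of the momentum is
symmetric; this makes Hessians self-adjoint. -/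
theorem lower_nonlinConn_symm {p : Vec n × Vec n} (hp : p ∈ slit T) (m j : Fin n) :
    ∑ i, gMat Λ p.1 p.2 m i * nonlinConn Λ p.1 p.2 i j - dirD (baseDir j) (momentum Λ m) p =
      ∑ i, gMat Λ p.1 p.2 j i * nonlinConn Λ p.1 p.2 i m - dirD (baseDir m) (momentum Λ j) p := by
  have h1 := hΛ.lower_nonlinConn hp m j
  have h2 := hΛ.lower_nonlinConn hp j m
  have h3 : sprayD Λ (fun p => gMat Λ p.1 p.2 j m) p = sprayD Λ (fun p => gMat Λ p.1 p.2 m j) p := by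
    simp only [sprayD, hΛ.dirD_gMat_symm hp _ j m]
  linarith

theorem smooth_logVolume : ContDiffOn ℝ ∞ (logVolume Λ) (slit T) := by
  have h : ContDiffOn ℝ ∞ (fun p : Vec n × Vec n => -(gMat Λ p.1 p.2).det) (slit T) :=
    (contDiffOn_det fun i j => hΛ.smooth_gMat i j).neg
  have hpos : ∀ p ∈ slit T, 0 < -(gMat Λ p.1 p.2).det := fun p hp =>
    neg_pos.2 (hΛ.det_neg p.1 hp.1 p.2 hp.2)
  exact (h.sqrt fun p hp => (hpos p hp).ne').log fun p hp => (Real.sqrt_pos.2 (hpos p hp)).ne'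

theorem dirD_logVolume {p : Vec n × Vec n} (hp : p ∈ slit T) (a : Vec n × Vec n) :
    dirD a (logVolume Λ) p =
      (1 / 2) * ∑ i, ∑ j, gInv Λ p.1 p.2 j i * dirD a (fun p => gMat Λ p.1 p.2 i j) p := by
  have hpos : ∀ p ∈ slit T, 0 < -(gMat Λ p.1 p.2).det := fun p hp =>
    neg_pos.2 (hΛ.det_neg p.1 hp.1 p.2 hp.2)
  have h1 : ∀ p ∈ slit T, logVolume Λ p = (1 / 2) * Real.log ((gMat Λ p.1 p.2).det) := by
    intro p hp
    rw [logVolume, Real.log_sqrt (hpos p hp).le, Real.log_neg_eq_log]; ring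
  have hdet : DifferentiableAt ℝ (fun p : Vec n × Vec n => (gMat Λ p.1 p.2).det) p :=
    hΛ.diffAt (contDiffOn_det fun i j => hΛ.smooth_gMat i j) hp
  have hne : (gMat Λ p.1 p.2).det ≠ 0 := (hΛ.det_neg p.1 hp.1 p.2 hp.2).ne
  have h2 : dirD a (fun p : Vec n × Vec n => Real.log ((gMat Λ p.1 p.2).det)) p =
      ((gMat Λ p.1 p.2).det)⁻¹ * dirD a (fun p : Vec n × Vec n => (gMat Λ p.1 p.2).det) p := by
    rw [dirD, (hdet.hasFDerivAt.log hne).fderiv]; rfl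
  rw [dirD_congr hΛ.isOpen_slit h1 a hp, dirD_const_mul (hdet.log hne), h2,
    dirD_det fun i j => hΛ.diffAt (hΛ.smooth_gMat i j) hp]
  congr 1
  simp only [Finset.mul_sum]
  refine Finset.sum_congr rfl fun i _ => Finset.sum_congr rfl fun j _ => ?_
  rw [gInv, Matrix.inv_def, Ring.inverse_eq_inv', Matrix.smul_apply, smul_eq_mul, mul_assoc]

/-- The trace of the nonlinear connection is the derivative of the logarithmic volume density
along the spray. -/
theorem trace_nonlinConn {p : Vec n × Vec n} (hp : p ∈ slit T) :
    ∑ i, nonlinConn Λ p.1 p.2 i i = sprayD Λ (logVolume Λ) p := by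
  have h1 : ∀ i, 2 * nonlinConn Λ p.1 p.2 i i = ∑ m, gInv Λ p.1 p.2 i m *
      (sprayD Λ (fun p => gMat Λ p.1 p.2 i m) p
        + dirD (baseDir i) (momentum Λ m) p - dirD (baseDir m) (momentum Λ i) p) := by
    intro i
    simp only [← hΛ.lower_nonlinConn hp]
    have := hΛ.sum_gInv_gMat hp (fun l => 2 * nonlinConn Λ p.1 p.2 l i) i
    rw [← this]
    refine Finset.sum_congr rfl fun m _ => ?_
    congr 1
    rw [Finset.mul_sum]
    exact Finset.sum_congr rfl fun l _ => by ring
  have h2 : ∑ i, ∑ m, gInv Λ p.1 p.2 i m * dirD (baseDir i) (momentum Λ m) p =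
      ∑ i, ∑ m, gInv Λ p.1 p.2 i m * dirD (baseDir m) (momentum Λ i) p := by
    rw [Finset.sum_comm]
    refine Finset.sum_congr rfl fun m _ => Finset.sum_congr rfl fun i _ => ?_
    rw [hΛ.gInv_symm hp]
  have h3 : ∑ i, ∑ m, gInv Λ p.1 p.2 i m * sprayD Λ (fun p => gMat Λ p.1 p.2 i m) p =
      2 * sprayD Λ (logVolume Λ) p := by
    simp only [sprayD, hΛ.dirD_logVolume hp, mul_sub, Finset.sum_sub_distrib]
    congr 1
    · simp only [Finset.mul_sum]
      rw [Finset.sum_comm]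
      conv_rhs => rw [Finset.sum_comm]
      refine (Finset.sum_congr rfl fun m _ => Finset.sum_comm).trans ?_
      rw [Finset.sum_comm]
      conv_rhs => rw [Finset.sum_comm]
      refine Finset.sum_congr rfl fun k _ => ?_
      rw [Finset.sum_comm]
      refine Finset.sum_congr rfl fun i _ => Finset.sum_congr rfl fun m _ => ?_
      rw [hΛ.gInv_symm hp m i]; ring
    · simp only [Finset.mul_sum]
      rw [Finset.sum_comm]
      conv_rhs => rw [Finset.sum_comm]
      refine (Finset.sum_congr rfl fun m _ => Finset.sum_comm).trans ?_
      rw [Finset.sum_comm]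
      conv_rhs => rw [Finset.sum_comm]
      refine Finset.sum_congr rfl fun k _ => ?_
      rw [Finset.sum_comm]
      refine Finset.sum_congr rfl fun i _ => Finset.sum_congr rfl fun m _ => ?_
      rw [hΛ.gInv_symm hp m i]; ring
  have h4 : 2 * ∑ i, nonlinConn Λ p.1 p.2 i i = 2 * sprayD Λ (logVolume Λ) p := by
    rw [Finset.mul_sum]
    simp only [h1, mul_sub, mul_add, Finset.sum_sub_distrib, Finset.sum_add_distrib, h2, h3]
    ring
  linarith

end IsCoordLagrangian

theorem IsCoordLagrangian.smooth_trace {n : ℕ} {T : Set (Vec n)} {Λ : Vec n → Vec n → ℝ}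
    (hΛ : IsCoordLagrangian T Λ) : ContDiffOn ℝ ∞
    (fun p : Vec n × Vec n => ∑ i, nonlinConn Λ p.1 p.2 i i) (slit T) :=
  ContDiffOn.sum fun i _ => hΛ.smooth_nonlinConn i i

/-! ### The weighted Bochner identity in coordinates -/

/-- The matrix of `v ↦ D_v^V V`, namely `∂Vⁱ/∂xʲ + Nⁱ_j(V)`. -/
noncomputable def hessMatrix {n : ℕ} (Λ : Vec n → Vec n → ℝ) (V : Vec n → Vec n) (q : Vec n) :
    Matrix (Fin n) (Fin n) ℝ :=
  Matrix.of fun i j => pd j (fun q' => V q' i) q + nonlinConn Λ q (V q) i j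

/-- The acceleration `D_V^V V`. -/
noncomputable def accel {n : ℕ} (Λ : Vec n → Vec n → ℝ) (V : Vec n → Vec n) (i : Fin n)
    (q : Vec n) : ℝ :=
  ∑ j, V q j * pd j (fun q' => V q' i) q + spray Λ q (V q) i

/-- `V` is a nowhere vanishing vector field of class `C²` on the coordinate domain `W`. -/
structure IsCoordField {n : ℕ} (T W : Set (Vec n)) (V : Vec n → Vec n) : Prop where
  isOpen : IsOpen W
  subset : W ⊆ T
  contDiffOn : ContDiffOn ℝ 2 V W
  ne_zero : ∀ q ∈ W, V q ≠ 0

section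

variable {n : ℕ}

/-- The chain rule for `q ↦ f(q, V(q))`. -/
theorem pd_comp_field {f : Vec n × Vec n → ℝ} {V : Vec n → Vec n} {q : Vec n}
    (hf : DifferentiableAt ℝ f (q, V q)) (hV : DifferentiableAt ℝ V q) (i : Fin n) :
    pd i (fun q => f (q, V q)) q = dirD (baseDir i) f (q, V q)
      + ∑ l, pd i (fun q => V q l) q * dirD (fibDir l) f (q, V q) := by
  have h := HasFDerivAt.comp (f := fun q => (q, V q)) q hf.hasFDerivAt
    ((hasFDerivAt_id q).prodMk hV.hasFDerivAt)
  have h1 : pd i (fun q => f (q, V q)) q =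
      dirD (EuclideanSpace.single i 1, fderiv ℝ V q (EuclideanSpace.single i 1)) f (q, V q) :=
    congrArg (fun L => L (EuclideanSpace.single i 1)) h.fderiv
  have h2 : ∀ l, fderiv ℝ V q (EuclideanSpace.single i 1) l = pd i (fun q => V q l) q := by
    intro l
    have := ((EuclideanSpace.proj (𝕜 := ℝ) l : Vec n →L[ℝ] ℝ).hasFDerivAt).comp q hV.hasFDerivAt
    exact (congrArg (fun L => L (EuclideanSpace.single i 1)) this.fderiv).symm
  rw [h1, dirD_eq_sum]
  congr 1
  · rw [Finset.sum_eq_single i (fun j _ hj => by simp [hj]) (by simp)]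
    simp
  · simp only [h2]

end

namespace IsCoordField

variable {n : ℕ} {T W : Set (Vec n)} {V : Vec n → Vec n} (hV : IsCoordField T W V)
include hV

theorem mem_slit {q : Vec n} (hq : q ∈ W) : (q, V q) ∈ slit T := ⟨hV.subset hq, hV.ne_zero q hq⟩

theorem contDiffAt {q : Vec n} (hq : q ∈ W) : ContDiffAt ℝ 2 V q :=
  hV.contDiffOn.contDiffAt (hV.isOpen.mem_nhds hq)

theorem diffAt {q : Vec n} (hq : q ∈ W) : DifferentiableAt ℝ V q :=
  (hV.contDiffAt hq).differentiableAt (by simp)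

theorem contDiffAt_coord {q : Vec n} (hq : q ∈ W) (i : Fin n) :
    ContDiffAt ℝ 2 (fun q => V q i) q :=
  (EuclideanSpace.proj (𝕜 := ℝ) i).contDiff.contDiffAt.comp q (hV.contDiffAt hq)

theorem diffAt_coord {q : Vec n} (hq : q ∈ W) (i : Fin n) :
    DifferentiableAt ℝ (fun q => V q i) q :=
  (hV.contDiffAt_coord hq i).differentiableAt (by simp)

theorem diffAt_pd {q : Vec n} (hq : q ∈ W) (i j : Fin n) :
    DifferentiableAt ℝ (pd j fun q => V q i) q := by
  have h := (hV.contDiffAt_coord hq i).fderiv_right (m := 1) (by norm_num)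
  exact (h.differentiableAt (by simp)).clm_apply (differentiableAt_const _)

variable {Λ : Vec n → Vec n → ℝ} (hΛ : IsCoordLagrangian T Λ)
include hΛ

theorem diffAt_comp {f : Vec n × Vec n → ℝ} (hf : ContDiffOn ℝ ∞ f (slit T)) {q : Vec n}
    (hq : q ∈ W) : DifferentiableAt ℝ (fun q => f (q, V q)) q :=
  DifferentiableAt.comp (f := fun q => (q, V q)) q (hΛ.diffAt hf (hV.mem_slit hq))
    (differentiableAt_id.prodMk (hV.diffAt hq))

theorem pd_comp {f : Vec n × Vec n → ℝ} (hf : ContDiffOn ℝ ∞ f (slit T)) {q : Vec n}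
    (hq : q ∈ W) (i : Fin n) : pd i (fun q => f (q, V q)) q = dirD (baseDir i) f (q, V q)
      + ∑ l, pd i (fun q => V q l) q * dirD (fibDir l) f (q, V q) :=
  pd_comp_field (hΛ.diffAt hf (hV.mem_slit hq)) (hV.diffAt hq) i

theorem hessCoord_eq {q : Vec n} (hq : q ∈ W) (v : Vec n) (i : Fin n) :
    hessCoord Λ V q v i = ∑ j, hessMatrix Λ V q i j * v j := by
  change ∑ j, (v j * pd j (fun q' => V q' i) q + ∑ k, chern Λ q (V q) i j k * v j * V q k) = _
  refine Finset.sum_congr rfl fun j _ => ?_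
  have h := hΛ.chern_apply_self (hV.mem_slit hq) i j
  rw [hessMatrix, Matrix.of_apply, ← h, add_mul, Finset.sum_mul]
  congr 1
  · ring
  · exact Finset.sum_congr rfl fun k _ => by ring

theorem boxCoord_eq {q : Vec n} (hq : q ∈ W) : boxCoord Λ V q = ∑ i, hessMatrix Λ V q i i := by
  rw [boxCoord]
  refine Finset.sum_congr rfl fun i _ => ?_
  rw [hV.hessCoord_eq hΛ hq, Finset.sum_eq_single i (fun j _ hj => by simp [hj]) (by simp)]
  simp

theorem accel_eq {q : Vec n} (hq : q ∈ W) (i : Fin n) :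
    accel Λ V i q = ∑ j, hessMatrix Λ V q i j * V q j := by
  have h := hΛ.nonlinConn_apply_self (hV.mem_slit hq) i
  simp only [hessMatrix, Matrix.of_apply, add_mul, Finset.sum_add_distrib]
  rw [h, accel]
  congr 1
  exact Finset.sum_congr rfl fun j _ => mul_comm _ _

theorem diffAt_hessMatrix {q : Vec n} (hq : q ∈ W) (i j : Fin n) :
    DifferentiableAt ℝ (fun q => hessMatrix Λ V q i j) q :=
  (hV.diffAt_pd hq i j).fun_add (hV.diffAt_comp hΛ (hΛ.smooth_nonlinConn i j) hq)

theorem pd_accel {q : Vec n} (hq : q ∈ W) (i : Fin n) :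
    pd i (accel Λ V i) q = ∑ j, pd i (fun q => V q j) q * pd j (fun q => V q i) q
      + ∑ j, V q j * pd j (pd i fun q => V q i) q
      + dirD (baseDir i) (fun p => spray Λ p.1 p.2 i) (q, V q)
      + 2 * ∑ l, pd i (fun q => V q l) q * nonlinConn Λ q (V q) i l := by
  have h1 : pd i (accel Λ V i) q =
      pd i (fun q => ∑ j, V q j * pd j (fun q' => V q' i) q) q
        + pd i (fun q => spray Λ q (V q) i) q :=
    dirD_add (E := Vec n) (DifferentiableAt.fun_sum fun j _ =>
      (hV.diffAt_coord hq j).fun_mul (hV.diffAt_pd hq i j))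
      (hV.diffAt_comp hΛ (hΛ.smooth_spray i) hq) _
  have h2 : pd i (fun q => ∑ j, V q j * pd j (fun q' => V q' i) q) q =
      ∑ j, pd i (fun q => V q j * pd j (fun q' => V q' i) q) q :=
    dirD_sum (E := Vec n) (fun j _ => (hV.diffAt_coord hq j).fun_mul (hV.diffAt_pd hq i j)) _
  have h3 : ∀ j, pd i (fun q => V q j * pd j (fun q' => V q' i) q) q =
      pd i (fun q => V q j) q * pd j (fun q => V q i) q
        + V q j * pd j (pd i fun q => V q i) q := by
    intro j
    have := dirD_mul (E := Vec n) (hV.diffAt_coord hq j) (hV.diffAt_pd hq i j)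
      (EuclideanSpace.single i 1)
    refine this.trans ?_
    congr 2
    exact dirD_comm_of_contDiffAt (E := Vec n) (hV.contDiffAt_coord hq i) _ _
  have h4 : pd i (fun q => spray Λ q (V q) i) q =
      dirD (baseDir i) (fun p => spray Λ p.1 p.2 i) (q, V q)
        + ∑ l, pd i (fun q => V q l) q * dirD (fibDir l) (fun p => spray Λ p.1 p.2 i) (q, V q) :=
    hV.pd_comp hΛ (hΛ.smooth_spray i) hq i
  have h5 : ∀ l, dirD (fibDir l) (fun p => spray Λ p.1 p.2 i) (q, V q) =
      2 * nonlinConn Λ q (V q) i l := by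
    intro l
    have := hΛ.nonlinConn_eq (hV.mem_slit hq) i l
    change nonlinConn Λ q (V q) i l = _ at this
    rw [this]; ring
  rw [h1, h2, h4]
  simp only [h3, h5, Finset.sum_add_distrib, mul_left_comm _ (2 : ℝ), ← Finset.mul_sum]
  ring

/-- The Ricci curvature in terms of the trace of the nonlinear connection. -/
theorem ricci_eq {q : Vec n} (hq : q ∈ W) :
    ricci Λ q (V q) = ∑ i, dirD (baseDir i) (fun p => spray Λ p.1 p.2 i) (q, V q)
      - sprayD Λ (fun p => ∑ i, nonlinConn Λ p.1 p.2 i i) (q, V q)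
      - ∑ i, ∑ k, nonlinConn Λ q (V q) i k * nonlinConn Λ q (V q) k i := by
  have hp := hV.mem_slit hq
  have h1 : ∀ i, curvature Λ q (V q) i i =
      dirD (baseDir i) (fun p => spray Λ p.1 p.2 i) (q, V q)
      - sprayD Λ (fun p => nonlinConn Λ p.1 p.2 i i) (q, V q)
      - ∑ k, nonlinConn Λ q (V q) i k * nonlinConn Λ q (V q) k i := by
    intro i
    rw [← hΛ.pd_base (hΛ.smooth_spray i) hp, curvature, sprayD, sub_sub]
    congr 1
    simp only [Finset.sum_add_distrib, Finset.sum_sub_distrib]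
    congr 2
    · refine Finset.sum_congr rfl fun k _ => ?_
      rw [← hΛ.pd_base (hΛ.smooth_nonlinConn i i) hp, mul_comm]
    · refine Finset.sum_congr rfl fun k _ => ?_
      rw [← hΛ.pd_fib (hΛ.smooth_nonlinConn i i) hp, mul_comm]
  have h2 : sprayD Λ (fun p => ∑ i, nonlinConn Λ p.1 p.2 i i) (q, V q) =
      ∑ i, sprayD Λ (fun p => nonlinConn Λ p.1 p.2 i i) (q, V q) := by
    simp only [sprayD, Finset.sum_sub_distrib]
    rw [Finset.sum_comm, Finset.sum_comm (f := fun i k => spray Λ q (V q) k *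
      dirD (fibDir k) (fun p => nonlinConn Λ p.1 p.2 i i) (q, V q))]
    congr 1 <;>
    · refine Finset.sum_congr rfl fun k _ => ?_
      rw [dirD_sum fun i _ => hΛ.diffAt (hΛ.smooth_nonlinConn i i) hp, Finset.mul_sum]
  rw [ricci, h2]
  simp only [h1, Finset.sum_sub_distrib]

/-- Along a vector field which need not be geodesic, the spray derivative is corrected by the
acceleration. -/
theorem sum_pd_comp {f : Vec n × Vec n → ℝ} (hf : ContDiffOn ℝ ∞ f (slit T)) {q : Vec n}
    (hq : q ∈ W) : ∑ k, V q k * pd k (fun q => f (q, V q)) q =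
      sprayD Λ f (q, V q) + ∑ l, accel Λ V l q * dirD (fibDir l) f (q, V q) := by
  simp only [hV.pd_comp hΛ hf hq, sprayD, accel, mul_add, add_mul, Finset.sum_add_distrib,
    Finset.mul_sum, Finset.sum_mul]
  rw [Finset.sum_comm (f := fun l k => V q k * pd k (fun q' => V q' l) q *
    dirD (fibDir l) f (q, V q))]
  simp only [mul_assoc]
  ring

/-- The divergence of the acceleration of an arbitrary vector field. This is the Bochner identity
before any symmetry of the Hessian is used. -/
theorem sum_pd_accel {q : Vec n} (hq : q ∈ W) :
    ∑ i, pd i (accel Λ V i) q + ∑ l, accel Λ V l q *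
        dirD (fibDir l) (fun p => ∑ i, nonlinConn Λ p.1 p.2 i i) (q, V q) =
      ∑ k, V q k * pd k (fun q => ∑ i, hessMatrix Λ V q i i) q
        + ∑ i, ∑ j, hessMatrix Λ V q i j * hessMatrix Λ V q j i + ricci Λ q (V q) := by
  have h1 : ∑ k, V q k * pd k (fun q => ∑ i, hessMatrix Λ V q i i) q =
      ∑ i, ∑ k, V q k * pd k (pd i fun q => V q i) q
        + ∑ k, V q k * pd k (fun q => ∑ i, nonlinConn Λ q (V q) i i) q := by
    rw [Finset.sum_comm, ← Finset.sum_add_distrib]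
    refine Finset.sum_congr rfl fun k _ => ?_
    rw [← Finset.mul_sum, ← mul_add]
    congr 1
    have ha := dirD_add (E := Vec n) (p := q) (f := fun q => ∑ i, pd i (fun q' => V q' i) q)
      (g := fun q => ∑ i, nonlinConn Λ q (V q) i i)
      (DifferentiableAt.fun_sum fun i _ => hV.diffAt_pd hq i i)
      (hV.diffAt_comp hΛ (hΛ.smooth_trace) hq) (EuclideanSpace.single k 1)
    have hb := dirD_sum (E := Vec n) (p := q) (s := Finset.univ)
      (f := fun i q => pd i (fun q' => V q' i) q)
      (fun i _ => hV.diffAt_pd hq i i) (EuclideanSpace.single k 1)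
    rw [hb] at ha
    simp only [hessMatrix, Matrix.of_apply, Finset.sum_add_distrib]
    exact ha
  have h2 := hV.sum_pd_comp hΛ (hΛ.smooth_trace) hq
  have h3 : ∑ i, ∑ j, hessMatrix Λ V q i j * hessMatrix Λ V q j i =
      ∑ i, ∑ j, pd i (fun q => V q j) q * pd j (fun q => V q i) q
      + 2 * ∑ i, ∑ l, pd i (fun q => V q l) q * nonlinConn Λ q (V q) i l
      + ∑ i, ∑ k, nonlinConn Λ q (V q) i k * nonlinConn Λ q (V q) k i := by
    have h4 : ∑ i, ∑ l, pd i (fun q => V q l) q * nonlinConn Λ q (V q) i l =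
        ∑ i, ∑ l, pd l (fun q => V q i) q * nonlinConn Λ q (V q) l i := Finset.sum_comm
    rw [two_mul]
    nth_rewrite 2 [h4]
    simp only [← Finset.sum_add_distrib, hessMatrix, Matrix.of_apply]
    exact Finset.sum_congr rfl fun i _ => Finset.sum_congr rfl fun j _ => by ring
  rw [h1, h3, hV.ricci_eq hΛ hq]
  simp only [hV.pd_accel hΛ hq, Finset.sum_add_distrib, ← Finset.mul_sum]
  change ∑ k, V q k * pd k (fun q => ∑ i, nonlinConn Λ q (V q) i i) q = _ at h2
  linarith

/-! ### Gradient vector fields -/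

/-- The Hessian of a function is symmetric with respect to `g_V`, where `V` is the gradient. -/
theorem lower_hessMatrix_symm {f : Vec n → ℝ} (hf : ContDiffOn ℝ 2 f W)
    (hfV : ∀ q ∈ W, ∀ i, momentum Λ i (q, V q) = pd i f q) {q : Vec n} (hq : q ∈ W) (m j : Fin n) :
    ∑ l, gMat Λ q (V q) m l * hessMatrix Λ V q l j =
      ∑ l, gMat Λ q (V q) j l * hessMatrix Λ V q l m := by
  have hp := hV.mem_slit hq
  have key : ∀ m j, ∑ l, gMat Λ q (V q) m l * hessMatrix Λ V q l j =
      pd j (pd m f) q + (∑ l, gMat Λ q (V q) m l * nonlinConn Λ q (V q) l j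
        - dirD (baseDir j) (momentum Λ m) (q, V q)) := by
    intro m j
    have h1 : pd j (fun q => momentum Λ m (q, V q)) q = pd j (pd m f) q := by
      refine pd_congr ?_ j
      filter_upwards [hV.isOpen.mem_nhds hq] with q hq using hfV q hq m
    rw [hV.pd_comp hΛ (hΛ.smooth_momentum m) hq] at h1
    simp only [hessMatrix, Matrix.of_apply, mul_add, Finset.sum_add_distrib]
    rw [← h1]
    have h2 : ∑ l, gMat Λ q (V q) m l * pd j (fun q => V q l) q =
        ∑ l, pd j (fun q => V q l) q * dirD (fibDir l) (momentum Λ m) (q, V q) := by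
      refine Finset.sum_congr rfl fun l _ => ?_
      rw [← hΛ.gMat_eq hp, hΛ.gMat_symm hp l m, mul_comm]
    rw [h2]
    ring
  rw [key, key]
  have h3 : pd j (pd m f) q = pd m (pd j f) q :=
    dirD_comm_of_contDiffAt (E := Vec n) (hf.contDiffAt (hV.isOpen.mem_nhds hq)) _ _
  have h4 := hΛ.lower_nonlinConn_symm hp m j
  dsimp only at h4
  rw [h3, h4]

/-- The acceleration of a gradient field `V` is the gradient of `L(V)`. -/
theorem lower_accel {f : Vec n → ℝ} (hf : ContDiffOn ℝ 2 f W)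
    (hfV : ∀ q ∈ W, ∀ i, momentum Λ i (q, V q) = pd i f q) {q : Vec n} (hq : q ∈ W) (m : Fin n) :
    ∑ l, gMat Λ q (V q) m l * accel Λ V l q = pd m (fun q => Λ q (V q)) q := by
  have hp := hV.mem_slit hq
  have h1 : ∑ l, gMat Λ q (V q) m l * accel Λ V l q =
      ∑ j, V q j * ∑ l, gMat Λ q (V q) m l * hessMatrix Λ V q l j := by
    simp only [hV.accel_eq hΛ hq, Finset.mul_sum]
    rw [Finset.sum_comm]
    exact Finset.sum_congr rfl fun j _ => Finset.sum_congr rfl fun l _ => by ring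
  have h2 : ∑ j, V q j * ∑ l, gMat Λ q (V q) j l * hessMatrix Λ V q l m =
      ∑ l, momentum Λ l (q, V q) * hessMatrix Λ V q l m := by
    simp only [← hΛ.gMat_apply_self hp, Finset.mul_sum, Finset.sum_mul]
    rw [Finset.sum_comm]
    refine Finset.sum_congr rfl fun l _ => Finset.sum_congr rfl fun j _ => ?_
    rw [← hΛ.gMat_symm hp l j]; ring
  rw [h1]
  simp only [hV.lower_hessMatrix_symm hΛ hf hfV hq m]
  rw [h2, show pd m (fun q => Λ q (V q)) q = _ from hV.pd_comp hΛ hΛ.smooth hq m,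
    ← hΛ.base_lagrangian hp m, add_comm, ← Finset.sum_add_distrib]
  refine Finset.sum_congr rfl fun l _ => ?_
  simp only [hessMatrix, Matrix.of_apply]
  rw [show dirD (fibDir l) (fun p => Λ p.1 p.2) (q, V q) = momentum Λ l (q, V q) from rfl]
  ring

theorem relGradCoord_eq {f u : Vec n → ℝ} (hf : ContDiffOn ℝ 2 f W)
    (hfV : ∀ q ∈ W, ∀ i, momentum Λ i (q, V q) = pd i f q)
    (hu : ∀ q ∈ W, u q = -Λ q (V q)) {q : Vec n} (hq : q ∈ W) (i : Fin n) :
    relGradCoord Λ V u q i = -accel Λ V i q := by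
  have hp := hV.mem_slit hq
  have h1 : ∀ j, pd j u q = - ∑ l, gMat Λ q (V q) j l * accel Λ V l q := by
    intro j
    rw [hV.lower_accel hΛ hf hfV hq]
    have h2 : pd j u q = pd j (fun q => -Λ q (V q)) q := by
      refine pd_congr ?_ j
      filter_upwards [hV.isOpen.mem_nhds hq] with q hq using hu q hq
    rw [h2, pd, fderiv_fun_neg]; rfl
  change ∑ j, gInv Λ q (V q) i j * pd j u q = _
  simp only [h1, mul_neg, Finset.sum_neg_distrib]
  rw [show ∑ j, gInv Λ q (V q) i j * ∑ l, gMat Λ q (V q) j l * accel Λ V l q = accel Λ V i q from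
    hΛ.sum_gInv_gMat hp (fun l => accel Λ V l q) i]

end IsCoordField

/-! ### Derivatives along geodesics -/

namespace IsCoordLagrangian

variable {n : ℕ} {T : Set (Vec n)} {Λ : Vec n → Vec n → ℝ} (hΛ : IsCoordLagrangian T Λ)
include hΛ

theorem smooth_sprayD {f : Vec n × Vec n → ℝ} (hf : ContDiffOn ℝ ∞ f (slit T)) :
    ContDiffOn ℝ ∞ (sprayD Λ f) (slit T) :=
  (ContDiffOn.sum fun k _ => (contDiff_fibCoord k).contDiffOn.mul (hΛ.smooth_dirD hf _)).sub
    (ContDiffOn.sum fun k _ => (hΛ.smooth_spray k).mul (hΛ.smooth_dirD hf _))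

/-- Local existence of geodesics, which are the projections of the integral curves of the
spray. -/
theorem exists_isGeodesicFrom {q v : Vec n} (hq : q ∈ T) (hv : v ≠ 0) :
    ∃ η, IsGeodesicFrom Λ q v η := by
  have hp : (q, v) ∈ slit T := ⟨hq, hv⟩
  let Y : Vec n × Vec n → Vec n × Vec n := fun p =>
    (p.2, WithLp.toLp 2 fun i => -spray Λ p.1 p.2 i)
  have hY : ContDiffAt ℝ 1 Y (q, v) := by
    refine contDiffAt_snd.prodMk ?_
    rw [contDiffAt_euclidean]
    intro i
    exact (((hΛ.smooth_spray i).contDiffAt (hΛ.slit_mem_nhds hp)).of_le (by norm_cast)).neg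
  obtain ⟨α, hα0, ε, hε, hα⟩ :=
    hY.exists_forall_mem_closedBall_exists_eq_forall_mem_Ioo_hasDerivAt₀ 0
  rw [zero_sub, zero_add] at hα
  have hmem : Set.Ioo (-ε) ε ∈ 𝓝 (0 : ℝ) := Ioo_mem_nhds (by linarith) hε
  have hfst : ∀ t ∈ Set.Ioo (-ε) ε, HasDerivAt (fun t => (α t).1) (α t).2 t := fun t ht =>
    (hα t ht).fst
  have hsnd : ∀ t ∈ Set.Ioo (-ε) ε, HasDerivAt (fun t => (α t).2)
      (WithLp.toLp 2 fun i => -spray Λ (α t).1 (α t).2 i) t := fun t ht => (hα t ht).snd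
  refine ⟨fun t => (α t).1, by simp [hα0], ?_, ?_⟩
  · rw [(hfst 0 ⟨by linarith, hε⟩).deriv, hα0]
  · have hslit : ∀ᶠ t in 𝓝 (0 : ℝ), α t ∈ slit T := by
      have hc : ContinuousAt α 0 := (hα 0 ⟨by linarith, hε⟩).continuousAt
      exact hc.eventually (by rw [hα0]; exact hΛ.slit_mem_nhds hp)
    filter_upwards [hmem, hslit] with t ht hts
    refine ⟨(hfst t ht).differentiableAt, ?_⟩
    have hev : deriv (fun t => (α t).1) =ᶠ[𝓝 t] fun t => (α t).2 := by
      filter_upwards [isOpen_Ioo.mem_nhds ht] with s hs using (hfst s hs).deriv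
    refine ((hsnd t ht).congr_of_eventuallyEq hev).congr_deriv ?_
    rw [hev.eq_of_nhds]
    simp only [hΛ.chern_apply_self_self hts]

theorem geodesic_spec {q v : Vec n} (hq : q ∈ T) (hv : v ≠ 0) :
    IsGeodesicFrom Λ q v (geodesic Λ q v) :=
  Classical.epsilon_spec (hΛ.exists_isGeodesicFrom hq hv)

/-- Along the velocity of a geodesic, functions on the tangent bundle are differentiated by the
spray. -/
theorem eventually_hasDerivAt_geodesic {q v : Vec n} (hq : q ∈ T) (hv : v ≠ 0)
    {f : Vec n × Vec n → ℝ} (hf : ContDiffOn ℝ ∞ f (slit T)) :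
    ∀ᶠ t in 𝓝 (0 : ℝ),
      HasDerivAt (fun t => f (geodesic Λ q v t, deriv (geodesic Λ q v) t))
        (sprayD Λ f (geodesic Λ q v t, deriv (geodesic Λ q v) t)) t := by
  obtain ⟨h0, h1, h2⟩ := hΛ.geodesic_spec hq hv
  set η := geodesic Λ q v
  have hslit : ∀ᶠ t in 𝓝 (0 : ℝ), (η t, deriv η t) ∈ slit T := by
    have hc : ContinuousAt (fun t => (η t, deriv η t)) 0 :=
      (h2.self_of_nhds.1.continuousAt).prodMk h2.self_of_nhds.2.continuousAt
    exact hc.eventually (by beta_reduce; rw [h0, h1]; exact hΛ.slit_mem_nhds ⟨hq, hv⟩)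
  filter_upwards [h2, hslit] with t ht hts
  have h3 := (hΛ.diffAt hf hts).hasFDerivAt.comp_hasDerivAt t (ht.1.hasDerivAt.prodMk ht.2)
  refine h3.congr_deriv ?_
  refine (dirD_eq_sum f (η t, deriv η t) _ _).trans ?_
  simp only [hΛ.chern_apply_self_self hts, neg_mul, Finset.sum_neg_distrib, sprayD]
  ring

theorem geodesic_zero {q v : Vec n} (hq : q ∈ T) (hv : v ≠ 0) : geodesic Λ q v 0 = q :=
  (hΛ.geodesic_spec hq hv).1

theorem deriv_geodesic_zero {q v : Vec n} (hq : q ∈ T) (hv : v ≠ 0) :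
    deriv (geodesic Λ q v) 0 = v :=
  (hΛ.geodesic_spec hq hv).2.1

variable {Φ : Vec n → ℝ} (hΦ : ContDiffOn ℝ ∞ Φ T)
include hΦ

theorem smooth_psi : ContDiffOn ℝ ∞ (fun p : Vec n × Vec n => psi Λ Φ p.1 p.2) (slit T) :=
  hΛ.smooth_logVolume.sub (hΦ.comp contDiffOn_fst fun _ hp => hp.1)

theorem hasDerivAt_psiAlong {q v : Vec n} (hq : q ∈ T) (hv : v ≠ 0) :
    HasDerivAt (psiAlong Λ Φ q v) (sprayD Λ (fun p => psi Λ Φ p.1 p.2) (q, v)) 0 := by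
  have h := (hΛ.eventually_hasDerivAt_geodesic hq hv (hΛ.smooth_psi hΦ)).self_of_nhds
  rw [hΛ.geodesic_zero hq hv, hΛ.deriv_geodesic_zero hq hv] at h
  exact h

theorem iteratedDeriv_psiAlong {q v : Vec n} (hq : q ∈ T) (hv : v ≠ 0) :
    iteratedDeriv 2 (psiAlong Λ Φ q v) 0 =
      sprayD Λ (sprayD Λ fun p => psi Λ Φ p.1 p.2) (q, v) := by
  have h1 : deriv (psiAlong Λ Φ q v) =ᶠ[𝓝 0] fun t =>
      sprayD Λ (fun p => psi Λ Φ p.1 p.2) (geodesic Λ q v t, deriv (geodesic Λ q v) t) := by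
    filter_upwards [hΛ.eventually_hasDerivAt_geodesic hq hv (hΛ.smooth_psi hΦ)] with t ht
      using ht.deriv
  have h2 := (hΛ.eventually_hasDerivAt_geodesic hq hv
    (hΛ.smooth_sprayD (hΛ.smooth_psi hΦ))).self_of_nhds
  rw [hΛ.geodesic_zero hq hv, hΛ.deriv_geodesic_zero hq hv] at h2
  rw [iteratedDeriv_succ, iteratedDeriv_one, h1.deriv_eq]
  exact h2.deriv

theorem diffAt_density {q : Vec n} (hq : q ∈ T) : DifferentiableAt ℝ Φ q :=
  (hΦ.contDiffAt (hΛ.isOpen.mem_nhds hq)).differentiableAt (by simp)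

theorem dirD_density {p : Vec n × Vec n} (hp : p ∈ slit T) (a : Vec n × Vec n) :
    dirD a (fun p : Vec n × Vec n => Φ p.1) p = fderiv ℝ Φ p.1 a.1 := by
  have h := HasFDerivAt.comp p (hΛ.diffAt_density hΦ hp.1).hasFDerivAt (hasFDerivAt_fst (𝕜 := ℝ))
  exact congrArg (fun L => L a) h.fderiv

/-- The spray derivative of `ψ` is the trace of the nonlinear connection minus the derivative of
the density. -/
theorem sprayD_psi {p : Vec n × Vec n} (hp : p ∈ slit T) :
    sprayD Λ (fun p => psi Λ Φ p.1 p.2) p =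
      ∑ i, nonlinConn Λ p.1 p.2 i i - ∑ k, p.2 k * pd k Φ p.1 := by
  have hd : DifferentiableAt ℝ (fun p : Vec n × Vec n => Φ p.1) p :=
    (hΛ.diffAt_density hΦ hp.1).comp p differentiableAt_fst
  have h1 : ∀ a, dirD a (fun p : Vec n × Vec n => psi Λ Φ p.1 p.2) p =
      dirD a (logVolume Λ) p - fderiv ℝ Φ p.1 a.1 := fun a => by
    rw [← hΛ.dirD_density hΦ hp a]
    exact dirD_sub (hΛ.diffAt hΛ.smooth_logVolume hp) hd a
  rw [hΛ.trace_nonlinConn hp]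
  simp only [sprayD, h1, mul_sub, Finset.sum_sub_distrib, baseDir, fibDir, map_zero,
    sub_zero, pd]
  ring

/-- The fibre derivatives of the spray derivative of `ψ`. -/
theorem fib_sprayD_psi {p : Vec n × Vec n} (hp : p ∈ slit T) (l : Fin n) :
    dirD (fibDir l) (sprayD Λ fun p => psi Λ Φ p.1 p.2) p =
      dirD (fibDir l) (fun p => ∑ i, nonlinConn Λ p.1 p.2 i i) p - pd l Φ p.1 := by
  have hs : ∀ k, ContDiffOn ℝ ∞ (fun p : Vec n × Vec n => pd k Φ p.1) (slit T) := fun k =>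
    (hΦ.dirD hΛ.isOpen (EuclideanSpace.single k 1)).comp contDiffOn_fst fun _ hp => hp.1
  have h0 : ∀ k, dirD (fibDir l) (fun p : Vec n × Vec n => pd k Φ p.1) p = 0 := by
    intro k
    have hd : DifferentiableAt ℝ (pd k Φ) p.1 :=
      (hΦ.dirD hΛ.isOpen (EuclideanSpace.single k 1)).differentiableAt_of_isOpen hΛ.isOpen hp.1
    have h := HasFDerivAt.comp p hd.hasFDerivAt (hasFDerivAt_fst (𝕜 := ℝ))
    refine (congrArg (fun L => L (fibDir l)) h.fderiv).trans ?_
    simp [fibDir]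
  rw [dirD_congr hΛ.isOpen_slit (fun p hp => hΛ.sprayD_psi hΦ hp) _ hp,
    dirD_sub (hΛ.diffAt hΛ.smooth_trace hp)
      (hΛ.diffAt (ContDiffOn.sum fun k _ => (contDiff_fibCoord k).contDiffOn.mul (hs k)) hp),
    dirD_fib_sum_fibCoord fun k => hΛ.diffAt (hs k) hp]
  simp [h0]

end IsCoordLagrangian

namespace IsCoordField

variable {n : ℕ} {T W : Set (Vec n)} {V : Vec n → Vec n} (hV : IsCoordField T W V)
  {Λ : Vec n → Vec n → ℝ} (hΛ : IsCoordLagrangian T Λ) {Φ : Vec n → ℝ} (hΦ : ContDiffOn ℝ ∞ Φ T)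
include hV hΛ hΦ

theorem boxMCoord_eq {q : Vec n} (hq : q ∈ W) : boxMCoord Λ Φ V q =
    ∑ i, hessMatrix Λ V q i i - sprayD Λ (fun p => psi Λ Φ p.1 p.2) (q, V q) := by
  rw [boxMCoord, hV.boxCoord_eq hΛ hq,
    (hΛ.hasDerivAt_psiAlong hΦ (hV.subset hq) (hV.ne_zero q hq)).deriv]

theorem eventuallyEq_boxMCoord {q : Vec n} (hq : q ∈ W) : boxMCoord Λ Φ V =ᶠ[𝓝 q] fun q =>
    ∑ i, hessMatrix Λ V q i i - sprayD Λ (fun p => psi Λ Φ p.1 p.2) (q, V q) := by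
  filter_upwards [hV.isOpen.mem_nhds hq] with q hq using hV.boxMCoord_eq hΛ hΦ hq

theorem diffAt_boxMCoord {q : Vec n} (hq : q ∈ W) : DifferentiableAt ℝ (boxMCoord Λ Φ V) q :=
  DifferentiableAt.congr_of_eventuallyEq
    ((DifferentiableAt.fun_sum fun i _ => hV.diffAt_hessMatrix hΛ hq i i).fun_sub
      (hV.diffAt_comp hΛ (hΛ.smooth_sprayD (hΛ.smooth_psi hΦ)) hq))
    (hV.eventuallyEq_boxMCoord hΛ hΦ hq)

theorem sum_pd_boxMCoord {q : Vec n} (hq : q ∈ W) :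
    ∑ k, V q k * pd k (boxMCoord Λ Φ V) q =
      ∑ k, V q k * pd k (fun q => ∑ i, hessMatrix Λ V q i i) q
        - sprayD Λ (sprayD Λ fun p => psi Λ Φ p.1 p.2) (q, V q)
        - ∑ l, accel Λ V l q * dirD (fibDir l) (sprayD Λ fun p => psi Λ Φ p.1 p.2) (q, V q) := by
  have hs := hΛ.smooth_sprayD (hΛ.smooth_psi hΦ)
  have h1 : ∀ k, pd k (boxMCoord Λ Φ V) q = pd k (fun q => ∑ i, hessMatrix Λ V q i i) q
      - pd k (fun q => sprayD Λ (fun p => psi Λ Φ p.1 p.2) (q, V q)) q := by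
    intro k
    rw [pd_congr (hV.eventuallyEq_boxMCoord hΛ hΦ hq) k]
    exact dirD_sub (E := Vec n) (DifferentiableAt.fun_sum fun i _ => hV.diffAt_hessMatrix hΛ hq i i)
      (hV.diffAt_comp hΛ hs hq) _
  simp only [h1, mul_sub, Finset.sum_sub_distrib]
  rw [hV.sum_pd_comp hΛ hs hq]
  ring

/-- The weighted Bochner identity for the gradient field `V` of `f`. -/
theorem bochner {f u : Vec n → ℝ} (hf : ContDiffOn ℝ 2 f W)
    (hfV : ∀ q ∈ W, ∀ i, momentum Λ i (q, V q) = pd i f q)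
    (hu : ∀ q ∈ W, u q = -Λ q (V q)) {q : Vec n} (hq : q ∈ W) :
    divCoord Φ (relGradCoord Λ V u) q + ∑ k, V q k * pd k (boxMCoord Λ Φ V) q =
      -ricci Λ q (V q) - sprayD Λ (sprayD Λ fun p => psi Λ Φ p.1 p.2) (q, V q)
        - ∑ i, ∑ j, hessMatrix Λ V q i j * hessMatrix Λ V q j i := by
  have hdiv : divCoord Φ (relGradCoord Λ V u) q =
      -∑ i, pd i (accel Λ V i) q - ∑ i, accel Λ V i q * pd i Φ q := by
    rw [divCoord, Finset.sum_add_distrib, sub_eq_add_neg, ← Finset.sum_neg_distrib,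
      ← Finset.sum_neg_distrib]
    congr 1
    · refine Finset.sum_congr rfl fun i _ => ?_
      have h2 : pd i (fun q => relGradCoord Λ V u q i) q = pd i (fun q => -accel Λ V i q) q := by
        refine pd_congr ?_ i
        filter_upwards [hV.isOpen.mem_nhds hq] with q hq using hV.relGradCoord_eq hΛ hf hfV hu hq i
      rw [h2, pd, fderiv_fun_neg]; rfl
    · refine Finset.sum_congr rfl fun i _ => ?_
      rw [hV.relGradCoord_eq hΛ hf hfV hu hq, neg_mul]
  have h1 := hV.sum_pd_accel hΛ hq
  rw [hdiv, hV.sum_pd_boxMCoord hΛ hΦ hq]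
  have h2 : ∑ l, accel Λ V l q * dirD (fibDir l) (sprayD Λ fun p => psi Λ Φ p.1 p.2) (q, V q) =
      ∑ l, accel Λ V l q * dirD (fibDir l) (fun p => ∑ i, nonlinConn Λ p.1 p.2 i i) (q, V q)
      - ∑ i, accel Λ V i q * pd i Φ q := by
    simp only [hΛ.fib_sprayD_psi hΦ (hV.mem_slit hq), mul_sub, Finset.sum_sub_distrib]
  rw [h2]
  linarith

/-- The weighted Bochner identity multiplied by the weight `exp(2ψ/n)`. Differentiating the weight
along the geodesic adds `(2/n) ψ' □_𝔪 f`, which completes the square `(□_𝔪 f)²/n` to `(□ f)²/n` and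
leaves exactly the term `-ψ'²/n` of the weighted Ricci curvature `Ric_0`. -/
theorem weighted_bochner (hn : (n : ℝ) ≠ 0) {f u : Vec n → ℝ} (hf : ContDiffOn ℝ 2 f W)
    (hfV : ∀ q ∈ W, ∀ i, momentum Λ i (q, V q) = pd i f q)
    (hu : ∀ q ∈ W, u q = -Λ q (V q)) {q : Vec n} (hq : q ∈ W) {w : ℝ → ℝ}
    (hw : ∀ t, w t = Real.exp (2 * psi Λ Φ (geodesic Λ q (V q) t)
      (deriv (geodesic Λ q (V q)) t) / n)) :
    w 0 * divCoord Φ (relGradCoord Λ V u) q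
      + deriv (fun t => w t * boxMCoord Λ Φ V (geodesic Λ q (V q) t)) 0
      + w 0 * boxMCoord Λ Φ V q ^ 2 / n =
    w 0 * ((∑ i, hessMatrix Λ V q i i) ^ 2 / n
      - ∑ i, ∑ j, hessMatrix Λ V q i j * hessMatrix Λ V q j i
      - weightedRicciCoord Λ Φ 0 q (V q)) := by
  have hqT := hV.subset hq
  have hq0 := hV.ne_zero q hq
  have hψ := hΛ.hasDerivAt_psiAlong hΦ hqT hq0
  obtain ⟨h0, h1, h2⟩ := hΛ.geodesic_spec hqT hq0
  have hη : HasDerivAt (geodesic Λ q (V q)) (V q) 0 := by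
    have := h2.self_of_nhds.1.hasDerivAt; rwa [h1] at this
  have hb : HasDerivAt (fun t => boxMCoord Λ Φ V (geodesic Λ q (V q) t))
      (∑ k, V q k * pd k (boxMCoord Λ Φ V) q) 0 := by
    have h3 : HasFDerivAt (boxMCoord Λ Φ V) (fderiv ℝ (boxMCoord Λ Φ V) q)
        (geodesic Λ q (V q) 0) := by
      rw [h0]; exact (hV.diffAt_boxMCoord hΛ hΦ hq).hasFDerivAt
    refine (h3.comp_hasDerivAt (0 : ℝ) hη).congr_deriv ?_
    conv_lhs => rw [vec_eq_sum_single (V q)]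
    simp [pd]
  have hwd : HasDerivAt w
      (w 0 * (2 * sprayD Λ (fun p => psi Λ Φ p.1 p.2) (q, V q) / n)) 0 := by
    have h3 := ((hψ.const_mul 2).div_const (n : ℝ)).exp
    have h4 : w = fun t => Real.exp (2 * psiAlong Λ Φ q (V q) t / n) := funext hw
    rw [h4]; exact h3
  have h5 := (hwd.fun_mul hb).deriv
  simp only [h0] at h5
  rw [h5, weightedRicciCoord, hψ.deriv, hΛ.iteratedDeriv_psiAlong hΦ hqT hq0]
  have h6 := hV.bochner hΛ hΦ hf hfV hu hq
  have h7 : divCoord Φ (relGradCoord Λ V u) q = -ricci Λ q (V q)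
      - sprayD Λ (sprayD Λ fun p => psi Λ Φ p.1 p.2) (q, V q)
      - ∑ i, ∑ j, hessMatrix Λ V q i j * hessMatrix Λ V q j i
      - ∑ k, V q k * pd k (boxMCoord Λ Φ V) q := by linarith
  rw [h7, hV.boxMCoord_eq hΛ hΦ hq]
  field_simp
  ring

end IsCoordField

/-! ### Local expressions of a Finsler spacetime -/

/-- The Gram matrix of a basis with respect to a Lorentzian form has negative determinant. -/
theorem lorentz_gram_det_neg {n : ℕ} {B : Vec n →L[ℝ] Vec n →L[ℝ] ℝ} {e : Fin n → Vec n}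
    (he : IsLorentzOrthonormal (fun a b => B a b) e) (hn : 0 < n)
    (a : Module.Basis (Fin n) ℝ (Vec n)) : (Matrix.of fun i j => B (a i) (a j)).det < 0 := by
  obtain ⟨b, -, hb⟩ := exists_lorentz_coordinates he
  have h1 : (Matrix.of fun i j => B (a i) (a j)) =
      (b.toMatrix a).transpose * Matrix.diagonal lorentzSign * b.toMatrix a := by
    ext i j
    rw [Matrix.mul_apply, Matrix.of_apply, hb]
    refine Finset.sum_congr rfl fun k _ => ?_
    rw [Matrix.mul_diagonal, Matrix.transpose_apply, Module.Basis.toMatrix_apply,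
      Module.Basis.toMatrix_apply]
    ring
  have h2 : (b.toMatrix a).det ≠ 0 := by
    rw [← Module.Basis.det_apply]
    exact (b.isUnit_det a).ne_zero
  have h3 : ∏ i : Fin n, lorentzSign i = -1 := by
    obtain ⟨m, rfl⟩ : ∃ m, n = m + 1 := ⟨n - 1, by omega⟩
    rw [Fin.prod_univ_succ]
    simp [lorentzSign]
  rw [h1, Matrix.det_mul, Matrix.det_mul, Matrix.det_transpose, Matrix.det_diagonal, h3]
  have : 0 < (b.toMatrix a).det * (b.toMatrix a).det := mul_self_pos.2 h2
  linarith

theorem fderiv_fderiv_apply {n : ℕ} {l : Vec n → ℝ} {v : Vec n}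
    (hd : DifferentiableAt ℝ (fderiv ℝ l) v) (a b : Vec n) :
    fderiv ℝ (fun w => fderiv ℝ l w b) v a = fderiv ℝ (fderiv ℝ l) v a b := by
  rw [(hd.hasFDerivAt.clm_apply (hasFDerivAt_const b v)).fderiv]
  simp

section Manifold

variable {n : ℕ} {M : Type*} [TopologicalSpace M] [ChartedSpace (Vec n) M]

/-- The tangent vector with coordinates `(q, v)` in the chart `c`. -/
noncomputable def ofCoord (c : OpenPartialHomeomorph M (Vec n)) (p : Vec n × Vec n) :
    TangentBundle (𝓡 n) M :=
  ⟨c.symm p.1, mfderiv (𝓡 n) (𝓡 n) c.symm p.1 p.2⟩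

theorem tangentVec_ext {y z : M} {v w : Vec n} (h1 : z = y) (h2 : w = v) :
    (⟨z, w⟩ : TangentBundle (𝓡 n) M) = ⟨y, v⟩ := by
  subst h1; subst h2; rfl

variable [IsManifold (𝓡 n) ∞ M]

theorem isManifold_one : IsManifold (𝓡 n) 1 M := IsManifold.of_le (n := ∞) (by norm_cast)

theorem contMDiffOn_ofCoord (x : M) :
    ContMDiffOn 𝓘(ℝ, Vec n × Vec n) (𝓡 n).tangent ∞ (ofCoord (chartAt (Vec n) x))
      ((chartAt (Vec n) x).target ×ˢ Set.univ) := by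
  have := isManifold_one (n := n) (M := M)
  set c := chartAt (Vec n) x
  have h1 : ContMDiffOn (𝓡 n) (𝓡 n) ∞ c.symm c.target := contMDiffOn_chart_symm
  have h2 := h1.contMDiffOn_tangentMapWithin (m := ∞) (by simp) c.open_target.uniqueMDiffOn
  have h3 : ContMDiff 𝓘(ℝ, Vec n × Vec n) (𝓡 n).tangent ∞
      (fun p : Vec n × Vec n => (⟨p.1, p.2⟩ : TangentBundle (𝓡 n) (Vec n))) := by
    have := contMDiff_tangentBundleModelSpaceHomeomorph_symm (I := 𝓡 n) (n := ∞)
    rw [modelWithCornersSelf_prod]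
    exact this
  have h4 := h2.comp (h3.contMDiffOn (s := c.target ×ˢ Set.univ)) (fun p hp => hp.1)
  refine h4.congr fun p hp => ?_
  simp only [ofCoord, Function.comp_apply, tangentMapWithin]
  rw [mfderivWithin_of_isOpen c.open_target hp.1]

theorem mfderiv_symm_coordVec (x : M) {y : M} (hy : y ∈ (chartAt (Vec n) x).source)
    (v : TangentSpace (𝓡 n) y) :
    mfderiv (𝓡 n) (𝓡 n) (chartAt (Vec n) x).symm (chartAt (Vec n) x y)
      (coordVec (chartAt (Vec n) x) y v) = v := by
  have := isManifold_one (n := n) (M := M)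
  have h := (mdifferentiable_chart (I := 𝓡 n) x).symm_comp_deriv hy
  exact congrArg (fun L => L v) h

theorem coordVec_mfderiv_symm (x : M) {q : Vec n} (hq : q ∈ (chartAt (Vec n) x).target)
    (v : Vec n) : coordVec (chartAt (Vec n) x) ((chartAt (Vec n) x).symm q)
      (mfderiv (𝓡 n) (𝓡 n) (chartAt (Vec n) x).symm q v) = v := by
  have := isManifold_one (n := n) (M := M)
  have h := (mdifferentiable_chart (I := 𝓡 n) x).comp_symm_deriv hq
  exact congrArg (fun L => L v) h

theorem ofCoord_coordVec (x : M) {y : M} (hy : y ∈ (chartAt (Vec n) x).source)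
    (v : TangentSpace (𝓡 n) y) :
    ofCoord (chartAt (Vec n) x) (chartAt (Vec n) x y, coordVec (chartAt (Vec n) x) y v) = ⟨y, v⟩ :=
  tangentVec_ext ((chartAt (Vec n) x).left_inv hy) (mfderiv_symm_coordVec x hy v)

/-- The chart at `x` identifies `T_xM` with `ℝⁿ` by the identity. -/
theorem coordVec_self (x : M) (v : TangentSpace (𝓡 n) x) :
    coordVec (chartAt (Vec n) x) x v = v := by
  have := isManifold_one (n := n) (M := M)
  have h := mfderiv_chartAt_eq_tangentCoordChange (I := 𝓡 n) (mem_chart_source (Vec n) x)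
  have h2 := tangentCoordChange_self (I := 𝓡 n) (mem_extChartAt_source x) (v := v)
  exact (congrArg (fun L => L v) h).trans h2

/-- The differential of the inverse chart, as a linear isomorphism. -/
noncomputable def chartSymmEquiv (x : M) {q : Vec n} (hq : q ∈ (chartAt (Vec n) x).target) :
    Vec n ≃ₗ[ℝ] Vec n :=
  LinearEquiv.ofLinearMap
    (mfderiv (𝓡 n) (𝓡 n) (chartAt (Vec n) x).symm q : Vec n →L[ℝ] Vec n).toLinearMap
    (mfderiv (𝓡 n) (𝓡 n) (chartAt (Vec n) x) ((chartAt (Vec n) x).symm q) :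
      Vec n →L[ℝ] Vec n).toLinearMap
    (by
      ext1 v
      have h := mfderiv_symm_coordVec x ((chartAt (Vec n) x).map_target hq) v
      rw [(chartAt (Vec n) x).right_inv hq] at h
      exact h)
    (by ext1 v; exact coordVec_mfderiv_symm x hq v)

namespace FinslerST.FinslerSpacetime

variable (S : FinslerSpacetime n M)

/-- The restriction of `L` to the tangent space at `y`. -/
def fibreL (y : M) : Vec n → ℝ := fun v => S.L ⟨y, v⟩

theorem coordL_eq (c : OpenPartialHomeomorph M (Vec n)) (q v : Vec n) :
    S.coordL c q v = S.fibreL (c.symm q) (mfderiv (𝓡 n) (𝓡 n) c.symm q v) := rfl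

theorem contDiffOn_coordL (x : M) :
    ContDiffOn ℝ ∞ (fun p : Vec n × Vec n => S.coordL (chartAt (Vec n) x) p.1 p.2)
      (slit (chartAt (Vec n) x).target) := by
  rw [← contMDiffOn_iff_contDiffOn]
  refine S.smooth.comp ((contMDiffOn_ofCoord x).mono fun p hp => ⟨hp.1, trivial⟩) fun p hp => ?_
  intro h0
  refine hp.2 ?_
  have h1 := coordVec_mfderiv_symm x hp.1 p.2
  have h2 : mfderiv (𝓡 n) (𝓡 n) (chartAt (Vec n) x).symm p.1 p.2 = 0 := h0
  rw [h2, coordVec, map_zero] at h1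
  exact h1.symm

/-- Near `y` the smoothness of the fibre restriction is read off in the chart at `y`, which
identifies `T_yM` with `ℝⁿ` by the identity. -/
theorem isLorentzMinkowski_fibreL (y : M) : IsLorentzMinkowski (S.fibreL y) := by
  have hsm : ContDiffOn ℝ ∞ (S.fibreL y) {0}ᶜ := by
    have hy := mem_chart_source (Vec n) y
    have h := S.contDiffOn_coordL y
    have h2 : ContDiffOn ℝ ∞ (fun v : Vec n => ((chartAt (Vec n) y) y, v)) {0}ᶜ :=
      (contDiff_const.prodMk contDiff_id).contDiffOn
    refine (h.comp h2 fun v hv => ⟨(chartAt (Vec n) y).map_source hy, hv⟩).congr fun v _ => ?_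
    have h3 : ofCoord (chartAt (Vec n) y) (chartAt (Vec n) y y, v) = ⟨y, v⟩ :=
      (congrArg (fun w : Vec n => ofCoord (chartAt (Vec n) y) (chartAt (Vec n) y y, w))
        (coordVec_self y v)).symm.trans (ofCoord_coordVec y hy v)
    exact (congrArg S.L h3).symm
  refine ⟨hsm, fun v c hc => S.homogeneous y v c hc, fun v hv => ?_⟩
  obtain ⟨e, he⟩ := S.lorentzian y v hv
  refine ⟨e, fun i j => ?_⟩
  rw [← he i j]
  have hd : DifferentiableAt ℝ (fderiv ℝ (S.fibreL y)) v :=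
    ((hsm.contDiffAt (isOpen_compl_singleton.mem_nhds hv)).fderiv_right
      (m := ∞) (by simp)).differentiableAt (by simp)
  exact (fderiv_fderiv_apply hd (e i) (e j)).symm

theorem fundTensor_eq {y : M} {v : Vec n} (hv : v ≠ 0) (a b : Vec n) :
    fundTensor S.L y v a b = fderiv ℝ (fderiv ℝ (S.fibreL y)) v a b := by
  have hd := (S.isLorentzMinkowski_fibreL y).differentiableAt_fderiv hv
  exact fderiv_fderiv_apply hd a b

theorem chartSymm_ne_zero (x : M) {q : Vec n} (hq : q ∈ (chartAt (Vec n) x).target) {v : Vec n}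
    (hv : v ≠ 0) : (mfderiv (𝓡 n) (𝓡 n) (chartAt (Vec n) x).symm q v : Vec n) ≠ 0 :=
  (chartSymmEquiv x hq).map_ne_zero_iff.2 hv

theorem fderiv_coordL (x : M) {q : Vec n} (hq : q ∈ (chartAt (Vec n) x).target) {v : Vec n}
    (hv : v ≠ 0) (a : Vec n) :
    fderiv ℝ (S.coordL (chartAt (Vec n) x) q) v a =
      fderiv ℝ (S.fibreL ((chartAt (Vec n) x).symm q))
        (mfderiv (𝓡 n) (𝓡 n) (chartAt (Vec n) x).symm q v)
        (mfderiv (𝓡 n) (𝓡 n) (chartAt (Vec n) x).symm q a) := by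
  let A : Vec n →L[ℝ] Vec n := mfderiv (𝓡 n) (𝓡 n) (chartAt (Vec n) x).symm q
  have h := ((S.isLorentzMinkowski_fibreL ((chartAt (Vec n) x).symm q)).differentiableAt
    (chartSymm_ne_zero x hq hv)).hasFDerivAt.comp v A.hasFDerivAt
  exact congrArg (fun L => L a) h.fderiv

theorem gMat_coordL (x : M) {q : Vec n} (hq : q ∈ (chartAt (Vec n) x).target) {v : Vec n}
    (hv : v ≠ 0) (i j : Fin n) :
    gMat (S.coordL (chartAt (Vec n) x)) q v i j =
      fderiv ℝ (fderiv ℝ (S.fibreL ((chartAt (Vec n) x).symm q)))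
        (mfderiv (𝓡 n) (𝓡 n) (chartAt (Vec n) x).symm q v)
        (mfderiv (𝓡 n) (𝓡 n) (chartAt (Vec n) x).symm q (EuclideanSpace.single i (1 : ℝ) : Vec n))
        (mfderiv (𝓡 n) (𝓡 n) (chartAt (Vec n) x).symm q
          (EuclideanSpace.single j (1 : ℝ) : Vec n)) := by
  let A : Vec n →L[ℝ] Vec n := mfderiv (𝓡 n) (𝓡 n) (chartAt (Vec n) x).symm q
  have hd := (S.isLorentzMinkowski_fibreL ((chartAt (Vec n) x).symm q)).differentiableAt_fderiv
    (chartSymm_ne_zero x hq hv)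
  have h := (HasFDerivAt.comp v hd.hasFDerivAt A.hasFDerivAt).clm_apply
    (hasFDerivAt_const (A (EuclideanSpace.single j (1 : ℝ))) v)
  have h2 : gMat (S.coordL (chartAt (Vec n) x)) q v i j = pd i (fun v' =>
      fderiv ℝ (S.fibreL ((chartAt (Vec n) x).symm q)) (A v')
        (A (EuclideanSpace.single j (1 : ℝ)))) v := by
    rw [gMat, Matrix.of_apply]
    refine pd_congr ?_ i
    filter_upwards [isOpen_compl_singleton.mem_nhds hv] with v' hv'
    exact S.fderiv_coordL x hq hv' _
  rw [h2]
  refine (congrArg (fun L => L (EuclideanSpace.single i (1 : ℝ))) h.fderiv).trans ?_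
  simp [A]
  rfl

theorem isCoordLagrangian (x : M) :
    IsCoordLagrangian (chartAt (Vec n) x).target (S.coordL (chartAt (Vec n) x)) where
  isOpen := (chartAt (Vec n) x).open_target
  smooth := S.contDiffOn_coordL x
  homogeneous := by
    intro q _ v c hc
    let A : Vec n →L[ℝ] Vec n := mfderiv (𝓡 n) (𝓡 n) (chartAt (Vec n) x).symm q
    exact (congrArg (S.fibreL ((chartAt (Vec n) x).symm q)) (map_smul A c v)).trans
      ((S.isLorentzMinkowski_fibreL _).homogeneous (A v) c hc)
  det_neg := by
    intro q hq v hv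
    obtain ⟨e, he⟩ := (S.isLorentzMinkowski_fibreL ((chartAt (Vec n) x).symm q)).lorentzian _
      (chartSymm_ne_zero x hq hv)
    have hn : 0 < n := by
      rcases Nat.eq_zero_or_pos n with h | h
      · subst h; exact absurd (Subsingleton.elim v 0) hv
      · exact h
    have h := lorentz_gram_det_neg he hn
      ((EuclideanSpace.basisFun (Fin n) ℝ).toBasis.map (chartSymmEquiv x hq))
    refine lt_of_eq_of_lt (congrArg Matrix.det ?_) h
    ext i j
    rw [S.gMat_coordL x hq hv]
    simp only [Matrix.of_apply, Module.Basis.map_apply, OrthonormalBasis.coe_toBasis,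
      EuclideanSpace.basisFun_apply]
    rfl

end FinslerST.FinslerSpacetime

end Manifold

/-! ### Regularity of the gradient -/

/-- A covector field `df` of class `C²` is the Legendre image of a vector field of class `C²` near
each point, by the implicit function theorem. -/
theorem IsCoordLagrangian.exists_momentum_eq {n : ℕ} {T : Set (Vec n)} {Λ : Vec n → Vec n → ℝ}
    (hΛ : IsCoordLagrangian T Λ) {f : Vec n → ℝ} {q₀ v₀ : Vec n} (hq : q₀ ∈ T) (hv : v₀ ≠ 0)
    (hf : ContDiffAt ℝ 3 f q₀) (h : ∀ i, momentum Λ i (q₀, v₀) = pd i f q₀) :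
    ∃ V : Vec n → Vec n, ContDiffAt ℝ 2 V q₀ ∧ V q₀ = v₀ ∧
      ∀ᶠ q in 𝓝 q₀, ∀ i, momentum Λ i (q, V q) = pd i f q := by
  have hp : (q₀, v₀) ∈ slit T := ⟨hq, hv⟩
  have hpd : ∀ i, ContDiffAt ℝ 2 (pd i f) q₀ := fun i =>
    (hf.fderiv_right (m := 2) (by norm_num)).clm_apply contDiffAt_const
  have hmom : ∀ i, ContDiffAt ℝ 2 (momentum Λ i) (q₀, v₀) := fun i =>
    ((hΛ.smooth_momentum i).contDiffAt (hΛ.slit_mem_nhds hp)).of_le (by norm_cast)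
  have hpd' : ∀ i, ContDiffAt ℝ 2 (fun p : Vec n × Vec n => pd i f p.1) (q₀, v₀) := fun i =>
    ContDiffAt.comp (q₀, v₀) (g := pd i f) (hpd i) contDiffAt_fst
  let φ : Vec n × Vec n → Vec n := fun p => WithLp.toLp 2 fun i => momentum Λ i p - pd i f p.1
  have hφ : ContDiffAt ℝ 2 φ (q₀, v₀) :=
    contDiffAt_euclidean.2 fun i => (hmom i).sub (hpd' i)
  have hφ0 : φ (q₀, v₀) = 0 := by
    ext i
    exact sub_eq_zero.2 (h i)
  -- the fibre derivative of the momentum is the matrix `g`, which is invertible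
  have hD : ∀ (a : Vec n) (j : Fin n), fderiv ℝ φ (q₀, v₀) (0, a) j =
      ∑ i, gMat Λ q₀ v₀ j i * a i := by
    intro a j
    have h1 : fderiv ℝ φ (q₀, v₀) (0, a) j =
        dirD (0, a) (fun p => momentum Λ j p - pd j f p.1) (q₀, v₀) := by
      have := ((EuclideanSpace.proj (𝕜 := ℝ) j : Vec n →L[ℝ] ℝ).hasFDerivAt).comp (q₀, v₀)
        (hφ.differentiableAt (by simp)).hasFDerivAt
      exact (congrArg (fun L => L (0, a)) this.fderiv).symm
    have h2 : dirD (0, a) (fun p : Vec n × Vec n => pd j f p.1) (q₀, v₀) = 0 := by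
      have := HasFDerivAt.comp (q₀, v₀) (g := pd j f)
        ((hpd j).differentiableAt (by simp)).hasFDerivAt
        (hasFDerivAt_fst (𝕜 := ℝ) (p := (q₀, v₀)))
      refine (congrArg (fun L => L (0, a)) this.fderiv).trans ?_
      simp
    rw [h1, dirD_sub ((hmom j).differentiableAt (by simp)) ((hpd' j).differentiableAt (by simp)),
      h2, sub_zero, dirD_eq_sum]
    simp only [PiLp.zero_apply, zero_mul, Finset.sum_const_zero, zero_add]
    refine Finset.sum_congr rfl fun i _ => ?_
    rw [← hΛ.gMat_eq hp, hΛ.gMat_symm hp, mul_comm]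
  have hinj : Function.Injective
      (fderiv ℝ φ (q₀, v₀) ∘L ContinuousLinearMap.inr ℝ (Vec n) (Vec n)).toLinearMap := by
    intro a b hab
    ext m
    refine hΛ.eq_of_lower_eq hp (a := a) (b := b) (fun m => ?_) m
    rw [← hD, ← hD]
    exact congrArg (fun v : Vec n => v m) hab
  have hinv : (fderiv ℝ φ (q₀, v₀) ∘L ContinuousLinearMap.inr ℝ (Vec n) (Vec n)).IsInvertible :=
    ⟨(LinearEquiv.ofInjectiveEndo _ hinj).toContinuousLinearEquiv, by ext v; rfl⟩
  refine ⟨hφ.implicitFunction (by simp) hinv, hφ.contDiffAt_implicitFunction (by simp) hinv,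
    hφ.implicitFunction_apply_self (by simp) hinv, ?_⟩
  filter_upwards [hφ.eventually_apply_implicitFunction (by simp) hinv] with q hq i
  exact sub_eq_zero.1 (congrArg (fun v : Vec n => v i) (hq.trans hφ0))

namespace FinslerST.FinslerSpacetime

variable {n : ℕ} {M : Type*} [TopologicalSpace M] [ChartedSpace (Vec n) M]
  [IsManifold (𝓡 n) ∞ M] (S : FinslerSpacetime n M)

theorem continuousOn_coordField_X (x : M) :
    ContinuousOn (coordField (chartAt (Vec n) x) S.X) (chartAt (Vec n) x).target := by
  have := isManifold_one (n := n) (M := M)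
  set c := chartAt (Vec n) x
  have h1 : ContMDiffOn (𝓡 n) (𝓡 n) ∞ c c.source := contMDiffOn_chart
  have h2 := h1.continuousOn_tangentMapWithin (by simp) c.open_source.uniqueMDiffOn
  have h3 : ContinuousOn (fun q => (⟨c.symm q, S.X (c.symm q)⟩ : TangentBundle (𝓡 n) M))
      c.target := S.X_smooth.continuous.comp_continuousOn c.continuousOn_symm
  have h4 := h2.comp h3 fun q hq => c.map_target hq
  have h5 := (continuous_snd.comp
    (tangentBundleModelSpaceHomeomorph (𝓡 n)).continuous).comp_continuousOn h4
  refine h5.congr fun q hq => ?_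
  have h6 : mfderivWithin (𝓡 n) (𝓡 n) c c.source (c.symm q) = mfderiv (𝓡 n) (𝓡 n) c (c.symm q) :=
    mfderivWithin_of_isOpen c.open_source (c.map_target hq)
  exact (congrArg (fun L => L (S.X (c.symm q))) h6).symm

/-- A continuous coordinate vector field which is future-directed timelike at one point is so
nearby. -/
theorem eventually_mem_future (x : M) {V : Vec n → Vec n} {q₀ : Vec n}
    (hq₀ : q₀ ∈ (chartAt (Vec n) x).target) (hV : ContinuousAt V q₀)
    (h : mfderiv (𝓡 n) (𝓡 n) (chartAt (Vec n) x).symm q₀ (V q₀) ∈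
      S.future ((chartAt (Vec n) x).symm q₀)) :
    ∀ᶠ q in 𝓝 q₀, mfderiv (𝓡 n) (𝓡 n) (chartAt (Vec n) x).symm q (V q) ∈
      S.future ((chartAt (Vec n) x).symm q) := by
  set c := chartAt (Vec n) x with hc
  let Y := coordField c S.X
  have hAY : ∀ q ∈ c.target, mfderiv (𝓡 n) (𝓡 n) c.symm q (Y q) = S.X (c.symm q) := by
    intro q hq
    have h1 := mfderiv_symm_coordVec x (c.map_target hq) (S.X (c.symm q))
    rw [c.right_inv hq] at h1
    exact h1
  have hseg : ∀ q ∈ c.target, ∀ s : ℝ, S.coordL c q (Y q + s • (V q - Y q)) =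
      S.fibreL (c.symm q) (S.X (c.symm q) + s •
        (mfderiv (𝓡 n) (𝓡 n) c.symm q (V q) - S.X (c.symm q))) := by
    intro q hq s
    let A : Vec n →L[ℝ] Vec n := mfderiv (𝓡 n) (𝓡 n) c.symm q
    have h2 : A (Y q) = S.X (c.symm q) := hAY q hq
    rw [coordL_eq, ← h2]
    refine congrArg (S.fibreL (c.symm q)) ?_
    change A (Y q + s • (V q - Y q)) = A (Y q) + s • (A (V q) - A (Y q))
    rw [map_add, map_smul, map_sub]
  have hX : ∀ y, S.fibreL y (S.X y) < 0 := S.X_timelike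
  have hl := S.isLorentzMinkowski_fibreL
  have hcont : ContinuousAt Y q₀ :=
    (S.continuousOn_coordField_X x).continuousAt (c.open_target.mem_nhds hq₀)
  have hev : ∀ᶠ q in 𝓝 q₀, ∀ s ∈ Set.Icc (0 : ℝ) 1, S.coordL c q (Y q + s • (V q - Y q)) < 0 := by
    refine isCompact_Icc.eventually_forall_of_forall_eventually
      (P := fun q s => S.coordL c q (Y q + s • (V q - Y q)) < 0) fun s hs => ?_
    have hneg : S.coordL c q₀ (Y q₀ + s • (V q₀ - Y q₀)) < 0 := by
      rw [hseg q₀ hq₀]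
      exact (hl _).futureCone_segment ((hl _).mem_futureCone_self (hX _)) h hs
    have hne : Y q₀ + s • (V q₀ - Y q₀) ≠ 0 := by
      intro h0
      rw [h0, coordL_eq] at hneg
      have : (mfderiv (𝓡 n) (𝓡 n) c.symm q₀ (0 : Vec n) : Vec n) = 0 :=
        map_zero (mfderiv (𝓡 n) (𝓡 n) c.symm q₀ : Vec n →L[ℝ] Vec n)
      exact (hl _).ne_zero hneg this
    have h3 : ContinuousAt (fun z : Vec n × ℝ => (z.1, Y z.1 + z.2 • (V z.1 - Y z.1))) (q₀, s) := by
      have hY1 : ContinuousAt (fun z : Vec n × ℝ => Y z.1) (q₀, s) :=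
        ContinuousAt.comp (x := (q₀, s)) (g := Y) hcont continuousAt_fst
      have hV1 : ContinuousAt (fun z : Vec n × ℝ => V z.1) (q₀, s) :=
        ContinuousAt.comp (x := (q₀, s)) (g := V) hV continuousAt_fst
      exact continuousAt_fst.prodMk (hY1.add (continuousAt_snd.smul (hV1.sub hY1)))
    have hΛ := S.isCoordLagrangian x
    have h4 : ContinuousAt (fun p : Vec n × Vec n => S.coordL c p.1 p.2)
        (q₀, Y q₀ + s • (V q₀ - Y q₀)) :=
      (hΛ.diffAt (p := (q₀, Y q₀ + s • (V q₀ - Y q₀))) hΛ.smooth ⟨hq₀, hne⟩).continuousAt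
    exact (ContinuousAt.comp (x := (q₀, s))
      (g := fun p : Vec n × Vec n => S.coordL c p.1 p.2) h4 h3).eventually_lt
      continuousAt_const hneg
  filter_upwards [hev, c.open_target.mem_nhds hq₀] with q hq hqT
  refine (hl _).mem_futureCone_of_segment ((hl _).mem_futureCone_self (hX _)) fun s hs => ?_
  exact (hseg q hqT s).symm.trans_lt (hq s hs)

variable {h : M → ℝ} {U : Set M}

/-- The gradient of `h` is a future-directed timelike vector whose momentum is `dh`. -/
theorem gradient_spec (htemp : S.IsTemporalOn (fun y => -h y) U) {y : M} (hy : y ∈ U) :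
    S.gradient h y ∈ S.future y ∧ fderiv ℝ (S.fibreL y) (S.gradient h y) = diff h y := by
  have hpolar : diff h y ∈ S.polar y := by
    have h1 := htemp.2 y hy
    have h2 : diff (fun y => -h y) y = -diff h y := mfderiv_neg (I := 𝓡 n) (f := h) (x := y)
    rwa [h2, neg_neg] at h1
  obtain ⟨v, hv, h1, h2⟩ := (S.isLorentzMinkowski_fibreL y).exists_legendre (S.X_timelike y)
    (ξ := (diff h y : Vec n →L[ℝ] ℝ)) hpolar
  have hspec : S.gradient h y ∈ S.future y ∧
      S.L ⟨y, S.gradient h y⟩ = S.dualL y (diff h y) ∧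
        S.dualL y (diff h y) = diff h y (S.gradient h y) / 2 :=
    Classical.epsilon_spec (p := fun v : TangentSpace (𝓡 n) y => v ∈ S.future y ∧
      S.L ⟨y, v⟩ = S.dualL y (diff h y) ∧ S.dualL y (diff h y) = diff h y v / 2) ⟨v, hv, h1, h2⟩
  exact ⟨hspec.1, (S.isLorentzMinkowski_fibreL y).fderiv_eq_of_legendre
    (ξ := (diff h y : Vec n →L[ℝ] ℝ)) hpolar hspec.1 hspec.2.1 (hspec.2.1.trans hspec.2.2)⟩

theorem gradient_timelike (htemp : S.IsTemporalOn (fun y => -h y) U) {y : M} (hy : y ∈ U) :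
    S.fibreL y (S.gradient h y) < 0 := (S.gradient_spec htemp hy).1.1

theorem mfderiv_symm_coordField (x : M) (G : (y : M) → TangentSpace (𝓡 n) y) {q : Vec n}
    (hq : q ∈ (chartAt (Vec n) x).target) :
    mfderiv (𝓡 n) (𝓡 n) (chartAt (Vec n) x).symm q (coordField (chartAt (Vec n) x) G q) =
      G ((chartAt (Vec n) x).symm q) := by
  have h1 := mfderiv_symm_coordVec x ((chartAt (Vec n) x).map_target hq)
    (G ((chartAt (Vec n) x).symm q))
  rw [(chartAt (Vec n) x).right_inv hq] at h1
  exact h1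

/-- The differential of a function in coordinates. -/
theorem diff_mfderiv_symm (x : M) {q : Vec n} (hq : q ∈ (chartAt (Vec n) x).target) {f : M → ℝ}
    (hf : MDifferentiableAt (𝓡 n) 𝓘(ℝ, ℝ) f ((chartAt (Vec n) x).symm q)) (a : Vec n) :
    diff f ((chartAt (Vec n) x).symm q) (mfderiv (𝓡 n) (𝓡 n) (chartAt (Vec n) x).symm q a) =
      fderiv ℝ (f ∘ (chartAt (Vec n) x).symm) q a := by
  have := isManifold_one (n := n) (M := M)
  have h1 := mfderiv_comp q hf (mdifferentiableAt_atlas_symm (chart_mem_atlas (Vec n) x) hq)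
  rw [mfderiv_eq_fderiv] at h1
  exact (congrArg (fun L => L a) h1).symm

/-- The coordinate vector `v` has momentum `dh` in coordinates exactly if the differential of `L`
on the tangent space, at the tangent vector with coordinates `v`, is `dh`. -/
theorem momentum_eq_iff (x : M) {q v : Vec n} (hq : q ∈ (chartAt (Vec n) x).target) (hv : v ≠ 0)
    (hh : MDifferentiableAt (𝓡 n) 𝓘(ℝ, ℝ) h ((chartAt (Vec n) x).symm q)) :
    (∀ i, momentum (S.coordL (chartAt (Vec n) x)) i (q, v) =
      pd i (h ∘ (chartAt (Vec n) x).symm) q) ↔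
    fderiv ℝ (S.fibreL ((chartAt (Vec n) x).symm q))
      (mfderiv (𝓡 n) (𝓡 n) (chartAt (Vec n) x).symm q v) =
        diff h ((chartAt (Vec n) x).symm q) := by
  have hΛ := S.isCoordLagrangian x
  have h1 : ∀ i, momentum (S.coordL (chartAt (Vec n) x)) i (q, v) =
      fderiv ℝ (S.coordL (chartAt (Vec n) x) q) v (EuclideanSpace.single i 1) := fun i =>
    (hΛ.pd_fib (p := (q, v)) hΛ.smooth ⟨hq, hv⟩ i).symm
  constructor
  · intro H
    have h2 : fderiv ℝ (S.coordL (chartAt (Vec n) x) q) v =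
        fderiv ℝ (h ∘ (chartAt (Vec n) x).symm) q := by
      ext a
      rw [vec_eq_sum_single a, map_sum, map_sum]
      refine Finset.sum_congr rfl fun i _ => ?_
      rw [map_smul, map_smul, ← h1, H]; rfl
    refine ContinuousLinearMap.ext fun b => ?_
    obtain ⟨a, rfl⟩ := (chartSymmEquiv x hq).surjective b
    refine (S.fderiv_coordL x hq hv a).symm.trans ?_
    rw [h2]
    exact (diff_mfderiv_symm x hq hh a).symm
  · intro H i
    rw [h1, S.fderiv_coordL x hq hv, H]
    exact diff_mfderiv_symm x hq hh _

/-- Near each point of `U` the gradient is of class `C²`. The implicit function theorem gives a `C²`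
field with momentum `dh`, which is future-directed near the point, and there it is the gradient
because the differential of `L` is injective on the future cone. -/
theorem exists_isCoordField (hU : IsOpen U) (hh : ContMDiffOn (𝓡 n) 𝓘(ℝ, ℝ) 3 h U)
    (htemp : S.IsTemporalOn (fun y => -h y) U) {x : M} (hx : x ∈ U) :
    ∃ W, chartAt (Vec n) x x ∈ W ∧ (∀ q ∈ W, (chartAt (Vec n) x).symm q ∈ U) ∧
      IsCoordField (chartAt (Vec n) x).target W
        (coordField (chartAt (Vec n) x) (S.gradient h)) ∧
      ContDiffOn ℝ 2 (h ∘ (chartAt (Vec n) x).symm) W ∧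
      ∀ q ∈ W, ∀ i, momentum (S.coordL (chartAt (Vec n) x)) i
        (q, coordField (chartAt (Vec n) x) (S.gradient h) q) =
          pd i (h ∘ (chartAt (Vec n) x).symm) q := by
  set c := chartAt (Vec n) x with hc
  set V := coordField c (S.gradient h) with hVdef
  have hΛ := S.isCoordLagrangian x
  have hxs := mem_chart_source (Vec n) x
  have hq₀ : c x ∈ c.target := c.map_source hxs
  have hsx : c.symm (c x) = x := c.left_inv hxs
  let D := c.target ∩ c.symm ⁻¹' U
  have hD : IsOpen D := c.symm.isOpen_inter_preimage hU
  have hq₀D : c x ∈ D := ⟨hq₀, by rw [Set.mem_preimage, hsx]; exact hx⟩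
  have hf : ContDiffOn ℝ 3 (h ∘ c.symm) D := by
    rw [← contMDiffOn_iff_contDiffOn]
    have h1 : ContMDiffOn (𝓡 n) (𝓡 n) 3 c.symm c.target :=
      (contMDiffOn_chart_symm (n := ∞)).of_le (by norm_cast)
    exact hh.comp (h1.mono Set.inter_subset_left) fun q hq => hq.2
  have hmd : ∀ q ∈ D, MDifferentiableAt (𝓡 n) 𝓘(ℝ, ℝ) h (c.symm q) := fun q hq =>
    (hh.contMDiffAt (hU.mem_nhds hq.2)).mdifferentiableAt (by simp)
  have hAV : ∀ q ∈ D, mfderiv (𝓡 n) (𝓡 n) c.symm q (V q) = S.gradient h (c.symm q) :=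
    fun q hq => mfderiv_symm_coordField x (S.gradient h) hq.1
  have hne : ∀ q ∈ D, V q ≠ 0 := by
    intro q hq h0
    have h1 := hAV q hq
    have h2 := (S.isLorentzMinkowski_fibreL _).ne_zero (S.gradient_timelike htemp hq.2)
    rw [h0] at h1
    exact h2 (h1.symm.trans (map_zero (mfderiv (𝓡 n) (𝓡 n) c.symm q : Vec n →L[ℝ] Vec n)))
  have hmom : ∀ q ∈ D, ∀ i, momentum (S.coordL c) i (q, V q) = pd i (h ∘ c.symm) q := by
    intro q hq
    refine (S.momentum_eq_iff x hq.1 (hne q hq) (hmd q hq)).2 ?_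
    have h1 := (S.gradient_spec htemp hq.2).2
    rw [← hAV q hq] at h1
    exact h1
  obtain ⟨V', hV', hV0, hV'm⟩ := hΛ.exists_momentum_eq hq₀ (hne _ hq₀D)
    (hf.contDiffAt (hD.mem_nhds hq₀D)) (hmom _ hq₀D)
  have hfut : ∀ᶠ q in 𝓝 (c x), mfderiv (𝓡 n) (𝓡 n) c.symm q (V' q) ∈ S.future (c.symm q) := by
    refine S.eventually_mem_future x hq₀ hV'.continuousAt ?_
    have h1 := (S.gradient_spec htemp hq₀D.2).1
    rw [← hAV _ hq₀D, ← hV0] at h1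
    exact h1
  -- both fields are future-directed with the same momentum, hence equal
  have heq : ∀ᶠ q in 𝓝 (c x), V' q = V q := by
    filter_upwards [hfut, hV'm, hD.mem_nhds hq₀D] with q h1 h2 hq
    have hl := S.isLorentzMinkowski_fibreL (c.symm q)
    have hV'0 : V' q ≠ 0 := by
      intro h0
      rw [h0] at h1
      exact hl.ne_zero h1.1 (map_zero (mfderiv (𝓡 n) (𝓡 n) c.symm q : Vec n →L[ℝ] Vec n))
    have h3 := (S.momentum_eq_iff x hq.1 hV'0 (hmd q hq)).1 h2
    have h4 := S.gradient_spec htemp hq.2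
    have h5 := hl.fderiv_injOn_futureCone h1 h4.1 (h3.trans h4.2.symm)
    exact (chartSymmEquiv x hq.1).injective (h5.trans (hAV q hq).symm)
  have hV2 : ContDiffAt ℝ 2 V (c x) := hV'.congr_of_eventuallyEq (heq.mono fun _ h => h.symm)
  obtain ⟨W, hWsub, hWo, hWx⟩ := mem_nhds_iff.1
    (Filter.inter_mem (hV2.eventually (by norm_num)) (hD.mem_nhds hq₀D))
  exact ⟨W, hWx, fun q hq => (hWsub hq).2.2,
    ⟨hWo, fun q hq => (hWsub hq).2.1, fun q hq =>
      ContDiffAt.contDiffWithinAt (show ContDiffAt ℝ 2 V q from (hWsub hq).1),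
      fun q hq => hne q (hWsub hq).2⟩,
    (hf.of_le (by norm_num)).mono fun q hq => (hWsub hq).2, fun q hq => hmom q (hWsub hq).2⟩

end FinslerST.FinslerSpacetime

/-! ### Self-adjoint endomorphisms of a Lorentzian vector space -/

section LorentzAlgebra

variable {n : ℕ} {B : Vec n →L[ℝ] Vec n →L[ℝ] ℝ} {e : Fin n → Vec n}
  {H : Vec n →ₗ[ℝ] Vec n}

theorem lorentz_apply_basis {b : Module.Basis (Fin n) ℝ (Vec n)} (hb : ∀ i, b i = e i)
    (hB : ∀ u w, B u w = ∑ i, lorentzSign i * b.repr u i * b.repr w i) (u : Vec n) (i : Fin n) :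
    B u (e i) = lorentzSign i * b.repr u i := by
  rw [← hb i, hB, Finset.sum_eq_single i (fun j _ hj => by simp [hj]) (by simp)]
  simp

theorem lorentz_trace_eq (he : IsLorentzOrthonormal (fun a b => B a b) e) (A : Vec n →ₗ[ℝ] Vec n) :
    LinearMap.trace ℝ (Vec n) A = ∑ i, lorentzSign i * B (A (e i)) (e i) := by
  obtain ⟨b, hb, hB⟩ := exists_lorentz_coordinates he
  rw [LinearMap.trace_eq_matrix_trace ℝ b, Matrix.trace]
  refine Finset.sum_congr rfl fun i _ => ?_
  rw [Matrix.diag_apply, LinearMap.toMatrix_apply, hb, lorentz_apply_basis hb hB, ← mul_assoc,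
    lorentzSign_mul_self, one_mul]

theorem lorentz_trace_sq_eq (he : IsLorentzOrthonormal (fun a b => B a b) e)
    (hH : ∀ a b, B (H a) b = B a (H b)) :
    LinearMap.trace ℝ (Vec n) (H * H) =
      ∑ i, ∑ j, lorentzSign i * lorentzSign j * B (H (e i)) (e j) ^ 2 := by
  obtain ⟨b, hb, hB⟩ := exists_lorentz_coordinates he
  rw [lorentz_trace_eq he]
  refine Finset.sum_congr rfl fun i _ => ?_
  rw [Module.End.mul_apply, hH, hB, Finset.mul_sum]
  refine Finset.sum_congr rfl fun j _ => ?_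
  rw [lorentz_apply_basis hb hB]
  have := lorentzSign_mul_self j
  linear_combination (-(lorentzSign i * lorentzSign j * (b.repr (H (e i)) j) ^ 2)) * this

/-- The difference of the two sides of the trace inequality as a sum of squares. The mixed terms
enter the trace of the square with a negative sign, which the term `2 ∑ h(0, α)²` compensates; this
is the only effect of the Lorentzian signature. -/
theorem sum_sq_identity {m : ℕ} {h : Fin (m + 1) → Fin (m + 1) → ℝ} (hs : ∀ i j, h i j = h j i) :
    2 * ∑ α : Fin m, h 0 α.succ ^ 2
      - ((∑ i, lorentzSign i * h i i) ^ 2 / (m + 1)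
        - ∑ i, ∑ j, lorentzSign i * lorentzSign j * h i j ^ 2) =
    ∑ i, (lorentzSign i * h i i - (∑ k, lorentzSign k * h k k) / (m + 1)) ^ 2
      + ∑ α : Fin m, ∑ β : Fin m, (if α = β then 0 else h α.succ β.succ ^ 2) := by
  have hm : (m : ℝ) + 1 ≠ 0 := by positivity
  set T := ∑ i, lorentzSign i * h i i with hT
  have h1 : ∑ i, (lorentzSign i * h i i - T / (m + 1)) ^ 2 =
      ∑ i, h i i ^ 2 - T ^ 2 / (m + 1) := by
    have : ∀ i, (lorentzSign i * h i i - T / (m + 1)) ^ 2 =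
        h i i ^ 2 - 2 * (T / (m + 1)) * (lorentzSign i * h i i) + (T / (m + 1)) ^ 2 := by
      intro i
      linear_combination (h i i ^ 2) * lorentzSign_mul_self i
    simp only [this, Finset.sum_add_distrib, Finset.sum_sub_distrib, ← Finset.mul_sum, ← hT]
    simp only [Finset.sum_const, Finset.card_univ, Fintype.card_fin, nsmul_eq_mul]
    push_cast
    field_simp
    ring
  have h2 : ∀ α : Fin m, ∑ β : Fin m, h α.succ β.succ ^ 2 = h α.succ α.succ ^ 2 +
      ∑ β : Fin m, (if α = β then 0 else h α.succ β.succ ^ 2) := by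
    intro α
    have : ∀ β : Fin m, h α.succ β.succ ^ 2 = (if α = β then h α.succ α.succ ^ 2 else 0) +
        (if α = β then 0 else h α.succ β.succ ^ 2) := by
      intro β
      split_ifs with hαβ
      · rw [hαβ, add_zero]
      · rw [zero_add]
    rw [Finset.sum_congr rfl fun β _ => this β, Finset.sum_add_distrib, Finset.sum_ite_eq]
    simp only [Finset.mem_univ, if_true]
  have h3 : ∑ i, ∑ j, lorentzSign i * lorentzSign j * h i j ^ 2 =
      h 0 0 ^ 2 - 2 * ∑ α : Fin m, h 0 α.succ ^ 2
        + ∑ α : Fin m, ∑ β : Fin m, h α.succ β.succ ^ 2 := by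
    have ls0 : lorentzSign (0 : Fin (m + 1)) = -1 := by simp [lorentzSign]
    have lsS : ∀ α : Fin m, lorentzSign α.succ = 1 := fun α => by simp [lorentzSign]
    have hsplit : ∀ i : Fin (m + 1), ∑ j, lorentzSign i * lorentzSign j * h i j ^ 2 =
        lorentzSign i * (-1) * h i 0 ^ 2 + lorentzSign i * ∑ β : Fin m, h i β.succ ^ 2 := by
      intro i
      rw [Fin.sum_univ_succ, ls0, Finset.mul_sum]
      simp only [lsS, mul_one]
    rw [Finset.sum_congr rfl fun i _ => hsplit i, Fin.sum_univ_succ, ls0]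
    simp only [lsS, Finset.sum_add_distrib]
    have h4 : ∑ α : Fin m, h α.succ 0 ^ 2 = ∑ α : Fin m, h 0 α.succ ^ 2 :=
      Finset.sum_congr rfl fun α _ => by rw [hs]
    simp only [one_mul, neg_mul, neg_neg, Finset.sum_neg_distrib]
    linear_combination -h4
  rw [h1, h3, Fin.sum_univ_succ]
  simp only [h2, Finset.sum_add_distrib]
  ring

/-- The trace inequality behind the Riccati comparison: up to the mixed terms, the trace of the
square of a self-adjoint endomorphism dominates the square of its trace divided by the dimension,
with equality only for multiples of the identity. -/
theorem lorentz_trace_inequality (he : IsLorentzOrthonormal (fun a b => B a b) e) (hn : 0 < n)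
    (hH : ∀ a b, B (H a) b = B a (H b)) (hsymm : ∀ a b, B a b = B b a) :
    LinearMap.trace ℝ (Vec n) H ^ 2 / n - LinearMap.trace ℝ (Vec n) (H * H) ≤
      2 * ∑ α ∈ Finset.univ.filter (fun α : Fin n => α.val ≠ 0),
        B (H (e ⟨0, hn⟩)) (e α) ^ 2 ∧
    ((∀ α : Fin n, α.val ≠ 0 → B (H (e ⟨0, hn⟩)) (e α) = 0) →
      (LinearMap.trace ℝ (Vec n) H ^ 2 / n - LinearMap.trace ℝ (Vec n) (H * H) = 0 ↔
        ∃ c : ℝ, ∀ v, H v = c • v)) := by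
  obtain ⟨m, rfl⟩ : ∃ m, n = m + 1 := ⟨n - 1, by omega⟩
  have hs : ∀ i j, B (H (e i)) (e j) = B (H (e j)) (e i) := fun i j => by rw [hH, hsymm]
  have key := sum_sq_identity (h := fun i j => B (H (e i)) (e j)) hs
  rw [← lorentz_trace_eq he, ← lorentz_trace_sq_eq he hH] at key
  have hfilter : ∑ α ∈ Finset.univ.filter (fun α : Fin (m + 1) => α.val ≠ 0),
      B (H (e ⟨0, hn⟩)) (e α) ^ 2 = ∑ α : Fin m, B (H (e 0)) (e α.succ) ^ 2 := by
    rw [Finset.sum_filter, Fin.sum_univ_succ]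
    simp
  have hcast : ((m + 1 : ℕ) : ℝ) = (m : ℝ) + 1 := by push_cast; ring
  rw [hfilter, hcast]
  set T := LinearMap.trace ℝ (Vec (m + 1)) H with hT
  have hp1 : ∀ i : Fin (m + 1), 0 ≤ (lorentzSign i * B (H (e i)) (e i) - T / (m + 1)) ^ 2 :=
    fun i => sq_nonneg _
  have hp2 : ∀ α β : Fin m, 0 ≤ (if α = β then 0 else B (H (e α.succ)) (e β.succ) ^ 2) := by
    intro α β; split_ifs <;> positivity
  have hS1 := Finset.sum_nonneg fun i (_ : i ∈ Finset.univ) => hp1 i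
  have hS2 := Finset.sum_nonneg fun α (_ : α ∈ Finset.univ) =>
    Finset.sum_nonneg fun β (_ : β ∈ Finset.univ) => hp2 α β
  refine ⟨by linarith, fun h0 => ?_⟩
  have hz : ∀ α : Fin m, B (H (e 0)) (e α.succ) = 0 := fun α => h0 α.succ (by simp)
  simp only [hz] at key
  constructor
  · intro hzero
    -- all squares vanish, so `H` is diagonal in the frame with equal eigenvalues `T / n`
    rw [hzero] at key
    simp only [ne_eq, OfNat.ofNat_ne_zero, not_false_eq_true, zero_pow, Finset.sum_const_zero,
      mul_zero, sub_zero] at key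
    have h1 := (Finset.sum_eq_zero_iff_of_nonneg fun i _ => hp1 i).1
      (le_antisymm (by linarith) hS1)
    have h2 := (Finset.sum_eq_zero_iff_of_nonneg fun α _ =>
      Finset.sum_nonneg fun β _ => hp2 α β).1 (le_antisymm (by linarith) hS2)
    have hd : ∀ i, lorentzSign i * B (H (e i)) (e i) = T / (m + 1) := fun i =>
      sub_eq_zero.1 (pow_eq_zero_iff (by norm_num) |>.1 (h1 i (Finset.mem_univ i)))
    have hoff : ∀ i j, i ≠ j → B (H (e i)) (e j) = 0 := by
      intro i j hij
      induction i using Fin.cases with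
      | zero =>
        induction j using Fin.cases with
        | zero => exact absurd rfl hij
        | succ β => exact hz β
      | succ α =>
        induction j using Fin.cases with
        | zero => rw [hs]; exact hz α
        | succ β =>
          have h3 := (Finset.sum_eq_zero_iff_of_nonneg fun β _ => hp2 α β).1
            (h2 α (Finset.mem_univ α)) β (Finset.mem_univ β)
          rw [if_neg (fun h => hij (by rw [h]))] at h3
          exact pow_eq_zero_iff (by norm_num) |>.1 h3
    obtain ⟨b, hb, hB⟩ := exists_lorentz_coordinates he
    have hrepr : ∀ i j, b.repr (H (e j)) i = lorentzSign i * B (H (e j)) (e i) := by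
      intro i j
      rw [lorentz_apply_basis hb hB, ← mul_assoc, lorentzSign_mul_self, one_mul]
    refine ⟨T / (m + 1), fun v => ?_⟩
    have hlin : H = (T / (m + 1)) • LinearMap.id := by
      refine b.ext fun j => b.ext_elem fun i => ?_
      rw [hb, hrepr, LinearMap.smul_apply, LinearMap.id_apply, map_smul, Finsupp.smul_apply]
      by_cases hij : j = i
      · subst hij
        rw [hd, ← hb]
        simp
      · rw [hoff j i hij, ← hb]
        simp [hij]
    rw [hlin]; rfl
  · rintro ⟨c, hc⟩
    have hlin : H = c • LinearMap.id := LinearMap.ext hc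
    have h1 : LinearMap.trace ℝ (Vec (m + 1)) H = c * (m + 1) := by
      rw [hlin, map_smul, LinearMap.trace_id]
      simp
    have h2 : LinearMap.trace ℝ (Vec (m + 1)) (H * H) = c ^ 2 * (m + 1) := by
      have : H * H = c ^ 2 • LinearMap.id := by
        refine LinearMap.ext fun v => ?_
        rw [Module.End.mul_apply, hc, hc, smul_smul, ← sq]; rfl
      rw [this, map_smul, LinearMap.trace_id]
      simp
    rw [h2, hT, h1]
    have hm : (m : ℝ) + 1 ≠ 0 := by positivity
    field_simp
    ring

end LorentzAlgebra

/-! ### The Hessian at a point -/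

theorem trace_toEuclideanLin {n : ℕ} (A : Matrix (Fin n) (Fin n) ℝ) :
    LinearMap.trace ℝ (Vec n) (Matrix.toEuclideanLin A) = ∑ i, A i i := by
  change LinearMap.trace ℝ (Vec n) (Matrix.toLpLin 2 2 A) = _
  rw [Matrix.toLpLin_eq_toLin, Matrix.trace_toLin_eq]; rfl

theorem trace_toEuclideanLin_mul_self {n : ℕ} (A : Matrix (Fin n) (Fin n) ℝ) :
    LinearMap.trace ℝ (Vec n) (Matrix.toEuclideanLin A * Matrix.toEuclideanLin A) =
      ∑ i, ∑ j, A i j * A j i := by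
  have h : Matrix.toEuclideanLin A * Matrix.toEuclideanLin A = Matrix.toEuclideanLin (A * A) := by
    change Matrix.toLpLin 2 2 A * Matrix.toLpLin 2 2 A = Matrix.toLpLin 2 2 (A * A)
    rw [Matrix.toLpLin_eq_toLin, Module.End.mul_eq_comp, ← Matrix.toLin_mul]
  rw [h, trace_toEuclideanLin]; rfl

theorem bilin_eq_sum {n : ℕ} (B : Vec n →L[ℝ] Vec n →L[ℝ] ℝ) (u v : Vec n) :
    B u v = ∑ i, ∑ j, u i * v j * B (EuclideanSpace.single i 1) (EuclideanSpace.single j 1) := by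
  conv_lhs => rw [vec_eq_sum_single u, vec_eq_sum_single v]
  simp only [map_sum, map_smul, sum_apply, smul_apply, smul_eq_mul, Finset.mul_sum]
  rw [Finset.sum_comm]
  exact Finset.sum_congr rfl fun i _ => Finset.sum_congr rfl fun j _ => by ring

theorem symm_chart_self {n : ℕ} {M : Type*} [TopologicalSpace M] [ChartedSpace (Vec n) M] (x : M) :
    (chartAt (Vec n) x).symm (chartAt (Vec n) x x) = x :=
  (chartAt (Vec n) x).left_inv (mem_chart_source (Vec n) x)

section Manifold

variable {n : ℕ} {M : Type*} [TopologicalSpace M] [ChartedSpace (Vec n) M]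
  [IsManifold (𝓡 n) ∞ M]

/-- At the centre of the chart at `x`, the chart identifies `T_xM` with `ℝⁿ` by the identity. -/
theorem mfderiv_symm_self (x : M) (v : Vec n) :
    (mfderiv (𝓡 n) (𝓡 n) (chartAt (Vec n) x).symm (chartAt (Vec n) x x) v : Vec n) = v :=
  (congrArg (mfderiv (𝓡 n) (𝓡 n) (chartAt (Vec n) x).symm (chartAt (Vec n) x x) :
    Vec n →L[ℝ] Vec n) (coordVec_self x v)).symm.trans
      (mfderiv_symm_coordVec x (mem_chart_source (Vec n) x) v)

theorem coordField_self (G : (y : M) → TangentSpace (𝓡 n) y) (x : M) :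
    coordField (chartAt (Vec n) x) G (chartAt (Vec n) x x) = G x := by
  rw [coordField, symm_chart_self, coordVec_self]

/-- The differential at `x` of a function which is given near `x` in the chart at `x`. -/
theorem diff_eq_of_chart {x : M} {u : M → ℝ} {g : Vec n → ℝ}
    (hg : DifferentiableAt ℝ g (chartAt (Vec n) x x))
    (hu : ∀ᶠ y in 𝓝 x, u y = g (chartAt (Vec n) x y)) (v : TangentSpace (𝓡 n) x) :
    FinslerSpacetime.diff u x v = fderiv ℝ g (chartAt (Vec n) x x) v := by
  have := isManifold_one (n := n) (M := M)
  have h1 : mfderiv (𝓡 n) 𝓘(ℝ, ℝ) u x =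
      mfderiv (𝓡 n) 𝓘(ℝ, ℝ) (g ∘ chartAt (Vec n) x) x :=
    Filter.EventuallyEq.mfderiv_eq hu
  have h2 := mfderiv_comp (I := 𝓡 n) (I' := 𝓡 n) (I'' := 𝓘(ℝ, ℝ)) x
    hg.mdifferentiableAt (mdifferentiableAt_atlas (I := 𝓡 n) (chart_mem_atlas (Vec n) x)
      (mem_chart_source (Vec n) x))
  rw [mfderiv_eq_fderiv] at h2
  have h3 := congrArg (fun L => L v) (h1.trans h2)
  exact h3.trans (congrArg (fderiv ℝ g (chartAt (Vec n) x x)) (coordVec_self x v))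

end Manifold

theorem FinslerST.FinslerSpacetime.gMat_coordL_self {n : ℕ} {M : Type*} [TopologicalSpace M]
    [ChartedSpace (Vec n) M] [IsManifold (𝓡 n) ∞ M] (S : FinslerSpacetime n M) (x : M) {v : Vec n}
    (hv : v ≠ 0) (i j : Fin n) :
    gMat (S.coordL (chartAt (Vec n) x)) (chartAt (Vec n) x x) v i j =
      fderiv ℝ (fderiv ℝ (S.fibreL x)) v
        (EuclideanSpace.single i (1 : ℝ)) (EuclideanSpace.single j (1 : ℝ)) := by
  have h := S.gMat_coordL x ((chartAt (Vec n) x).map_source (mem_chart_source (Vec n) x)) hv i j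
  rw [symm_chart_self] at h
  refine h.trans ?_
  have h1 := mfderiv_symm_self x v
  have h2 := mfderiv_symm_self x (EuclideanSpace.single i (1 : ℝ) : Vec n)
  have h3 := mfderiv_symm_self x (EuclideanSpace.single j (1 : ℝ) : Vec n)
  exact (congrArg (fun a : Vec n => fderiv ℝ (fderiv ℝ (S.fibreL x)) a _ _) h1).trans
    ((congrArg (fun a : Vec n => fderiv ℝ (fderiv ℝ (S.fibreL x)) v a _) h2).trans
      (congrArg (fun a : Vec n => fderiv ℝ (fderiv ℝ (S.fibreL x)) v _ a) h3))

namespace FinslerST.WeightedFinslerSpacetime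

variable {n : ℕ} {M : Type*} [TopologicalSpace M] [ChartedSpace (Vec n) M]
  [IsManifold (𝓡 n) ∞ M] [MeasurableSpace M] (S : WeightedFinslerSpacetime n M)

theorem contDiffOn_logDensity (x : M) :
    ContDiffOn ℝ ∞ (S.logDensity (chartAt (Vec n) x)) (chartAt (Vec n) x).target :=
  (Classical.epsilon_spec (p := IsLogDensity S.m (chartAt (Vec n) x))
    (S.m_smooth _ (IsManifold.chart_mem_maximalAtlas x))).1

variable {h : M → ℝ} {U : Set M}

theorem speedSq_eq (htemp : S.IsTemporalOn (fun y => -h y) U) {y : M} (hy : y ∈ U) :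
    S.speedSq h y = -2 * S.fibreL y (S.gradient h y) :=
  lorentzNorm_sq (S.gradient_timelike htemp hy).le

/-- The Hessian of `h` at `x` is a self-adjoint endomorphism of `(T_xM, g_{∇h})`, which determines
the differential of `F(∇h)²` and, by the weighted Bochner identity, the left-hand side of the
inequality. -/
theorem exists_hessian_endomorphism (hn : 0 < n) (hU : IsOpen U)
    (hh : ContMDiffOn (𝓡 n) 𝓘(ℝ, ℝ) 3 h U)
    (htemp : S.IsTemporalOn (fun y => -h y) U) {x : M} (hx : x ∈ U) :
    ∃ H : Vec n →ₗ[ℝ] Vec n, (∀ v, S.hessian h x v = H v) ∧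
      (∀ a b, fderiv ℝ (fderiv ℝ (S.fibreL x)) (S.gradient h x) (H a) b =
        fderiv ℝ (fderiv ℝ (S.fibreL x)) (S.gradient h x) a (H b)) ∧
      (∀ v : Vec n, FinslerSpacetime.diff (S.speedSq h) x v =
        -2 * fderiv ℝ (fderiv ℝ (S.fibreL x)) (S.gradient h x) v (H (S.gradient h x))) ∧
      S.wylieLHS h x = S.weight (chartAt (Vec n) x) h x 0 *
        (LinearMap.trace ℝ (Vec n) H ^ 2 / n - LinearMap.trace ℝ (Vec n) (H * H)
          - S.weightedRicci 0 x (S.gradient h x)) := by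
  obtain ⟨W, hxW, hWU, hV, hf, hfV⟩ := S.exists_isCoordField hU hh htemp hx
  have hΛ := S.isCoordLagrangian x
  have hl := S.isLorentzMinkowski_fibreL x
  have hG0 : (S.gradient h x : Vec n) ≠ 0 := hl.ne_zero (S.gradient_timelike htemp hx)
  set c := chartAt (Vec n) x with hc
  set V := coordField c (S.gradient h) with hVdef
  have hVx : V (c x) = S.gradient h x := coordField_self (S.gradient h) x
  have hcG : coordVec c x (S.gradient h x) = V (c x) := (coordVec_self x _).trans hVx.symm
  set A := hessMatrix (S.coordL c) V (c x) with hA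
  set G : Vec n := S.gradient h x with hG
  have hgB : ∀ i j, gMat (S.coordL c) (c x) (V (c x)) i j = fderiv ℝ (fderiv ℝ (S.fibreL x)) G
      (EuclideanSpace.single i (1 : ℝ)) (EuclideanSpace.single j (1 : ℝ)) := by
    intro i j
    rw [hVx]
    exact S.gMat_coordL_self x hG0 i j
  have hbil : ∀ a b, fderiv ℝ (fderiv ℝ (S.fibreL x)) G a b =
      ∑ i, ∑ j, a i * b j * gMat (S.coordL c) (c x) (V (c x)) i j := by
    intro a b
    simp only [hgB]
    exact bilin_eq_sum _ a b
  have hHcoord : ∀ (v : Vec n) i, Matrix.toEuclideanLin A v i = ∑ j, A i j * v j :=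
    fun v i => rfl
  have hspeed : ∀ q ∈ W, S.speedSq h (c.symm q) = -2 * S.coordL c q (V q) := by
    intro q hq
    rw [S.speedSq_eq htemp (hWU q hq), FinslerSpacetime.coordL_eq]
    exact congrArg (fun v => -2 * S.fibreL (c.symm q) v)
      (FinslerSpacetime.mfderiv_symm_coordField x (S.gradient h) (hV.subset hq)).symm
  refine ⟨Matrix.toEuclideanLin A, fun v => ?_, fun a b => ?_, fun v => ?_, ?_⟩
  · have h1 : S.hessian h x v = hessCoord (S.coordL c) V (c x) v :=
      congrArg (hessCoord (S.coordL c) V (c x)) (coordVec_self x v)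
    rw [h1]
    exact PiLp.ext fun i => hV.hessCoord_eq hΛ hxW v i
  · have hright : ∀ a b, fderiv ℝ (fderiv ℝ (S.fibreL x)) G a (Matrix.toEuclideanLin A b) =
        ∑ i, ∑ k, a i * b k * ∑ j, gMat (S.coordL c) (c x) (V (c x)) i j * A j k := by
      intro a b
      rw [hbil]
      refine Finset.sum_congr rfl fun i _ => ?_
      simp only [hHcoord, Finset.mul_sum, Finset.sum_mul]
      rw [Finset.sum_comm]
      exact Finset.sum_congr rfl fun k _ => Finset.sum_congr rfl fun j _ => by ring
    rw [hl.symm hG0, hright, hright, Finset.sum_comm]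
    refine Finset.sum_congr rfl fun i _ => Finset.sum_congr rfl fun k _ => ?_
    rw [hV.lower_hessMatrix_symm hΛ hf hfV hxW k i]
    ring
  · have hd : DifferentiableAt ℝ (fun q => S.coordL c q (V q)) (c x) :=
      hV.diffAt_comp hΛ hΛ.smooth hxW
    have hev : ∀ᶠ y in 𝓝 x, S.speedSq h y = -2 * S.coordL c (c y) (V (c y)) := by
      have hcx : ContinuousAt c x := c.continuousAt (mem_chart_source (Vec n) x)
      filter_upwards [hcx.eventually (hV.isOpen.mem_nhds hxW),
        c.open_source.mem_nhds (mem_chart_source (Vec n) x)] with y hy hys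
      rw [← hspeed _ hy, c.left_inv hys]
    rw [diff_eq_of_chart (g := fun q => -2 * S.coordL c q (V q)) (hd.const_mul _) hev v,
      fderiv_const_mul hd]
    have h1 : fderiv ℝ (fun q => S.coordL c q (V q)) (c x) v =
        ∑ m, v m * pd m (fun q => S.coordL c q (V q)) (c x) := by
      conv_lhs => rw [vec_eq_sum_single v, map_sum]
      exact Finset.sum_congr rfl fun m _ => by rw [map_smul]; rfl
    change -2 * fderiv ℝ (fun q => S.coordL c q (V q)) (c x) v = _
    rw [h1, hbil]
    congr 1
    refine Finset.sum_congr rfl fun m _ => ?_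
    rw [← hV.lower_accel hΛ hf hfV hxW m, Finset.mul_sum]
    refine Finset.sum_congr rfl fun l _ => ?_
    rw [hV.accel_eq hΛ hxW, hVx, ← hHcoord]
    ring
  · have hΦ := S.contDiffOn_logDensity x
    have hbo := hV.weighted_bochner hΛ hΦ (Nat.cast_ne_zero.2 hn.ne') hf hfV
      (u := (fun y => S.speedSq h y / 2) ∘ c.symm)
      (fun q hq => by
        change S.speedSq h (c.symm q) / 2 = _
        rw [hspeed q hq]; ring) hxW (w := S.weight c h x) (fun t => by
        rw [← hcG]; rfl)
    have hz : S.zeta c h x = geodesic (S.coordL c) (c x) (V (c x)) :=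
      congrArg (geodesic (S.coordL c) (c x)) hcG
    rw [trace_toEuclideanLin, trace_toEuclideanLin_mul_self, weightedRicci, hcG, ← hbo, ← hz]
    rfl

end FinslerST.WeightedFinslerSpacetime

/-! ### The inequality and its equality case -/

theorem lemma4p5 {n : ℕ} (hn : 2 ≤ n) {M : Type*} [TopologicalSpace M] [T2Space M]
    [SecondCountableTopology M] [ConnectedSpace M] [ChartedSpace (Vec n) M]
    [IsManifold (𝓡 n) ∞ M] [MeasurableSpace M] [BorelSpace M]
    (S : WeightedFinslerSpacetime n M) (hRic : S.RicciBoundedBelow 0 0)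
    (U : Set M) (hU : IsOpen U) (h : M → ℝ) (hh : ContMDiffOn (𝓡 n) 𝓘(ℝ, ℝ) 3 h U)
    (htemp : S.IsTemporalOn (fun y => -h y) U)
    (x : M) (hx : x ∈ U) (e : Fin n → TangentSpace (𝓡 n) x)
    (he : IsLorentzOrthonormal (fundTensor S.L x (S.gradient h x)) e)
    (he₁ : e ⟨0, by omega⟩ = (S.F x (S.gradient h x))⁻¹ • S.gradient h x) :
    S.wylieLHS h x ≤ S.wylieRHS h x e ∧
    ((∃ k : ℝ, ∀ y ∈ U, S.F y (S.gradient h y) = k) →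
      (S.wylieLHS h x = S.wylieRHS h x e ↔
        S.weightedRicci 0 x (S.gradient h x) = 0 ∧
          ∃ c : ℝ, ∀ v : TangentSpace (𝓡 n) x, S.hessian h x v = c • v)) := by
  have hn0 : 0 < n := by omega
  obtain ⟨H, hHess, hself, hdiff, hLHS⟩ := S.exists_hessian_endomorphism hn0 hU hh htemp hx
  have hl := S.isLorentzMinkowski_fibreL x
  have hGt := S.gradient_timelike htemp hx
  have hG0 : (S.gradient h x : Vec n) ≠ 0 := hl.ne_zero hGt
  set G : Vec n := S.gradient h x with hG
  set B := fderiv ℝ (fderiv ℝ (S.fibreL x)) G with hB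
  let e' : Fin n → Vec n := e
  have he' : IsLorentzOrthonormal (fun a b => B a b) e' := fun i j =>
    (S.fundTensor_eq hG0 (e i) (e j)).symm.trans (he i j)
  have hF : 0 < S.F x G := lorentzNorm_pos hGt
  have hGe : G = S.F x G • e' ⟨0, hn0⟩ := by
    have h1 : e' ⟨0, hn0⟩ = (S.F x G)⁻¹ • G := he₁
    rw [h1, smul_smul, mul_inv_cancel₀ hF.ne', one_smul]
  -- `d[F(∇h)²](e_α) = -2 g(e_α, ∇²h(∇h))`, and `∇h = F(∇h) e₁`
  have hdα : ∀ α, FinslerSpacetime.diff (S.speedSq h) x (e α) =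
      -2 * S.F x G * B (H (e' ⟨0, hn0⟩)) (e' α) := by
    intro α
    have h1 : H G = S.F x G • H (e' ⟨0, hn0⟩) := by
      conv_lhs => rw [hGe]
      rw [map_smul]
    refine (hdiff (e' α)).trans ?_
    rw [h1, map_smul, smul_eq_mul, hl.symm hG0]
    ring
  set w := S.weight (chartAt (Vec n) x) h x 0 with hw
  have hwpos : 0 < w := Real.exp_pos _
  have hRHS : S.wylieRHS h x e = w * (2 * ∑ α ∈ Finset.univ.filter (fun α : Fin n => α.val ≠ 0),
      B (H (e' ⟨0, hn0⟩)) (e' α) ^ 2) := by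
    have h1 : S.wylieRHS h x e = w / (2 * S.F x G ^ 2) *
      ∑ α ∈ Finset.univ.filter (fun α : Fin n => α.val ≠ 0),
        (FinslerSpacetime.diff (S.speedSq h) x (e α)) ^ 2 := rfl
    rw [h1, Finset.mul_sum, Finset.mul_sum, Finset.mul_sum]
    refine Finset.sum_congr rfl fun α _ => ?_
    rw [hdα]
    field_simp
  have hRic0 : 0 ≤ S.weightedRicci 0 x (S.gradient h x) := by
    have h1 := hRic x _ (S.gradient_spec htemp hx).1
    rwa [zero_mul] at h1
  obtain ⟨hineq, heq⟩ := lorentz_trace_inequality he' hn0 hself (hl.symm hG0)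
  set D := LinearMap.trace ℝ (Vec n) H ^ 2 / n - LinearMap.trace ℝ (Vec n) (H * H) with hD
  refine ⟨?_, ?_⟩
  · rw [hLHS, hRHS]
    exact mul_le_mul_of_nonneg_left (by linarith) hwpos.le
  · rintro ⟨k, hk⟩
    -- `d[F(∇h)²] = 0` kills the mixed terms of the Hessian
    have hzero : ∀ α, B (H (e' ⟨0, hn0⟩)) (e' α) = 0 := by
      intro α
      have h1 : FinslerSpacetime.diff (S.speedSq h) x (e α) = 0 := by
        refine (diff_eq_of_chart (g := fun _ => k ^ 2) (differentiableAt_const _)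
          (by filter_upwards [hU.mem_nhds hx] with y hy
              exact congrArg (· ^ 2) (hk y hy)) (e α)).trans ?_
        rw [fderiv_fun_const]; rfl
      rw [hdα] at h1
      have h2 : (-2 * S.F x G) ≠ 0 := by nlinarith
      exact (mul_eq_zero.1 h1).resolve_left h2
    have hR : S.wylieRHS h x e = 0 := by
      rw [hRHS, Finset.sum_eq_zero fun α _ => by rw [hzero]; norm_num]
      ring
    have hD0 : D ≤ 0 := by
      refine hineq.trans_eq ?_
      rw [Finset.sum_eq_zero fun α _ => by rw [hzero]; norm_num]
      ring
    have hiff := heq fun α _ => hzero α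
    have hHiff : (∃ c : ℝ, ∀ v : TangentSpace (𝓡 n) x, S.hessian h x v = c • v) ↔
        ∃ c : ℝ, ∀ v, H v = c • v :=
      exists_congr fun c => forall_congr' fun v =>
        ⟨fun h1 => (hHess v).symm.trans h1, fun h1 => (hHess v).trans h1⟩
    rw [hR, hHiff, ← hiff, hLHS, mul_eq_zero, or_iff_right hwpos.ne']
    constructor
    · intro h1
      exact ⟨by linarith, by linarith⟩
    · rintro ⟨h1, h2⟩
      rw [h2, h1, sub_zero]
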